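/- Let $G$ be a finite subgroup of $\mathrm{SL}(2,\mathbb C)$, let $V=\mathbb C^2$ be its natural representation, and let $\rho_i$ ($i\in I$) be the irreducible complex representations of $G$, one from each isomorphism class, with characters $\chi_i$, with $\delta_i=\dim\rho_i$, and with $\rho_0$ trivial. Let $Q$ be a quiver with vertex set $I$ obtained by choosing any orientation of the McKay graph of $G$, in which the number of edges between $i$ and $j$ is the multiplicity of $\rho_i$ in $V\otimes\rho_j$ (if $G$ is trivial, $Q$ is the quiver with one vertex and one loop). Put $R=\mathbb C[u]$, and let $\varepsilon_i=\frac{\delta_i}{|G|}\sum_{g\in G}\chi_i(g^{-1})\,g$ be the central idempotent of $\mathbb CG$ that corresponds to $\rho_i$. Then the map $$R^I\longrightarrow Z(RG),\qquad (\tau_i)_{i\in I}\longmapsto\sum_{i\in I}\frac{\tau_i}{\delta_i}\,\varepsilon_i$$ is a bijection onto the centre of $RG$; use it to identify $R^I$ with $Z(RG)$. For $\tau\in Z(RG)=R^I$ let $$A^\tau=\bigl(R\langle x,y\rangle\rtimes G\bigr)\big/(xy-yx-\tau),$$ where $R\langle x,y\rangle\rtimes G$ is the skew group algebra for the action of $G$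 on $R\langle x,y\rangle$ that is trivial on $R$ and is the natural representation on the span of $x$ and $y$. Let $e=|G|^{-1}\sum_{g\in G}g\in A^\tau$ and $C^\tau=eA^\tau e$. Let $\widehat Q$ be the quiver obtained from $Q$ by adding a reverse arrow $a^*\colon j\to i$ for each arrow $a\colon i\to j$ of $Q$ and a loop $u_i$ at each vertex $i$. Let $\mathbb C\widehat Q$ be its path algebra, in which $pq$ means first $q$ and then $p$, let $e_i$ be the trivial path at $i$, put $u=\sum_{i\in I}u_i$, and let $$\mathfrak A^\tau(Q)=\mathbb C\widehat Q\Big/\Bigl(\sum_{a\in Q}[a,a^*]-\sum_{i\in I}\tau_i(u)e_i,\ \ u\text{ is central}\Bigr)$$ be the $N=1$ ADE quiver algebra. Then for every $\tau$ the $\mathbb C$-algebras $A^\tau$ and $\mathfrak A^\tau(Q)$ are Morita equivalent, and $C^\tau\cong e_0\,\mathfrak A^\tau(Q)\,e_0$ as $\mathbb C$-algebras. -/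

import Mathlib

open Polynomial

universe u v

noncomputable section

/-! ## Path algebras -/

/-- The space with basis the paths of a quiver. The path `⟨i, j, p⟩` starts at its tail `i` and
ends at its head `j`; the paths of length zero are included. -/
def PathAlgebra (k : Type*) [CommRing k] (V : Type u) [Quiver.{v} V] : Type _ :=
  (Σ i j : V, Quiver.Path i j) →₀ k

namespace PathAlgebra

variable {k : Type*} [CommRing k] {V : Type u} [Quiver.{v} V]

instance : AddCommGroup (PathAlgebra k V) :=
  inferInstanceAs (AddCommGroup ((Σ i j : V, Quiver.Path i j) →₀ k))

instance : Module k (PathAlgebra k V) :=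
  inferInstanceAs (Module k ((Σ i j : V, Quiver.Path i j) →₀ k))

/-- The basis element given by a path. -/
def ofPath (k : Type*) [CommRing k] {V : Type u} [Quiver.{v} V] {i j : V}
    (p : Quiver.Path i j) : PathAlgebra k V :=
  Finsupp.single (⟨i, j, p⟩ : Σ i j : V, Quiver.Path i j) (1 : k)

/-- The trivial path `e_i`. -/
def vertex (k : Type*) [CommRing k] {V : Type u} [Quiver.{v} V] (i : V) : PathAlgebra k V :=
  ofPath k (Quiver.Path.nil : Quiver.Path i i)

/-- An arrow, as a path of length one. -/
def arrow (k : Type*) [CommRing k] {V : Type u} [Quiver.{v} V] {i j : V} (a : i ⟶ j) :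
    PathAlgebra k V :=
  ofPath k a.toPath

open Classical in
/-- The product `p q` of two paths: first `q`, then `p`, if `q` ends where `p` starts, and zero
otherwise. -/
def pathMul (k : Type*) [CommRing k] {V : Type u} [Quiver.{v} V]
    (p q : Σ i j : V, Quiver.Path i j) : PathAlgebra k V :=
  if h : q.2.1 = p.1 then ofPath k (q.2.2.comp (p.2.2.cast h.symm rfl)) else 0

/-- The bilinear extension of the product of paths. -/
def mulLin (k : Type*) [CommRing k] (V : Type u) [Quiver.{v} V] :
    PathAlgebra k V →ₗ[k] PathAlgebra k V →ₗ[k] PathAlgebra k V :=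
  Finsupp.linearCombination k
    (fun p => (Finsupp.linearCombination k (fun q => pathMul k p q) :
      PathAlgebra k V →ₗ[k] PathAlgebra k V))

instance : Mul (PathAlgebra k V) := ⟨fun x y => mulLin k V x y⟩

instance [Fintype V] : One (PathAlgebra k V) := ⟨∑ i : V, vertex k i⟩

theorem mul_eq_mulLin (x y : PathAlgebra k V) : x * y = mulLin k V x y := rfl

theorem one_eq_sum [Fintype V] : (1 : PathAlgebra k V) = ∑ i : V, vertex k i := rfl

theorem mulLin_ofPath {i j l m : V} (p : Quiver.Path i j) (q : Quiver.Path l m) :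
    mulLin k V (ofPath k p) (ofPath k q) = pathMul k ⟨i, j, p⟩ ⟨l, m, q⟩ :=
  (DFunLike.congr_fun ((Finsupp.linearCombination_single k (1 : k) _).trans (one_smul k _)) _).trans
    ((Finsupp.linearCombination_single k (1 : k) _).trans (one_smul k _))

/-- The product of composable paths is the composite path. -/
theorem ofPath_mul_ofPath {i j l : V} (p : Quiver.Path j l) (q : Quiver.Path i j) :
    ofPath k p * ofPath k q = ofPath k (q.comp p) := by
  rw [mul_eq_mulLin, mulLin_ofPath]
  simp [pathMul]

/-- The product of paths that cannot be composed is zero. -/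
theorem ofPath_mul_ofPath_of_ne {i j l m : V} (p : Quiver.Path l m) (q : Quiver.Path i j)
    (h : j ≠ l) : ofPath k p * ofPath k q = 0 := by
  rw [mul_eq_mulLin, mulLin_ofPath]
  simp [pathMul, h]

theorem add_mul_aux (x y z : PathAlgebra k V) : (x + y) * z = x * z + y * z := by
  simp [mul_eq_mulLin]

theorem mul_add_aux (x y z : PathAlgebra k V) : x * (y + z) = x * y + x * z := by
  simp [mul_eq_mulLin]

theorem smul_mul_aux (c : k) (x y : PathAlgebra k V) : (c • x) * y = c • (x * y) := by
  simp [mul_eq_mulLin]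

theorem mul_smul_aux (c : k) (x y : PathAlgebra k V) : x * (c • y) = c • (x * y) := by
  simp [mul_eq_mulLin]

theorem zero_mul_aux (x : PathAlgebra k V) : 0 * x = 0 := by
  simp [mul_eq_mulLin]

theorem mul_zero_aux (x : PathAlgebra k V) : x * 0 = 0 := by
  simp [mul_eq_mulLin]

/-- The paths span the path algebra. -/
theorem induction_path {P : PathAlgebra k V → Prop} (x : PathAlgebra k V) (h0 : P 0)
    (hadd : ∀ x y, P x → P y → P (x + y)) (hsmul : ∀ (c : k) x, P x → P (c • x))
    (hpath : ∀ {i j : V} (p : Quiver.Path i j), P (ofPath k p)) : P x := by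
  refine Finsupp.induction_linear x h0 hadd ?_
  rintro ⟨i, j, p⟩ c
  have h := hsmul c _ (hpath p)
  unfold ofPath at h
  erw [Finsupp.smul_single] at h
  simpa using h

theorem mul_assoc_aux (x y z : PathAlgebra k V) : x * y * z = x * (y * z) := by
  induction x using induction_path with
  | h0 => simp only [zero_mul_aux]
  | hadd a b ha hb => simp only [add_mul_aux, ha, hb]
  | hsmul c a ha => simp only [smul_mul_aux, ha]
  | hpath p =>
    rename_i i j
    induction y using induction_path with
    | h0 => simp only [zero_mul_aux, mul_zero_aux]
    | hadd a b ha hb => simp only [add_mul_aux, mul_add_aux, ha, hb]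
    | hsmul c a ha => simp only [smul_mul_aux, mul_smul_aux, ha]
    | hpath q =>
      rename_i l m
      induction z using induction_path with
      | h0 => simp only [mul_zero_aux]
      | hadd a b ha hb => simp only [mul_add_aux, ha, hb]
      | hsmul c a ha => simp only [mul_smul_aux, ha]
      | hpath r =>
        rename_i s t
        by_cases h1 : m = i
        · subst h1
          by_cases h2 : t = l
          · subst h2
            simp only [ofPath_mul_ofPath, Quiver.Path.comp_assoc]
          · rw [ofPath_mul_ofPath, ofPath_mul_ofPath_of_ne _ _ h2, ofPath_mul_ofPath_of_ne _ _ h2,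
              mul_zero_aux]
        · rw [ofPath_mul_ofPath_of_ne _ _ h1, zero_mul_aux]
          by_cases h2 : t = l
          · subst h2
            rw [ofPath_mul_ofPath, ofPath_mul_ofPath_of_ne _ _ h1]
          · rw [ofPath_mul_ofPath_of_ne _ _ h2, mul_zero_aux]

theorem one_mul_aux [Fintype V] (x : PathAlgebra k V) : 1 * x = x := by
  induction x using induction_path with
  | h0 => simp only [mul_zero_aux]
  | hadd a b ha hb => simp only [mul_add_aux, ha, hb]
  | hsmul c a ha => simp only [mul_smul_aux, ha]
  | hpath p =>
    rename_i i j
    rw [one_eq_sum, mul_eq_mulLin, map_sum, LinearMap.sum_apply, Finset.sum_eq_single j]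
    · rw [← mul_eq_mulLin, vertex, ofPath_mul_ofPath, Quiver.Path.comp_nil]
    · intro l _ hl
      rw [← mul_eq_mulLin, vertex, ofPath_mul_ofPath_of_ne _ _ hl.symm]
    · simp

theorem mul_one_aux [Fintype V] (x : PathAlgebra k V) : x * 1 = x := by
  induction x using induction_path with
  | h0 => simp only [zero_mul_aux]
  | hadd a b ha hb => simp only [add_mul_aux, ha, hb]
  | hsmul c a ha => simp only [smul_mul_aux, ha]
  | hpath p =>
    rename_i i j
    rw [one_eq_sum, mul_eq_mulLin, map_sum, Finset.sum_eq_single i]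
    · rw [← mul_eq_mulLin, vertex, ofPath_mul_ofPath, Quiver.Path.nil_comp]
    · intro l _ hl
      rw [← mul_eq_mulLin, vertex, ofPath_mul_ofPath_of_ne _ _ hl]
    · simp

instance [Fintype V] : Ring (PathAlgebra k V) where
  __ := (inferInstance : AddCommGroup (PathAlgebra k V))
  __ := (inferInstance : Mul (PathAlgebra k V))
  __ := (inferInstance : One (PathAlgebra k V))
  left_distrib := mul_add_aux
  right_distrib := add_mul_aux
  zero_mul := zero_mul_aux
  mul_zero := mul_zero_aux
  mul_assoc := mul_assoc_aux
  one_mul := one_mul_aux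
  mul_one := mul_one_aux

instance [Fintype V] : Algebra k (PathAlgebra k V) :=
  Algebra.ofModule smul_mul_aux mul_smul_aux

theorem vertex_mul_self [Fintype V] (i : V) : vertex k i * vertex k i = vertex k i := by
  rw [vertex, ofPath_mul_ofPath, Quiver.Path.comp_nil]

end PathAlgebra

/-! ## The `N = 1` quiver algebra -/

/-- The vertex set of a quiver `Q`, regarded as the vertex set of the quiver obtained from the
double of `Q` by attaching a loop at every vertex. -/
def HatQuiver (V : Type u) : Type u := V

instance {V : Type u} [Fintype V] : Fintype (HatQuiver V) := inferInstanceAs (Fintype V)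

/-- The arrows of the double of `Q` with a loop attached at every vertex: the arrows `a` of `Q`,
their reverses `a*`, and the loops `u_i`. -/
inductive HatQuiver.Arrow {V : Type u} [Quiver.{v} V] : V → V → Type (max u v)
  | arr {i j : V} (a : i ⟶ j) : HatQuiver.Arrow i j
  | rev {i j : V} (a : i ⟶ j) : HatQuiver.Arrow j i
  | loop (i : V) : HatQuiver.Arrow i i

instance {V : Type u} [Quiver.{v} V] : Quiver.{max u v} (HatQuiver V) where
  Hom i j := HatQuiver.Arrow (V := V) i j

namespace NOneQuiverAlgebra

variable (V : Type u) [Quiver.{v} V]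

/-- The trivial path `e_i`. -/
def e {V : Type u} [Quiver.{v} V] (i : V) : PathAlgebra ℂ (HatQuiver V) :=
  PathAlgebra.vertex ℂ (V := HatQuiver V) i

/-- The arrow `a` of `Q`. -/
def arr {V : Type u} [Quiver.{v} V] {i j : V} (a : i ⟶ j) : PathAlgebra ℂ (HatQuiver V) :=
  PathAlgebra.arrow ℂ (V := HatQuiver V) (i := i) (j := j) (HatQuiver.Arrow.arr a)

/-- The reverse arrow `a*` of an arrow `a` of `Q`. -/
def rev {V : Type u} [Quiver.{v} V] {i j : V} (a : i ⟶ j) : PathAlgebra ℂ (HatQuiver V) :=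
  PathAlgebra.arrow ℂ (V := HatQuiver V) (i := j) (j := i) (HatQuiver.Arrow.rev a)

/-- The loop `u_i`. -/
def loop {V : Type u} [Quiver.{v} V] (i : V) : PathAlgebra ℂ (HatQuiver V) :=
  PathAlgebra.arrow ℂ (V := HatQuiver V) (i := i) (j := i) (HatQuiver.Arrow.loop i)

variable [Fintype V]

/-- The element `u`, the sum of all the loops `u_i`. -/
def uElt : PathAlgebra ℂ (HatQuiver V) := ∑ i : V, loop i

/-- The defining relations: `∑ [a, a*] = ∑ τ_i(u) e_i`, and `u` is central. -/
inductive Rel [∀ i j : V, Fintype (i ⟶ j)] (τ : V → ℂ[X]) :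
    PathAlgebra ℂ (HatQuiver V) → PathAlgebra ℂ (HatQuiver V) → Prop
  | moment : Rel τ
      (∑ i : V, ∑ j : V, ∑ a : i ⟶ j, (arr a * rev a - rev a * arr a))
      (∑ i : V, aeval (uElt V) (τ i) * e i)
  | central (x : PathAlgebra ℂ (HatQuiver V)) : Rel τ (uElt V * x) (x * uElt V)

end NOneQuiverAlgebra

/-- The `N = 1` quiver algebra determined by a finite quiver and a polynomial for each vertex. -/
abbrev NOneQuiverAlgebra (V : Type u) [Quiver.{v} V] [Fintype V]
    [∀ i j : V, Fintype (i ⟶ j)] (τ : V → ℂ[X]) : Type _ :=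
  RingQuot (NOneQuiverAlgebra.Rel V τ)

namespace NOneQuiverAlgebra

variable {V : Type u} [Quiver.{v} V] [Fintype V] [∀ i j : V, Fintype (i ⟶ j)] (τ : V → ℂ[X])

/-- The image of the trivial path `e_i` in the `N = 1` quiver algebra. -/
def idem (i : V) : NOneQuiverAlgebra V τ := RingQuot.mkAlgHom ℂ (Rel V τ) (e i)

theorem isIdempotentElem_idem (i : V) : IsIdempotentElem (idem τ i) := by
  unfold IsIdempotentElem idem
  rw [← map_mul]
  exact congrArg _ (PathAlgebra.vertex_mul_self (V := HatQuiver V) i)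

end NOneQuiverAlgebra

/-! ## Corner algebras -/

/-- The corner `e A e` of a `k`-algebra `A` is a `k`-module. -/
instance IsIdempotentElem.Corner.instModule {k : Type*} [CommRing k] {A : Type*} [Ring A]
    [Algebra k A] {e : A} (he : IsIdempotentElem e) : Module k he.Corner where
  smul c x := ⟨c • x.1, by
    obtain ⟨a, ha⟩ := x.2
    exact ⟨c • a, by simp only [mul_smul_comm, smul_mul_assoc, ← ha]⟩⟩
  one_smul x := Subtype.ext (one_smul k x.1)
  mul_smul c d x := Subtype.ext (mul_smul c d x.1)
  smul_zero c := Subtype.ext (smul_zero c)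
  smul_add c x y := Subtype.ext (smul_add c x.1 y.1)
  add_smul c d x := Subtype.ext (add_smul c d x.1)
  zero_smul x := Subtype.ext (zero_smul k x.1)

/-- The corner `e A e` of a `k`-algebra `A` is a `k`-algebra, with unit element `e`. -/
instance IsIdempotentElem.Corner.instAlgebra {k : Type*} [CommRing k] {A : Type*} [Ring A]
    [Algebra k A] {e : A} (he : IsIdempotentElem e) : Algebra k he.Corner :=
  Algebra.ofModule (fun c x y => Subtype.ext (smul_mul_assoc c x.1 y.1))
    (fun c x y => Subtype.ext (mul_smul_comm c x.1 y.1))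

/-! ## The deformed skew group algebra -/

/-- The special linear group acts on noncommutative polynomials in `x = x_0` and `y = x_1` with
coefficients in `ℂ[u]` by linear substitutions, `x_j ↦ ∑ i, g i j x_i`, so that the span of `x`
and `y` is the natural representation; it acts trivially on the coefficients. -/
def slSubst (g : Matrix.SpecialLinearGroup (Fin 2) ℂ) :
    FreeAlgebra ℂ[X] (Fin 2) →ₐ[ℂ[X]] FreeAlgebra ℂ[X] (Fin 2) :=
  FreeAlgebra.lift ℂ[X]
    (fun j => ∑ i : Fin 2, C (g.1 i j) • FreeAlgebra.ι ℂ[X] i)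

theorem slSubst_one : slSubst 1 = AlgHom.id ℂ[X] _ := by
  refine FreeAlgebra.hom_ext (funext fun j => ?_)
  fin_cases j <;> simp [slSubst]

theorem slSubst_mul (g h : Matrix.SpecialLinearGroup (Fin 2) ℂ) :
    slSubst (g * h) = (slSubst g).comp (slSubst h) := by
  refine FreeAlgebra.hom_ext (funext fun j => ?_)
  simp only [slSubst, Function.comp_apply, AlgHom.comp_apply, FreeAlgebra.lift_ι_apply, map_add,
    map_smul, Fin.sum_univ_two, Matrix.SpecialLinearGroup.coe_mul, Matrix.mul_apply, C_mul]
  module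

instance : MulSemiringAction (Matrix.SpecialLinearGroup (Fin 2) ℂ) (FreeAlgebra ℂ[X] (Fin 2)) where
  smul g f := slSubst g f
  one_smul f := congrArg (fun φ => φ f) slSubst_one
  mul_smul g h f := congrArg (fun φ => φ f) (slSubst_mul g h)
  smul_zero g := map_zero (slSubst g)
  smul_add g := map_add (slSubst g)
  smul_one g := map_one (slSubst g)
  smul_mul g := map_mul (slSubst g)

theorem sl_smul_def (g : Matrix.SpecialLinearGroup (Fin 2) ℂ) (f : FreeAlgebra ℂ[X] (Fin 2)) :
    g • f = slSubst g f := rfl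

instance : SMulCommClass (Matrix.SpecialLinearGroup (Fin 2) ℂ) ℂ (FreeAlgebra ℂ[X] (Fin 2)) where
  smul_comm g c f := by
    simp only [sl_smul_def]
    exact map_smul ((slSubst g).restrictScalars ℂ) c f

section

variable (G : Subgroup (Matrix.SpecialLinearGroup (Fin 2) ℂ))

instance : SMulCommClass G ℂ (FreeAlgebra ℂ[X] (Fin 2)) where
  smul_comm g c f := smul_comm (g : Matrix.SpecialLinearGroup (Fin 2) ℂ) c f

/-- The skew group algebra of `G` with coefficients in the algebra of noncommutative polynomials
in `x` and `y` over `ℂ[u]`. -/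
abbrev SkewGroupAlgebra : Type := SkewMonoidAlgebra (FreeAlgebra ℂ[X] (Fin 2)) G

/-- The inclusion of the group algebra over `ℂ[u]` in the skew group algebra. -/
def ofGroupAlgebra (z : MonoidAlgebra ℂ[X] G) : SkewGroupAlgebra G :=
  Finsupp.sum z.coeff fun g r => SkewMonoidAlgebra.single g (algebraMap ℂ[X] _ r)

/-- The defining relation `x y - y x = z`. -/
inductive DeformedSkewRel (z : MonoidAlgebra ℂ[X] G) :
    SkewGroupAlgebra G → SkewGroupAlgebra G → Prop
  | comm : DeformedSkewRel z
      (SkewMonoidAlgebra.single 1 (FreeAlgebra.ι ℂ[X] 0 * FreeAlgebra.ι ℂ[X] 1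
        - FreeAlgebra.ι ℂ[X] 1 * FreeAlgebra.ι ℂ[X] 0))
      (ofGroupAlgebra G z)

/-- The quotient of the skew group algebra by the relation `x y - y x = z`. -/
abbrev DeformedSkewAlgebra (z : MonoidAlgebra ℂ[X] G) : Type := RingQuot (DeformedSkewRel G z)

instance DeformedSkewAlgebra.instRing (z : MonoidAlgebra ℂ[X] G) :
    Ring (DeformedSkewAlgebra G z) :=
  RingQuot.instRing (R := SkewGroupAlgebra G) _

/-- The image of a group element. -/
def groupElt (z : MonoidAlgebra ℂ[X] G) : G →* DeformedSkewAlgebra G z :=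
  (RingQuot.mkAlgHom ℂ (DeformedSkewRel G z)).toMonoidHom.comp (SkewMonoidAlgebra.of _ G)

/-- The averaging idempotent `|G|⁻¹ ∑ g`. -/
def averaging [Fintype G] (z : MonoidAlgebra ℂ[X] G) : DeformedSkewAlgebra G z :=
  (Fintype.card G : ℂ)⁻¹ • ∑ g : G, groupElt G z g

theorem isIdempotentElem_averaging [Fintype G] (z : MonoidAlgebra ℂ[X] G) :
    IsIdempotentElem (averaging G z) := by
  have h : ∀ g : G, groupElt G z g * ∑ h : G, groupElt G z h = ∑ h : G, groupElt G z h := by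
    intro g
    rw [Finset.mul_sum]
    simp only [← map_mul]
    exact Fintype.sum_equiv (Equiv.mulLeft g) _ _ (fun _ => rfl)
  have hc : (Fintype.card G : ℂ) ≠ 0 := Nat.cast_ne_zero.mpr Fintype.card_ne_zero
  unfold IsIdempotentElem averaging
  rw [smul_mul_smul_comm, Finset.sum_mul, Finset.sum_congr rfl (fun g _ => h g),
    Finset.sum_const, Finset.card_univ, ← Nat.cast_smul_eq_nsmul ℂ, smul_smul]
  congr 1
  field_simp

/-! ## Irreducible representations and the McKay quiver -/

/-- The natural two-dimensional representation. -/
def naturalRep : Representation ℂ G (Fin 2 → ℂ) where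
  toFun g := Matrix.toLin' (g : Matrix.SpecialLinearGroup (Fin 2) ℂ).1
  map_one' := by simp [Module.End.one_eq_id]
  map_mul' g h := by simp [Matrix.toLin'_mul, Module.End.mul_eq_comp]

end

/-- A family of representations, the `i`-th one of dimension `δ i`, that contains every
irreducible representation exactly once up to isomorphism. -/
structure IsCompleteIrreps {H : Type*} [Group H] {I : Type*} {δ : I → ℕ}
    (ρ : ∀ i, Representation ℂ H (Fin (δ i) → ℂ)) : Prop where
  irreducible : ∀ i, (ρ i).IsIrreducible
  eq_of_equiv : ∀ i j, Nonempty ((ρ i).Equiv (ρ j)) → i = j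
  exists_equiv : ∀ (d : ℕ) (σ : Representation ℂ H (Fin d → ℂ)), σ.IsIrreducible →
    ∃ i, Nonempty (σ.Equiv (ρ i))

/-- The central idempotent `(δ_i / |H|) ∑ χ_i(g⁻¹) g` of the group algebra that corresponds to the
irreducible representation `ρ_i`: it acts as the identity on `ρ_i` and as zero on the other
irreducible representations. -/
def centralIdempotent {H : Type*} [Group H] [Fintype H] {d : ℕ}
    (ρ : Representation ℂ H (Fin d → ℂ)) : MonoidAlgebra ℂ[X] H :=
  ∑ g : H, MonoidAlgebra.single g (C ((d : ℂ) / Fintype.card H * ρ.character g⁻¹))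

/-- The element `∑ (τ_i / δ_i) ε_i` of the group algebra over `ℂ[u]`, where `ε_i` is the central
idempotent that corresponds to `ρ_i`. -/
def centralElement {H : Type*} [Group H] [Fintype H] {I : Type*} [Fintype I] {δ : I → ℕ}
    (ρ : ∀ i, Representation ℂ H (Fin (δ i) → ℂ)) (τ : I → ℂ[X]) : MonoidAlgebra ℂ[X] H :=
  ∑ i, (C ((δ i : ℂ)⁻¹) * τ i) • centralIdempotent (ρ i)

/-- The quiver is an orientation of the McKay graph of `G` with respect to the irreducible
representations `ρ`: between `i` and `j` there are as many arrows, of either direction, as the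
multiplicity of `ρ_i` in `V ⊗ ρ_j`, with `V` the natural representation. A loop is counted
twice; loops occur only for the trivial group, where there is exactly one. -/
def IsMcKayQuiver (G : Subgroup (Matrix.SpecialLinearGroup (Fin 2) ℂ)) {I : Type u}
    [Quiver.{v} I] [∀ i j : I, Fintype (i ⟶ j)] {δ : I → ℕ}
    (ρ : ∀ i, Representation ℂ G (Fin (δ i) → ℂ)) : Prop :=
  ∀ i j : I, Fintype.card (i ⟶ j) + Fintype.card (j ⟶ i) =
    Module.finrank ℂ ((ρ i).IntertwiningMap ((naturalRep G).tprod (ρ j)))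

end

/-! By Maschke and Schur the group algebra `ℂG` has matrix units `E^i_{pq}` (`matUnit`), one block
for each irreducible `ρ_i`, and the `E^i_{pp}` sum to one. The statement on the centre follows from
them: a central element multiplies every `E^i_{pp}` of a block by one and the same polynomial. For
the rest, fix an index `o_i` in each block and put `f = ∑ E^i_{o_i o_i}`. This idempotent is full,
since `E^i_{pp} = E^i_{p o_i} f E^i_{o_i p}`. The heart of the proof is that `f A^τ f` is the quiver
algebra, with `e_i` corresponding to `E^i_{o_i o_i}`.

The degree-one part of `f A^τ f` between the vertices `i` and `j` is spanned by the elements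
`E^j_{o_j p} x_k E^i_{q o_i}`, which are governed by `Hom_G(ρ_i, V ⊗ ρ_j)` (`natHom`). As `G`
preserves the symplectic form of `V`, this space is dual to `Hom_G(ρ_j, V ⊗ ρ_i)` under an
antisymmetric pairing. By the McKay condition its dimension is the number of arrows of the double of
`Q` from `i` to `j`, so one can choose elements `c_a`, one for each arrow `a` of the double, with
`⟨c_a, c_{a*}⟩ = ±1` and all other pairings zero (`IsDualSystem`). When `i = j` this is a symplectic
basis. For two composable arrows the symplectic contraction of `c_a` and `c_b` intertwines
irreducible representations, so Schur's lemma makes it zero or the scalar `⟨c_a, c_b⟩ / δ_i`. Hence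
compressing `xy - yx = τ` by `E^i_{o_i o_i}` gives the relation of the quiver algebra at `i`, the
factor `1/δ_i` being the one in the identification of `R^I` with the centre (`corner_commutator`).

This gives a map `ψ` from the quiver algebra to `A^τ` with `ψ 1 = f`. Its image is `f A^τ f`,
because inserting `1 = ∑ E^l_{rr}` into products reduces everything to generators. For injectivity,
`A^τ` is made to act by block matrices over the quiver algebra (`exists_block_hom`), and the
composite with `ψ` places each `e_j b e_i` in a block of its own. A full corner is Morita equivalent
to the whole algebra (`IsFullCorner.isMoritaEquivalent`), and `ψ` carries `e_0` to the averaging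
idempotent, which gives the isomorphism of corners. -/

noncomputable section

/-! ## Matrix units of the group algebra -/

namespace Representation

variable {H : Type*} [Group H] {d : ℕ}

/-- The matrix of a group element in a representation on `Fin d → ℂ`. -/
def mat (σ : Representation ℂ H (Fin d → ℂ)) (g : H) : Matrix (Fin d) (Fin d) ℂ :=
  LinearMap.toMatrix' (σ g)

variable (σ : Representation ℂ H (Fin d → ℂ))

theorem mat_one : σ.mat 1 = 1 := by
  simp [mat, Module.End.one_eq_id]

theorem mat_mul (g h : H) : σ.mat (g * h) = σ.mat g * σ.mat h := by
  simp [mat, Module.End.mul_eq_comp, LinearMap.toMatrix'_comp]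

theorem toLin'_mat (g : H) : Matrix.toLin' (σ.mat g) = σ g :=
  Matrix.toLin'_toMatrix' _

theorem mat_mul_mat_inv (g : H) : σ.mat g * σ.mat g⁻¹ = 1 := by
  rw [← mat_mul, mul_inv_cancel, mat_one]

theorem mat_inv_mul_mat (g : H) : σ.mat g⁻¹ * σ.mat g = 1 := by
  rw [← mat_mul, inv_mul_cancel, mat_one]

theorem character_eq_sum_mat (g : H) : σ.character g = ∑ p, σ.mat g p p := by
  rw [Representation.character, LinearMap.trace_eq_matrix_trace ℂ (Pi.basisFun ℂ (Fin d)),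
    LinearMap.toMatrix_eq_toMatrix']
  rfl

/-- A matrix that commutes with the group action is an intertwining map. -/
def intertwiningMapOfMatrix {m n : ℕ} (σ : Representation ℂ H (Fin m → ℂ))
    (τ : Representation ℂ H (Fin n → ℂ)) (S : Matrix (Fin n) (Fin m) ℂ)
    (hS : ∀ g, S * σ.mat g = τ.mat g * S) : IntertwiningMap σ τ where
  toLinearMap := Matrix.toLin' S
  isIntertwining' g := by
    rw [← toLin'_mat σ, ← toLin'_mat τ, ← Matrix.toLin'_mul, ← Matrix.toLin'_mul, hS]

/-- Averaging over the group turns any matrix into an intertwiner: substitute `g⁻¹h` for `h`. -/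
theorem sum_mat_mul_mat_inv_comm [Fintype H] {m n : ℕ} (σ : Representation ℂ H (Fin m → ℂ))
    (τ : Representation ℂ H (Fin n → ℂ)) (T : Matrix (Fin n) (Fin m) ℂ) (g : H) :
    (∑ h, τ.mat h * T * σ.mat h⁻¹) * σ.mat g = τ.mat g * ∑ h, τ.mat h * T * σ.mat h⁻¹ := by
  rw [Matrix.sum_mul, Matrix.mul_sum]
  refine Fintype.sum_equiv (Equiv.mulLeft g⁻¹) _ _ fun h => ?_
  simp only [Equiv.coe_mulLeft, mul_inv_rev, inv_inv, mat_mul, Matrix.mul_assoc]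
  rw [← Matrix.mul_assoc (τ.mat g), mat_mul_mat_inv, Matrix.one_mul]

theorem eq_zero_of_comm {m n : ℕ} {σ : Representation ℂ H (Fin m → ℂ)}
    {τ : Representation ℂ H (Fin n → ℂ)} (hσ : σ.IsIrreducible) (hτ : τ.IsIrreducible)
    (h : IsEmpty (σ.Equiv τ)) (S : Matrix (Fin n) (Fin m) ℂ)
    (hS : ∀ g, S * σ.mat g = τ.mat g * S) : S = 0 := by
  have h1 := congrArg IntertwiningMap.toLinearMap
    (Subsingleton.elim (intertwiningMapOfMatrix σ τ S hS) 0)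
  exact Matrix.toLin'.injective (h1.trans (map_zero Matrix.toLin').symm)

theorem sum_mat_mul_mat_inv_of_ne [Fintype H] {m n : ℕ} {σ : Representation ℂ H (Fin m → ℂ)}
    {τ : Representation ℂ H (Fin n → ℂ)} (hσ : σ.IsIrreducible) (hτ : τ.IsIrreducible)
    (h : IsEmpty (σ.Equiv τ)) (T : Matrix (Fin n) (Fin m) ℂ) :
    ∑ g, τ.mat g * T * σ.mat g⁻¹ = 0 :=
  eq_zero_of_comm hσ hτ h _ (sum_mat_mul_mat_inv_comm σ τ T)

theorem exists_smul_one_of_comm {σ : Representation ℂ H (Fin d → ℂ)} (hσ : σ.IsIrreducible)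
    (S : Matrix (Fin d) (Fin d) ℂ) (hS : ∀ g, S * σ.mat g = σ.mat g * S) :
    ∃ c : ℂ, S = c • (1 : Matrix (Fin d) (Fin d) ℂ) := by
  obtain ⟨c, hc⟩ := (IsIrreducible.algebraMap_intertwiningMap_bijective_of_isAlgClosed
    (k := ℂ) (ρ := σ)).2 (intertwiningMapOfMatrix σ σ S hS)
  refine ⟨c, Matrix.toLin'.injective ?_⟩
  rw [map_smul, Matrix.toLin'_one]
  exact (congrArg IntertwiningMap.toLinearMap hc).symm

theorem IsIrreducible.dim_pos {σ : Representation ℂ H (Fin d → ℂ)} (hσ : σ.IsIrreducible) :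
    0 < d := by
  rcases Nat.eq_zero_or_pos d with rfl | h
  · obtain ⟨a, b, hab⟩ := hσ.toNontrivial.exists_pair_ne
    refine absurd ?_ hab
    ext x
    rw [Subsingleton.elim x 0]
    exact iff_of_true a.toSubmodule.zero_mem b.toSubmodule.zero_mem
  · exact h

/-- Schur's lemma leaves a scalar, and the trace identifies it. This is the source of every factor
`1/δ_i` below. -/
theorem eq_trace_smul_one_of_comm {σ : Representation ℂ H (Fin d → ℂ)} (hσ : σ.IsIrreducible)
    (S : Matrix (Fin d) (Fin d) ℂ) (hS : ∀ g, S * σ.mat g = σ.mat g * S) :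
    S = (S.trace / d) • (1 : Matrix (Fin d) (Fin d) ℂ) := by
  obtain ⟨c, rfl⟩ := exists_smul_one_of_comm hσ S hS
  have : (d : ℂ) ≠ 0 := Nat.cast_ne_zero.mpr hσ.dim_pos.ne'
  simp [this]

theorem sum_mat_mul_mat_inv_self [Fintype H] {σ : Representation ℂ H (Fin d → ℂ)}
    (hσ : σ.IsIrreducible) (T : Matrix (Fin d) (Fin d) ℂ) :
    ∑ g, σ.mat g * T * σ.mat g⁻¹ =
      ((Fintype.card H : ℂ) * T.trace / d) • (1 : Matrix (Fin d) (Fin d) ℂ) := by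
  rw [eq_trace_smul_one_of_comm hσ _ (sum_mat_mul_mat_inv_comm σ σ T)]
  congr 2
  rw [Matrix.trace_sum]
  have : ∀ g, (σ.mat g * T * σ.mat g⁻¹).trace = T.trace := fun g => by
    rw [Matrix.trace_mul_comm, ← Matrix.mul_assoc, mat_inv_mul_mat, Matrix.one_mul]
  simp [this]

end Representation

open Representation

/-- The element of an algebra in which a group is represented by `f` that acts, in the irreducible
representation `σ`, as the matrix unit with a one in place `p q`. -/
def matUnit {H : Type*} [Group H] [Fintype H] {S : Type*} [Ring S] [Algebra ℂ S] (f : H →* S)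
    {d : ℕ} (σ : Representation ℂ H (Fin d → ℂ)) (p q : Fin d) : S :=
  ∑ g : H, ((d : ℂ) / Fintype.card H * σ.mat g⁻¹ q p) • f g

section MatUnit

variable {H : Type*} [Group H] [Fintype H] {S : Type*} [Ring S] [Algebra ℂ S] (f : H →* S)
  {d : ℕ} (σ : Representation ℂ H (Fin d → ℂ))

theorem map_matUnit {S' : Type*} [Ring S'] [Algebra ℂ S'] (φ : S →ₐ[ℂ] S') (p q : Fin d) :
    φ (matUnit f σ p q) = matUnit ((φ : S →* S').comp f) σ p q := by
  simp [matUnit]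

/-- Reindex by `h ↦ gh` and split `σ(h⁻¹) = σ((gh)⁻¹) σ(g)`. Each column of units thus transforms as
`σ` does, and irreducibility plays no part. -/
theorem mul_matUnit (g : H) (q s : Fin d) :
    f g * matUnit f σ q s = ∑ q', σ.mat g q' q • matUnit f σ q' s := by
  simp only [matUnit, Finset.mul_sum, Finset.smul_sum, mul_smul_comm, ← map_mul, smul_smul]
  rw [Finset.sum_comm]
  refine Fintype.sum_equiv (Equiv.mulLeft g) _ _ fun h => ?_
  rw [← Finset.sum_smul]
  congr 1
  have : σ.mat h⁻¹ = σ.mat (g * h)⁻¹ * σ.mat g := by rw [← mat_mul]; simp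
  rw [this, Matrix.mul_apply, Finset.mul_sum]
  exact Finset.sum_congr rfl fun x _ => by simp only [Equiv.coe_mulLeft]; ring

theorem matUnit_mul (g : H) (q s : Fin d) :
    matUnit f σ q s * f g = ∑ s', σ.mat g s s' • matUnit f σ q s' := by
  simp only [matUnit, Finset.sum_mul, Finset.smul_sum, smul_mul_assoc, ← map_mul, smul_smul]
  rw [Finset.sum_comm]
  refine Fintype.sum_equiv (Equiv.mulRight g) _ _ fun h => ?_
  rw [← Finset.sum_smul]
  congr 1
  have : σ.mat h⁻¹ = σ.mat g * σ.mat (h * g)⁻¹ := by rw [← mat_mul]; simp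
  rw [this, Matrix.mul_apply, Finset.mul_sum]
  exact Finset.sum_congr rfl fun x _ => by simp only [Equiv.coe_mulRight]; ring

variable {σ}

/-- Schur orthogonality, read off from the average of the elementary matrix in place `r q`. -/
theorem sum_mat_inv_mul_mat_self (hσ : σ.IsIrreducible) (p q r s : Fin d) :
    ∑ g, (d : ℂ) / Fintype.card H * σ.mat g⁻¹ q p * σ.mat g s r =
      if q = r ∧ s = p then 1 else 0 := by
  have h1 := congrFun (congrFun (sum_mat_mul_mat_inv_self hσ (Matrix.single r q 1)) s) p
  have h3 : (Matrix.single r q (1 : ℂ)).trace = if q = r then 1 else 0 := by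
    by_cases hqr : q = r
    · subst hqr; simp
    · simp [hqr, Matrix.trace_single_eq_of_ne r q _ (Ne.symm hqr)]
  rw [Matrix.sum_apply, h3] at h1
  have h2 : ∀ g, (σ.mat g * Matrix.single r q (1 : ℂ) * σ.mat g⁻¹) s p =
      σ.mat g⁻¹ q p * σ.mat g s r := fun g => by
    rw [Matrix.mul_apply, Finset.sum_eq_single q]
    · simp [mul_comm]
    · intro b _ hb
      simp [hb]
    · simp
  simp only [h2] at h1
  simp only [mul_assoc]
  rw [← Finset.mul_sum, h1]
  have hd : (d : ℂ) ≠ 0 := Nat.cast_ne_zero.mpr hσ.dim_pos.ne'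
  have hc : (Fintype.card H : ℂ) ≠ 0 := Nat.cast_ne_zero.mpr Fintype.card_ne_zero
  by_cases hqr : q = r <;> by_cases hrp : s = p <;> simp [hqr, hrp]
  field_simp

theorem sum_mat_inv_mul_mat_of_ne {m : ℕ} {τ : Representation ℂ H (Fin m → ℂ)}
    (hσ : σ.IsIrreducible) (hτ : τ.IsIrreducible) (h : IsEmpty (σ.Equiv τ))
    (p q : Fin d) (r s : Fin m) :
    ∑ g, (d : ℂ) / Fintype.card H * σ.mat g⁻¹ q p * τ.mat g s r = 0 := by
  have h1 := congrFun (congrFun (sum_mat_mul_mat_inv_of_ne hσ hτ h (Matrix.single r q 1)) s) p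
  rw [Matrix.sum_apply] at h1
  have h2 : ∀ g, (τ.mat g * Matrix.single r q (1 : ℂ) * σ.mat g⁻¹) s p =
      σ.mat g⁻¹ q p * τ.mat g s r := fun g => by
    rw [Matrix.mul_apply, Finset.sum_eq_single q]
    · simp [mul_comm]
    · intro b _ hb
      simp [hb]
    · simp
  simp only [h2] at h1
  simp only [mul_assoc]
  rw [← Finset.mul_sum, h1]
  simp

theorem matUnit_mul_matUnit (hσ : σ.IsIrreducible) (p q r s : Fin d) :
    matUnit f σ p q * matUnit f σ r s = if q = r then matUnit f σ p s else 0 := by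
  conv_lhs => enter [1]; rw [matUnit]
  simp only [Finset.sum_mul, smul_mul_assoc, mul_matUnit, Finset.smul_sum, smul_smul]
  rw [Finset.sum_comm]
  simp only [← Finset.sum_smul, sum_mat_inv_mul_mat_self hσ]
  by_cases hqr : q = r <;> simp [hqr]

theorem matUnit_mul_matUnit_of_ne {m : ℕ} {τ : Representation ℂ H (Fin m → ℂ)}
    (hσ : σ.IsIrreducible) (hτ : τ.IsIrreducible) (h : IsEmpty (σ.Equiv τ))
    (p q : Fin d) (r s : Fin m) : matUnit f σ p q * matUnit f τ r s = 0 := by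
  conv_lhs => enter [1]; rw [matUnit]
  simp only [Finset.sum_mul, smul_mul_assoc, mul_matUnit, Finset.smul_sum, smul_smul]
  rw [Finset.sum_comm]
  simp only [← Finset.sum_smul, sum_mat_inv_mul_mat_of_ne hσ hτ h]
  simp

theorem sum_matUnit_self : ∑ p, matUnit f σ p p =
    ∑ g : H, ((d : ℂ) / Fintype.card H * σ.character g⁻¹) • f g := by
  simp only [matUnit]
  rw [Finset.sum_comm]
  simp only [← Finset.sum_smul, ← Finset.mul_sum, character_eq_sum_mat]

end MatUnit

/-! ## Completeness -/

/-- Every simple module is the quotient by a maximal left ideal and is finite dimensional, so such a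
`z` lies in every maximal left ideal, that is in the Jacobson radical. By Maschke's theorem the
radical is zero. -/
theorem MonoidAlgebra.eq_zero_of_forall_irreducible {H : Type*} [Group H] [Finite H]
    (z : MonoidAlgebra ℂ H)
    (hz : ∀ (d : ℕ) (σ : Representation ℂ H (Fin d → ℂ)), σ.IsIrreducible →
      σ.asAlgebraHom z = 0) : z = 0 := by
  have hj : z ∈ Ring.jacobson (MonoidAlgebra ℂ H) := by
    rw [Ring.jacobson, Module.jacobson, Submodule.mem_sInf]
    intro m hm
    have hs : IsSimpleModule (MonoidAlgebra ℂ H) (MonoidAlgebra ℂ H ⧸ m) :=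
      isSimpleModule_iff_isCoatom.mpr hm
    let e : (MonoidAlgebra ℂ H ⧸ m) ≃ₗ[ℂ] (Fin (Module.finrank ℂ (MonoidAlgebra ℂ H ⧸ m)) → ℂ) :=
      (Module.finBasis ℂ (MonoidAlgebra ℂ H ⧸ m)).equivFun
    let φ := ((e.conjAlgEquiv ℂ).toAlgHom).comp
      (Algebra.lsmul (A := MonoidAlgebra ℂ H) ℂ ℂ (MonoidAlgebra ℂ H ⧸ m))
    let σ : Representation ℂ H _ := (MonoidAlgebra.lift ℂ _ H).symm φ
    have hφ : σ.asAlgebraHom = φ := (MonoidAlgebra.lift ℂ _ H).apply_symm_apply φ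
    have hφe : ∀ r x, φ r (e x) = e (r • x) := fun r x => by simp [φ]
    have hσ : σ.IsIrreducible := by
      rw [irreducible_iff_isSimpleModule_asModule]
      let E : (MonoidAlgebra ℂ H ⧸ m) ≃ₗ[MonoidAlgebra ℂ H] σ.asModule :=
        { (e.toAddEquiv.trans σ.asModuleEquiv.symm.toAddEquiv) with
          map_smul' := fun r x => by
            apply σ.asModuleEquiv.injective
            simp [hφ, hφe] }
      exact IsSimpleModule.congr E.symm
    have h1 := LinearMap.congr_fun (hφ.symm ▸ hz _ σ hσ : φ z = 0) (e (Submodule.Quotient.mk 1))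
    rw [hφe, LinearMap.zero_apply, LinearEquiv.map_eq_zero_iff, ← Submodule.Quotient.mk_smul,
      Submodule.Quotient.mk_eq_zero] at h1
    simpa using h1
  rwa [IsSemisimpleRing.jacobson_eq_bot, Submodule.mem_bot] at hj

/-- A representation by matrices, as a homomorphism. -/
def Representation.matHom {H : Type*} [Group H] {d : ℕ} (σ : Representation ℂ H (Fin d → ℂ)) :
    H →* Matrix (Fin d) (Fin d) ℂ where
  toFun := σ.mat
  map_one' := σ.mat_one
  map_mul' := σ.mat_mul

theorem Representation.asAlgebraHom_eq_zero_of_equiv {H : Type*} [Group H] {m n : ℕ}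
    {σ : Representation ℂ H (Fin m → ℂ)} {τ : Representation ℂ H (Fin n → ℂ)} (e : σ.Equiv τ)
    {z : MonoidAlgebra ℂ H} (hz : MonoidAlgebra.lift ℂ _ H τ.matHom z = 0) :
    σ.asAlgebraHom z = 0 := by
  have h : ∀ (w : MonoidAlgebra ℂ H) v,
      e (σ.asAlgebraHom w v) = (MonoidAlgebra.lift ℂ _ H τ.matHom w).mulVec (e v) := by
    intro w v
    induction w using MonoidAlgebra.induction_on with
    | of g =>
      simp only [MonoidAlgebra.of_apply, asAlgebraHom_single, one_smul, MonoidAlgebra.lift_single]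
      rw [show (τ.matHom g).mulVec (e v) = Matrix.toLin' (τ.mat g) (e v) from rfl, toLin'_mat]
      exact IntertwiningMap.isIntertwining σ τ e.toIntertwiningMap g v
    | add x y hx hy => simp [hx, hy, Matrix.add_mulVec]
    | smul r x hx => simp [hx, Matrix.smul_mulVec]
  refine LinearMap.ext fun v => e.toLinearEquiv.injective ?_
  refine (h z v).trans ?_
  rw [hz, Matrix.zero_mulVec]
  exact (map_zero e.toLinearEquiv).symm

namespace IsCompleteIrreps

variable {H : Type*} [Group H] {I : Type*} {δ : I → ℕ}
  {ρ : ∀ i, Representation ℂ H (Fin (δ i) → ℂ)} (hρ : IsCompleteIrreps ρ)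

include hρ

theorem isEmpty_equiv {i j : I} (h : i ≠ j) : IsEmpty ((ρ i).Equiv (ρ j)) :=
  ⟨fun e => h (hρ.eq_of_equiv i j ⟨e⟩)⟩

theorem dim_pos (i : I) : 0 < δ i := (hρ.irreducible i).dim_pos

theorem dim_ne_zero (i : I) : (δ i : ℂ) ≠ 0 := Nat.cast_ne_zero.mpr (hρ.dim_pos i).ne'

variable [Fintype H] {S : Type*} [Ring S] [Algebra ℂ S] (f : H →* S)

theorem matUnit_mul_self (i : I) (p q r s : Fin (δ i)) :
    matUnit f (ρ i) p q * matUnit f (ρ i) r s = if q = r then matUnit f (ρ i) p s else 0 :=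
  matUnit_mul_matUnit f (hρ.irreducible i) p q r s

theorem matUnit_mul_of_ne {i j : I} (h : i ≠ j) (p q : Fin (δ i)) (r s : Fin (δ j)) :
    matUnit f (ρ i) p q * matUnit f (ρ j) r s = 0 :=
  matUnit_mul_matUnit_of_ne f (hρ.irreducible i) (hρ.irreducible j) (hρ.isEmpty_equiv h) p q r s

theorem matUnit_matHom_of_ne {i j : I} (h : i ≠ j) (p q : Fin (δ i)) :
    matUnit (ρ j).matHom (ρ i) p q = 0 := by
  ext a b
  rw [matUnit, Matrix.sum_apply]
  exact sum_mat_inv_mul_mat_of_ne (hρ.irreducible i) (hρ.irreducible j) (hρ.isEmpty_equiv h) p q b a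

theorem matUnit_matHom_self (i : I) (p q : Fin (δ i)) :
    matUnit (ρ i).matHom (ρ i) p q = Matrix.single p q 1 := by
  ext a b
  rw [matUnit, Matrix.sum_apply]
  refine (sum_mat_inv_mul_mat_self (hρ.irreducible i) p q b a).trans ?_
  simp only [Matrix.single_apply, eq_comm (a := a), and_comm]

/-- The diagonal matrix units add up to one. -/
theorem sum_matUnit [Fintype I] : ∑ i, ∑ p, matUnit f (ρ i) p p = 1 := by
  -- The identity is tested on irreducible representations in `ℂH` itself, and then carried to `S`
  -- by the universal property of the group algebra.
  have h : 1 - ∑ i, ∑ p, matUnit (MonoidAlgebra.of ℂ H) (ρ i) p p = 0 := by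
    refine MonoidAlgebra.eq_zero_of_forall_irreducible _ fun d σ hσ => ?_
    obtain ⟨j, ⟨e⟩⟩ := hρ.exists_equiv d σ hσ
    refine asAlgebraHom_eq_zero_of_equiv e ?_
    have hl : ((MonoidAlgebra.lift ℂ (Matrix (Fin (δ j)) (Fin (δ j)) ℂ) H (ρ j).matHom :
        MonoidAlgebra ℂ H →* _)).comp (MonoidAlgebra.of ℂ H) = (ρ j).matHom := by
      ext1 g; simp
    simp only [map_sub, map_one, map_sum, map_matUnit, hl]
    rw [Finset.sum_eq_single j, Finset.sum_congr rfl fun p _ => hρ.matUnit_matHom_self j p p,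
      ← Matrix.sum_single_one, sub_self]
    · exact fun i _ hij => Finset.sum_eq_zero fun p _ => hρ.matUnit_matHom_of_ne hij p p
    · simp
  have h2 := congrArg (MonoidAlgebra.lift ℂ S H f) (sub_eq_zero.mp h)
  have hl : ((MonoidAlgebra.lift ℂ S H f : MonoidAlgebra ℂ H →* S)).comp (MonoidAlgebra.of ℂ H)
      = f := by
    ext1 g; simp
  simp only [map_one, map_sum, map_matUnit, hl] at h2
  exact h2.symm

end IsCompleteIrreps

end

noncomputable section

open Representation

/-! ## The centre of the group algebra over the polynomial ring -/

section Centre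

variable {H : Type*} [Group H] [Fintype H]

theorem centralIdempotent_eq_sum_matUnit {d : ℕ} (σ : Representation ℂ H (Fin d → ℂ)) :
    centralIdempotent σ = ∑ p, matUnit (MonoidAlgebra.of ℂ[X] H) σ p p := by
  rw [sum_matUnit_self, centralIdempotent]
  refine Finset.sum_congr rfl fun g _ => ?_
  rw [MonoidAlgebra.of_apply, MonoidAlgebra.smul_single, ← Polynomial.algebraMap_eq,
    Algebra.algebraMap_eq_smul_one]

theorem mul_sum_matUnit_comm {S : Type*} [Ring S] [Algebra ℂ S] (f : H →* S) {d : ℕ}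
    (σ : Representation ℂ H (Fin d → ℂ)) (g : H) :
    f g * ∑ p, matUnit f σ p p = (∑ p, matUnit f σ p p) * f g := by
  simp only [Finset.mul_sum, Finset.sum_mul, mul_matUnit, matUnit_mul]
  exact Finset.sum_comm

/-- The coefficient of the diagonal unit at the identity of the group is `d / |H|`, a nonzero
constant, so it can be cancelled. -/
theorem smul_matUnit_injective {d : ℕ} {σ : Representation ℂ H (Fin d → ℂ)}
    (hσ : σ.IsIrreducible) (p : Fin d) {r s : ℂ[X]}
    (h : r • matUnit (MonoidAlgebra.of ℂ[X] H) σ p p =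
      s • matUnit (MonoidAlgebra.of ℂ[X] H) σ p p) : r = s := by
  have hc : ∀ r : ℂ[X], (r • matUnit (MonoidAlgebra.of ℂ[X] H) σ p p).coeff 1 =
      r * C ((d : ℂ) / Fintype.card H) := by
    intro r
    have : (matUnit (MonoidAlgebra.of ℂ[X] H) σ p p).coeff 1 = C ((d : ℂ) / Fintype.card H) := by
      classical
      simp only [matUnit, MonoidAlgebra.of_apply, MonoidAlgebra.smul_single]
      rw [MonoidAlgebra.coeff_sum, Finsupp.finsetSum_apply, Finset.sum_eq_single 1]
      · simp [mat_one, ← Polynomial.algebraMap_eq, Algebra.algebraMap_eq_smul_one]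
      · intro g _ hg
        simp [hg]
      · simp
    rw [← this]
    simp
  have h1 := congrArg (fun z => MonoidAlgebra.coeff z 1) h
  simp only [hc] at h1
  refine mul_right_cancel₀ ?_ h1
  rw [Ne, C_eq_zero]
  exact div_ne_zero (Nat.cast_ne_zero.mpr hσ.dim_pos.ne')
    (Nat.cast_ne_zero.mpr Fintype.card_ne_zero)

/-- Compressing a group element `g` by the diagonal unit gives the matrix entry `σ(g)_{pp}` times
that unit; the general case is by linearity. -/
theorem exists_matUnit_mul_mul_matUnit {d : ℕ} {σ : Representation ℂ H (Fin d → ℂ)}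
    (hσ : σ.IsIrreducible) (z : MonoidAlgebra ℂ[X] H) (p : Fin d) :
    ∃ r : ℂ[X], matUnit (MonoidAlgebra.of ℂ[X] H) σ p p * z *
      matUnit (MonoidAlgebra.of ℂ[X] H) σ p p = r • matUnit (MonoidAlgebra.of ℂ[X] H) σ p p := by
  induction z using MonoidAlgebra.induction_on with
  | of g =>
    refine ⟨C (σ.mat g p p), ?_⟩
    rw [matUnit_mul, Finset.sum_mul, Finset.sum_eq_single p]
    · rw [smul_mul_assoc, matUnit_mul_matUnit _ hσ, if_pos rfl, ← Polynomial.algebraMap_eq,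
        algebraMap_smul]
    · intro q _ hq
      rw [smul_mul_assoc, matUnit_mul_matUnit _ hσ, if_neg hq, smul_zero]
    · simp
  | add x y hx hy =>
    obtain ⟨r, hr⟩ := hx
    obtain ⟨s, hs⟩ := hy
    exact ⟨r + s, by rw [mul_add, add_mul, hr, hs, add_smul]⟩
  | smul c x hx =>
    obtain ⟨r, hr⟩ := hx
    exact ⟨c * r, by rw [mul_smul_comm, smul_mul_assoc, hr, mul_smul]⟩

variable {I : Type*} [Fintype I] {δ : I → ℕ} {ρ : ∀ i, Representation ℂ H (Fin (δ i) → ℂ)}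

theorem centralElement_eq_sum_matUnit (τ : I → ℂ[X]) : centralElement ρ τ =
    ∑ i, ∑ p, (C ((δ i : ℂ)⁻¹) * τ i) • matUnit (MonoidAlgebra.of ℂ[X] H) (ρ i) p p := by
  simp only [centralElement, centralIdempotent_eq_sum_matUnit, Finset.smul_sum]

theorem centralElement_mem_center (τ : I → ℂ[X]) :
    centralElement ρ τ ∈ Set.center (MonoidAlgebra ℂ[X] H) := by
  rw [Semigroup.mem_center_iff]
  intro z
  induction z using MonoidAlgebra.induction_on with
  | of g =>
    simp only [centralElement, Finset.mul_sum, Finset.sum_mul, mul_smul_comm, smul_mul_assoc,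
      centralIdempotent_eq_sum_matUnit]
    refine Finset.sum_congr rfl fun i _ => ?_
    rw [← Finset.mul_sum, ← Finset.sum_mul, mul_sum_matUnit_comm]
  | add x y hx hy => rw [add_mul, mul_add, hx, hy]
  | smul c x hx => rw [smul_mul_assoc, mul_smul_comm, hx]

namespace IsCompleteIrreps

variable (hρ : IsCompleteIrreps ρ)

include hρ

theorem centralElement_mul_matUnit (τ : I → ℂ[X]) (i : I) (p q : Fin (δ i)) :
    centralElement ρ τ * matUnit (MonoidAlgebra.of ℂ[X] H) (ρ i) p q =
      (C ((δ i : ℂ)⁻¹) * τ i) • matUnit (MonoidAlgebra.of ℂ[X] H) (ρ i) p q := by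
  rw [centralElement_eq_sum_matUnit, Finset.sum_mul, Finset.sum_eq_single i]
  · rw [Finset.sum_mul, Finset.sum_eq_single p]
    · rw [smul_mul_assoc, hρ.matUnit_mul_self, if_pos rfl]
    · intro r _ hr
      rw [smul_mul_assoc, hρ.matUnit_mul_self, if_neg hr, smul_zero]
    · simp
  · intro j _ hj
    rw [Finset.sum_mul]
    exact Finset.sum_eq_zero fun r _ => by
      rw [smul_mul_assoc, hρ.matUnit_mul_of_ne _ hj, smul_zero]
  · simp

theorem bijOn_centralElement :
    Set.BijOn (centralElement ρ) Set.univ (Set.center (MonoidAlgebra ℂ[X] H)) := by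
  refine ⟨fun τ _ => centralElement_mem_center τ, fun τ _ τ' _ h => funext fun i => ?_,
    fun z hz => ?_⟩
  · have p : Fin (δ i) := ⟨0, hρ.dim_pos i⟩
    have h1 : centralElement ρ τ * matUnit (MonoidAlgebra.of ℂ[X] H) (ρ i) p p =
      centralElement ρ τ' * matUnit (MonoidAlgebra.of ℂ[X] H) (ρ i) p p := by rw [h]
    rw [hρ.centralElement_mul_matUnit, hρ.centralElement_mul_matUnit] at h1
    refine mul_left_cancel₀ ?_ (smul_matUnit_injective (hρ.irreducible i) p h1)
    rw [Ne, C_eq_zero]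
    exact inv_ne_zero (hρ.dim_ne_zero i)
  · have hz := Semigroup.mem_center_iff.mp hz
    choose r hr using fun i =>
      exists_matUnit_mul_mul_matUnit (hρ.irreducible i) z ⟨0, hρ.dim_pos i⟩
    -- The factor `δ i` undoes the division by `δ i` in `centralElement`.
    refine ⟨fun i => C (δ i : ℂ) * r i, Set.mem_univ _, ?_⟩
    conv_rhs => rw [← mul_one z, ← hρ.sum_matUnit (MonoidAlgebra.of ℂ[X] H), Finset.mul_sum]
    rw [centralElement_eq_sum_matUnit]
    refine Finset.sum_congr rfl fun i _ => ?_
    rw [Finset.mul_sum]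
    refine Finset.sum_congr rfl fun p _ => ?_
    rw [← mul_assoc, ← C_mul, inv_mul_cancel₀ (hρ.dim_ne_zero i), C_1, one_mul]
    set f := MonoidAlgebra.of ℂ[X] H
    set o : Fin (δ i) := ⟨0, hρ.dim_pos i⟩
    have h1 : ∀ a b c, matUnit f (ρ i) a b * matUnit f (ρ i) b c = matUnit f (ρ i) a c :=
      fun a b c => by rw [hρ.matUnit_mul_self, if_pos rfl]
    -- Moving the central `z` past the units shows that the scalar found at the index `o` also
    -- serves at every other `p` of the block.
    calc r i • matUnit f (ρ i) p p
        = matUnit f (ρ i) p o * (r i • matUnit f (ρ i) o o) * matUnit f (ρ i) o p := by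
          rw [mul_smul_comm, smul_mul_assoc, h1, h1]
      _ = z * matUnit f (ρ i) p p := by
          rw [← hr i, hz]
          change matUnit f (ρ i) p o * (z * matUnit f (ρ i) o o * matUnit f (ρ i) o o) *
            matUnit f (ρ i) o p = _
          rw [mul_assoc z, h1, ← mul_assoc, hz, mul_assoc z, h1, mul_assoc z, h1]

end IsCompleteIrreps

end Centre

end

noncomputable section

/-! ## Full corners and Morita equivalence -/

/-- A multiplicative linear map identifies `B` with the corner of `A` at the idempotent `ψ 1`, and
this idempotent is full. -/
structure IsFullCorner {k A B : Type*} [CommRing k] [Ring A] [Algebra k A] [Ring B] [Algebra k B]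
    (ψ : B →ₙₐ[k] A) : Prop where
  injective : Function.Injective ψ
  exists_eq : ∀ a, ∃ b, ψ b = ψ 1 * a * ψ 1
  full : ∃ (n : ℕ) (p q : Fin n → A), ∑ i, p i * ψ 1 * q i = 1

namespace IsFullCorner

section Corner

variable {k A B : Type*} [CommRing k] [Ring A] [Algebra k A] [Ring B] [Algebra k B]
  {ψ : B →ₙₐ[k] A} (h : IsFullCorner ψ)

include h

/-- Corresponding idempotents have isomorphic corners. -/
theorem nonempty_corner_algEquiv {e : A} (he : IsIdempotentElem e) {e' : B}
    (he' : IsIdempotentElem e') (hψ : ψ e' = e) : Nonempty (he.Corner ≃ₐ[k] he'.Corner) := by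
  have hmem : ∀ x : he'.Corner, ψ x.1 ∈ Subsemigroup.corner e := fun x => by
    obtain ⟨y, hy⟩ := x.2
    refine ⟨ψ y, ?_⟩
    change e * ψ y * e = _
    rw [← hψ, ← map_mul, ← map_mul]
    exact congrArg ψ hy
  let φ : he'.Corner →ₐ[k] he.Corner := AlgHom.ofLinearMap
    { toFun := fun x => ⟨ψ x.1, hmem x⟩
      map_add' := fun x y => Subtype.ext (map_add ψ x.1 y.1)
      map_smul' := fun c x => Subtype.ext (map_smul ψ c x.1) }
    (Subtype.ext hψ) (fun x y => Subtype.ext (map_mul ψ x.1 y.1))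
  refine ⟨(AlgEquiv.ofBijective φ ⟨fun x y hxy => Subtype.ext (h.injective
    (congrArg Subtype.val hxy)), fun y => ?_⟩).symm⟩
  -- A preimage of the compression of `e a e` by `ψ 1` is cut down on both sides by `e'`, so that it
  -- lies in the corner; this does not change its image.
  obtain ⟨a, ha⟩ := y.2
  obtain ⟨b, hb⟩ := h.exists_eq (e * a * e)
  refine ⟨⟨e' * b * e', b, rfl⟩, Subtype.ext ?_⟩
  change ψ (e' * b * e') = y.1
  have h1 : ψ 1 * e = e := by rw [← hψ, ← map_mul, one_mul]
  have h2 : e * ψ 1 = e := by rw [← hψ, ← map_mul, mul_one]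
  have h3 : e * e = e := he
  rw [map_mul, map_mul, hb, hψ, ← ha]
  calc e * (ψ 1 * (e * a * e) * ψ 1) * e = (e * ψ 1) * (e * a * e) * (ψ 1 * e) := by
        simp only [mul_assoc]
    _ = (e * e) * a * (e * e) := by rw [h1, h2]; simp only [mul_assoc]
    _ = e * a * e := by rw [h3]

end Corner

section Morita

open CategoryTheory

universe w w₁ w₂

variable {k : Type*} [CommRing k] {A : Type w₁} {B : Type w₂} [Ring A] [Algebra k A]
  [Ring B] [Algebra k B] {ψ : B →ₙₐ[k] A}

/-- The part of an `A`-module on which the idempotent `ψ 1` acts as the identity. -/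
def fixedPart (ψ : B →ₙₐ[k] A) (M : Type*) [AddCommGroup M] [Module A M] : AddSubgroup M where
  carrier := {m | ψ 1 • m = m}
  add_mem' {x y} hx hy := by
    rw [Set.mem_ofPred_eq] at *
    rw [smul_add, hx, hy]
  zero_mem' := smul_zero _
  neg_mem' {x} hx := by
    rw [Set.mem_ofPred_eq] at *
    rw [smul_neg, hx]

section

variable {M : Type*} [AddCommGroup M] [Module A M]

theorem mem_fixedPart {m : M} : m ∈ fixedPart ψ M ↔ ψ 1 • m = m := Iff.rfl

theorem smul_mem_fixedPart (b : B) (m : M) : ψ b • m ∈ fixedPart ψ M := by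
  rw [mem_fixedPart, ← mul_smul, ← map_mul, one_mul]

instance : Module B (fixedPart ψ M) where
  smul b m := ⟨ψ b • m.1, smul_mem_fixedPart b m.1⟩
  one_smul m := Subtype.ext m.2
  mul_smul b c m := Subtype.ext (by
    change ψ (b * c) • m.1 = ψ b • ψ c • m.1
    rw [map_mul, mul_smul])
  smul_zero b := Subtype.ext (smul_zero _)
  smul_add b m m' := Subtype.ext (smul_add _ _ _)
  add_smul b c m := Subtype.ext (by
    change ψ (b + c) • m.1 = ψ b • m.1 + ψ c • m.1
    rw [map_add, add_smul])
  zero_smul m := Subtype.ext (by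
    change ψ 0 • m.1 = 0
    rw [map_zero, zero_smul])

theorem coe_smul_fixedPart (b : B) (m : fixedPart ψ M) : (b • m).1 = ψ b • m.1 := rfl

end

/-- The functor to `B`-modules that takes the fixed part of an `A`-module. -/
def fixedFunctor (ψ : B →ₙₐ[k] A) : ModuleCat.{w} A ⥤ ModuleCat.{w} B where
  obj M := ModuleCat.of B (fixedPart ψ M)
  map {M N} g := ModuleCat.ofHom
    { toFun := fun m => ⟨g.hom m.1, by rw [mem_fixedPart, ← map_smul, mem_fixedPart.mp m.2]⟩
      map_add' := fun m m' => Subtype.ext (map_add g.hom m.1 m'.1)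
      map_smul' := fun b m => Subtype.ext (map_smul g.hom (ψ b) m.1) }
  map_id _ := rfl
  map_comp _ _ := rfl

/-- The `A`-module of additive maps from `A` to a `B`-module that are `B`-linear for the
multiplication on the left through `ψ`. -/
def Coinduced (ψ : B →ₙₐ[k] A) (N : Type*) [AddCommGroup N] [Module B N] : AddSubgroup (A →+ N) where
  carrier := {t | ∀ b x, t (ψ b * x) = b • t x}
  add_mem' {s t} hs ht b x := by simp [hs b x, ht b x]
  zero_mem' := by simp
  neg_mem' {t} ht b x := by simp [ht b x]

section

variable {N : Type*} [AddCommGroup N] [Module B N]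

instance : Module A (Coinduced ψ N) where
  smul a t := ⟨t.1.comp (AddMonoidHom.mulRight a), fun b x => by
    simp only [AddMonoidHom.comp_apply, AddMonoidHom.mulRight_apply, mul_assoc]
    exact t.2 b _⟩
  one_smul t := Subtype.ext (AddMonoidHom.ext fun x => congrArg t.1 (mul_one x))
  mul_smul a b t := Subtype.ext (AddMonoidHom.ext fun x => congrArg t.1 (mul_assoc x a b).symm)
  smul_zero a := rfl
  smul_add a s t := rfl
  add_smul a b t := Subtype.ext (AddMonoidHom.ext fun x =>
    (congrArg t.1 (mul_add x a b)).trans (map_add t.1 _ _))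
  zero_smul t := Subtype.ext (AddMonoidHom.ext fun x =>
    (congrArg t.1 (mul_zero x)).trans (map_zero t.1))

theorem coe_smul_coinduced (a : A) (t : Coinduced ψ N) (x : A) : (a • t).1 x = t.1 (x * a) := rfl

end

variable (h : IsFullCorner ψ)

include h

/-- By fullness `M` is spanned over `A` by its fixed part, so an `A`-linear map is determined there.
-/
theorem faithful_fixedFunctor : (fixedFunctor.{w} ψ).Faithful where
  map_injective {M N} g g' hg := by
    obtain ⟨n, p, q, hpq⟩ := h.full
    ext m
    have h1 : ∀ m' : fixedPart ψ M, g.hom m'.1 = g'.hom m'.1 := fun m' =>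
      congrArg (fun t => ((ModuleCat.Hom.hom t) m' : fixedPart ψ N).1) hg
    have h2 : ∀ i, g.hom ((p i * ψ 1 * q i) • m) = g'.hom ((p i * ψ 1 * q i) • m) := fun i => by
      rw [mul_assoc, mul_smul, map_smul g.hom (p i), map_smul g'.hom (p i), mul_smul]
      exact congrArg (p i • ·) (h1 ⟨_, smul_mem_fixedPart 1 (q i • m)⟩)
    rw [← one_smul A m, ← hpq, Finset.sum_smul, map_sum, map_sum]
    exact Finset.sum_congr rfl fun i _ => h2 i

theorem full_fixedFunctor : (fixedFunctor.{w} ψ).Full where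
  map_surjective {M N} g := by
    obtain ⟨n, p, q, hpq⟩ := h.full
    have hidem : ψ 1 * ψ 1 = ψ 1 := by rw [← map_mul, one_mul]
    let s : M →+ fixedPart ψ M :=
      { toFun := fun m => ⟨ψ 1 • m, smul_mem_fixedPart 1 m⟩
        map_zero' := Subtype.ext (smul_zero _)
        map_add' := fun x y => Subtype.ext (smul_add _ _ _) }
    let t : fixedPart ψ M →+ N := (fixedPart ψ N).subtype.comp (g.hom : fixedPart ψ M →ₗ[B] fixedPart ψ N).toAddMonoidHom
    -- On fixed vectors `ψ 1 * a` acts as `ψ 1 * a * ψ 1`, which is some `ψ b`, and `B`-linearity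
    -- carries it through `g`.
    have ht : ∀ (a : A) (m : fixedPart ψ M), ψ 1 • a • t m = t (s (a • m.1)) := by
      intro a m
      obtain ⟨b, hb⟩ := h.exists_eq a
      have h1 : s (a • m.1) = b • m := Subtype.ext (by
        rw [coe_smul_fixedPart, hb, mul_smul, mem_fixedPart.mp m.2, mul_smul]; rfl)
      have h2 : t (b • m) = ψ b • t m := congrArg Subtype.val (map_smul g.hom b m)
      rw [h1, h2, hb, mul_smul, mul_smul, show ψ 1 • t m = t m from (g.hom m).2]
    -- The only possible extension of `g`: write `m = ∑ p_i f q_i m` with `f = ψ 1` and apply `g` to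
    -- the fixed vectors `f q_i m`.
    let r : M →+ N := ∑ i, ((DistribSMul.toAddMonoidHom N (p i * ψ 1)).comp (t.comp (s.comp
      (DistribSMul.toAddMonoidHom M (q i)))))
    have hr : ∀ m, r m = ∑ i, (p i * ψ 1) • t (s (q i • m)) := fun m => by simp [r]
    have hM : ∀ m : M, m = ∑ i, p i • (s (q i • m)).1 := fun m => by
      conv_lhs => rw [← one_smul A m, ← hpq, Finset.sum_smul]
      refine Finset.sum_congr rfl fun i _ => ?_
      rw [mul_smul, mul_smul]
      rfl
    have hlin : ∀ (a : A) m, r (a • m) = a • r m := by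
      intro a m
      have h3 : ∀ i, t (s (q i • a • m)) = ∑ j, ψ 1 • (q i * a * p j) • t (s (q j • m)) := by
        intro i
        conv_lhs => rw [hM m]
        simp only [Finset.smul_sum, map_sum]
        refine Finset.sum_congr rfl fun j _ => ?_
        rw [← mul_smul, ← mul_smul, ht, mul_assoc]
      simp only [hr, h3, Finset.smul_sum]
      rw [Finset.sum_comm]
      refine Finset.sum_congr rfl fun j _ => ?_
      have h4 : ψ 1 • t (s (q j • m)) = t (s (q j • m)) :=
        (g.hom (s (q j • m)) : fixedPart ψ N).2
      conv_rhs => rw [mul_smul, h4, ← mul_smul, ← one_mul (a * p j), ← hpq, Finset.sum_mul,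
        Finset.sum_smul]
      refine Finset.sum_congr rfl fun i _ => ?_
      simp only [← mul_smul, mul_assoc, ← mul_assoc (ψ 1) (ψ 1), hidem]
    have hrt : ∀ m : fixedPart ψ M, r m.1 = t m := fun m => by
      have h5 : t m = (1 : A) • t m := (one_smul _ _).symm
      rw [hr, h5, ← hpq, Finset.sum_smul]
      refine Finset.sum_congr rfl fun i _ => ?_
      rw [← ht, ← mul_smul, ← mul_smul, mul_assoc (p i), hidem]
    refine ⟨ModuleCat.ofHom { r with map_smul' := hlin }, ?_⟩
    ext m
    exact Subtype.ext (hrt m)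

/-- The preimage of `N` is the coinduced module. A map `t` in it satisfies `t (ψ 1 * x) = t x`, so
it is in effect a `B`-linear map on `ψ 1 * A`. -/
theorem essSurj_fixedFunctor : (fixedFunctor.{max w w₁} ψ).EssSurj where
  mem_essImage N := by
    choose c hc using h.exists_eq
    have hc_eq : ∀ a b, ψ b = ψ 1 * a * ψ 1 → c a = b := fun a b hb =>
      h.injective ((hc a).trans hb.symm)
    -- Evaluation at `1`, with inverse `n ↦ (x ↦ c x • n)`, where `c x` is the element of `B` that
    -- corresponds to `ψ 1 * x * ψ 1`.
    let E : fixedPart ψ (Coinduced ψ N) ≃ₗ[B] N :=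
      { toFun := fun t => t.1.1 1
        map_add' := fun _ _ => rfl
        map_smul' := fun b t => by
          rw [coe_smul_fixedPart, coe_smul_coinduced, one_mul, RingHom.id_apply]
          have := t.1.2 b 1
          rwa [mul_one] at this
        invFun := fun n => ⟨⟨
          { toFun := fun x => c x • n
            map_zero' := by rw [hc_eq 0 0 (by simp), zero_smul]
            map_add' := fun x y => by
              rw [hc_eq (x + y) (c x + c y) (by simp [hc, mul_add, add_mul]), add_smul] },
          fun b x => by
            change c (ψ b * x) • n = b • c x • n
            rw [← mul_smul, hc_eq (ψ b * x) (b * c x)]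
            rw [map_mul, hc]
            simp only [← mul_assoc, ← map_mul, one_mul, mul_one]⟩, by
          refine Subtype.ext (AddMonoidHom.ext fun x => ?_)
          rw [coe_smul_coinduced]
          change c (x * ψ 1) • n = c x • n
          rw [hc_eq (x * ψ 1) (c x)]
          rw [hc]
          simp only [mul_assoc, ← map_mul, mul_one]⟩
        left_inv := fun t => by
          refine Subtype.ext (Subtype.ext (AddMonoidHom.ext fun x => ?_))
          change c x • t.1.1 1 = t.1.1 x
          have h1 := t.1.2 (c x) 1
          have h2 := t.1.2 1 (x * ψ 1)
          have h3 : t.1.1 (x * ψ 1) = t.1.1 x := DFunLike.congr_fun (congrArg Subtype.val t.2) x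
          rw [← h1, mul_one, hc, mul_assoc, h2, h3, one_smul]
        right_inv := fun n => by
          change c 1 • n = n
          rw [hc_eq 1 1 (by simp [← map_mul]), one_smul] }
    exact ⟨ModuleCat.of A (Coinduced ψ N), ⟨E.toModuleIso⟩⟩

open scoped ModuleCat.Algebra in
theorem isMoritaEquivalent : IsMoritaEquivalent k A B := by
  have := h.faithful_fixedFunctor.{max w₁ w₂}
  have := h.full_fixedFunctor.{max w₁ w₂}
  have := h.essSurj_fixedFunctor.{w₂}
  have : (fixedFunctor.{max w₁ w₂} ψ).IsEquivalence := {}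
  have hadd : (fixedFunctor.{max w₁ w₂} ψ).Additive := { map_add := rfl }
  have hlin : (fixedFunctor.{max w₁ w₂} ψ).Linear k :=
    { map_smul := fun {M N} g c => by
        ext m
        refine Subtype.ext ?_
        -- Scalars act on the target through `ψ (algebraMap k B c) = c • ψ 1`, which on fixed
        -- vectors is the scalar `c` of `A`.
        change algebraMap k A c • g.hom (m : fixedPart ψ M).1 =
          ψ (algebraMap k B c) • g.hom (m : fixedPart ψ M).1
        conv_lhs => rw [← (m : fixedPart ψ M).2]
        rw [map_smul, ← mul_smul, ← Algebra.smul_def, Algebra.algebraMap_eq_smul_one, map_smul] }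
  exact ⟨⟨{ eqv := (fixedFunctor.{max w₁ w₂} ψ).asEquivalence, linear := hlin }⟩⟩

end Morita

end IsFullCorner

end

noncomputable section

/-! ## Maps out of path algebras -/

namespace PathAlgebra

variable {k : Type*} [CommRing k] {V : Type u} [Quiver.{v} V]

section Lift

variable {S : Type*} [Ring S] [Algebra k S] (ε : V → S) (t : ∀ {i j : V}, (i ⟶ j) → S)

/-- The value of a path, given values of the trivial paths and of the arrows. -/
def pathVal {i : V} : ∀ {j : V}, Quiver.Path i j → S
  -- Every value ends in the idempotent of the tail, so values absorb it on the right by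
  -- construction; `hr` enters only when a single arrow is evaluated, in `lift_arrow`.
  | _, .nil => ε i
  | _, .cons p a => t a * pathVal p

/-- The linear map to an algebra with prescribed values on trivial paths and arrows. -/
def liftLin : PathAlgebra k V →ₗ[k] S :=
  Finsupp.linearCombination k (fun p : Σ i j : V, Quiver.Path i j => pathVal ε t p.2.2)

theorem liftLin_ofPath {i j : V} (p : Quiver.Path i j) :
    liftLin ε t (ofPath k p) = pathVal ε t p :=
  (Finsupp.linearCombination_single k (1 : k) _).trans (one_smul k _)

variable {ε t} (hε : ∀ i, ε i * ε i = ε i) (hne : ∀ i j, i ≠ j → ε i * ε j = 0)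
  (hl : ∀ {i j : V} (a : i ⟶ j), ε j * t a = t a) (hr : ∀ {i j : V} (a : i ⟶ j), t a * ε i = t a)

section

include hε hl

theorem mul_pathVal {i j : V} (p : Quiver.Path i j) : ε j * pathVal ε t p = pathVal ε t p := by
  cases p with
  | nil => exact hε i
  | cons p a => rw [pathVal, ← mul_assoc, hl]

theorem pathVal_comp {i j l : V}
    (q : Quiver.Path i j) (p : Quiver.Path j l) :
    pathVal ε t (q.comp p) = pathVal ε t p * pathVal ε t q := by
  induction p with
  | nil => rw [Quiver.Path.comp_nil, pathVal, mul_pathVal hε hl]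
  | cons p a ih => rw [Quiver.Path.comp_cons, pathVal, ih, pathVal, mul_assoc]

end

include hε in
theorem pathVal_mul {i j : V} (p : Quiver.Path i j) : pathVal ε t p * ε i = pathVal ε t p := by
  induction p with
  | nil => exact hε i
  | cons p a ih => rw [pathVal, mul_assoc, ih]

include hε hne hl in
theorem liftLin_mul (x y : PathAlgebra k V) :
    liftLin ε t (x * y) = liftLin ε t x * liftLin ε t y := by
  induction x using induction_path with
  | h0 => simp only [zero_mul_aux, map_zero, zero_mul]
  | hadd a b ha hb => simp only [add_mul_aux, map_add, ha, hb, add_mul]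
  | hsmul c a ha => simp only [smul_mul_aux, map_smul, ha, smul_mul_assoc]
  | hpath p =>
    rename_i i j
    induction y using induction_path with
    | h0 => simp only [mul_zero_aux, map_zero, mul_zero]
    | hadd a b ha hb => simp only [mul_add_aux, map_add, ha, hb, mul_add]
    | hsmul c a ha => simp only [mul_smul_aux, map_smul, ha, mul_smul_comm]
    | hpath q =>
      rename_i l m
      by_cases h : m = i
      · subst h
        rw [ofPath_mul_ofPath, liftLin_ofPath, liftLin_ofPath, liftLin_ofPath,
          pathVal_comp hε hl]
      · rw [ofPath_mul_ofPath_of_ne _ _ h, map_zero, liftLin_ofPath, liftLin_ofPath,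
          ← pathVal_mul hε p, ← mul_pathVal hε hl q, mul_assoc, ← mul_assoc (ε i),
          hne _ _ (Ne.symm h), zero_mul, mul_zero]

variable [Fintype V]

/-- The homomorphism from the path algebra with prescribed values on trivial paths and arrows. -/
def lift (ε : V → S) (t : ∀ {i j : V}, (i ⟶ j) → S) (hε : ∀ i, ε i * ε i = ε i)
    (hne : ∀ i j, i ≠ j → ε i * ε j = 0) (hl : ∀ {i j : V} (a : i ⟶ j), ε j * t a = t a) (h1 : ∑ i, ε i = 1) :
    PathAlgebra k V →ₐ[k] S :=
  AlgHom.ofLinearMap (liftLin ε t)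
    (by
      rw [one_eq_sum, map_sum, ← h1]
      exact Finset.sum_congr rfl fun i _ => liftLin_ofPath ε t _)
    (liftLin_mul hε hne hl)

variable (h1 : ∑ i, ε i = 1)

theorem lift_vertex (i : V) : lift ε t hε hne hl h1 (vertex k i) = ε i :=
  liftLin_ofPath ε t _

include hr in
theorem lift_arrow {i j : V} (a : i ⟶ j) : lift ε t hε hne hl h1 (arrow k a) = t a :=
  (liftLin_ofPath ε t _).trans (hr a)

end Lift

theorem arrow_mul_vertex {i j : V} (a : i ⟶ j) : arrow k a * vertex k i = arrow k a := by
  rw [arrow, vertex, ofPath_mul_ofPath, Quiver.Path.nil_comp]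

theorem vertex_mul_arrow {i j : V} (a : i ⟶ j) : vertex k j * arrow k a = arrow k a := by
  rw [arrow, vertex, ofPath_mul_ofPath, Quiver.Path.comp_nil]

theorem vertex_mul_vertex_of_ne {i j : V} (h : i ≠ j) : vertex k i * vertex k j = 0 :=
  ofPath_mul_ofPath_of_ne _ _ h.symm

variable [Fintype V]

/-- The path algebra is generated by trivial paths and arrows. -/
theorem induction_arrow {P : PathAlgebra k V → Prop} (x : PathAlgebra k V)
    (hadd : ∀ x y, P x → P y → P (x + y)) (hsmul : ∀ (c : k) x, P x → P (c • x))
    (hmul : ∀ x y, P x → P y → P (x * y)) (h0 : P 0)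
    (hvertex : ∀ i : V, P (vertex k i)) (harrow : ∀ {i j : V} (a : i ⟶ j), P (arrow k a)) : P x := by
  induction x using induction_path with
  | h0 => exact h0
  | hadd a b ha hb => exact hadd a b ha hb
  | hsmul c a ha => exact hsmul c a ha
  | hpath p =>
    rename_i i j
    induction p with
    | nil => exact hvertex i
    | cons p a ih =>
      have : ofPath k (p.cons a) = arrow k a * ofPath k p := by
        rw [arrow, ofPath_mul_ofPath]
        rfl
      rw [this]
      exact hmul _ _ (harrow a) ih

end PathAlgebra

/-! ## Maps out of the `N = 1` quiver algebra -/

namespace NOneQuiverAlgebra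

variable {V : Type u} [Quiver.{v} V]

theorem e_mul_of_ne {i j : V} (h : i ≠ j) : e i * e j = 0 :=
  PathAlgebra.vertex_mul_vertex_of_ne (V := HatQuiver V) h

theorem e_mul_arr {i j : V} (a : i ⟶ j) : e j * arr a = arr a :=
  PathAlgebra.vertex_mul_arrow (V := HatQuiver V) _

theorem arr_mul_e {i j : V} (a : i ⟶ j) : arr a * e i = arr a :=
  PathAlgebra.arrow_mul_vertex (V := HatQuiver V) _

theorem e_mul_rev {i j : V} (a : i ⟶ j) : e i * rev a = rev a :=
  PathAlgebra.vertex_mul_arrow (V := HatQuiver V) _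

theorem rev_mul_e {i j : V} (a : i ⟶ j) : rev a * e j = rev a :=
  PathAlgebra.arrow_mul_vertex (V := HatQuiver V) _

theorem loop_mul_e (i : V) : loop i * e i = loop i :=
  PathAlgebra.arrow_mul_vertex (V := HatQuiver V) _

variable [Fintype V]

theorem sum_e : ∑ i : V, e i = 1 := rfl

theorem uElt_mul_e (i : V) : uElt V * e i = loop i := by
  rw [uElt, Finset.sum_mul, Finset.sum_eq_single i]
  · exact loop_mul_e i
  · intro j _ hj
    rw [← loop_mul_e j, mul_assoc, e_mul_of_ne hj, mul_zero]
  · simp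

/-- The arrows of the double of a quiver. -/
abbrev Dbl {V : Type u} [Quiver.{v} V] (i j : V) : Type v := (i ⟶ j) ⊕ (j ⟶ i)

/-- An arrow of the double of `Q`, in the path algebra. -/
def dbl {i j : V} : Dbl i j → PathAlgebra ℂ (HatQuiver V)
  | .inl a => arr a
  | .inr a => rev a

/-- The sign of an arrow of the double: positive on the arrows of the quiver. -/
def Dbl.sign {V : Type u} [Quiver.{v} V] {i j : V} : Dbl i j → ℂ
  | .inl _ => 1
  | .inr _ => -1

variable [∀ i j : V, Fintype (i ⟶ j)]

variable {S : Type*} [Ring S] [Algebra ℂ S]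

/-- Every arrow `a` of the quiver contributes twice: `a a*` with sign plus at its head, and `a* a`
with sign minus at its tail. -/
theorem sum_sign_dbl (f : ∀ {i j : V}, Dbl i j → S) :
    ∑ i, ∑ j, ∑ a : Dbl j i, a.sign • (f a * f a.swap) =
      ∑ i, ∑ j, ∑ a : i ⟶ j, (f (.inl a) * f (.inr a) - f (.inr a) * f (.inl a)) := by
  simp only [Fintype.sum_sum_type, Dbl.sign, one_smul, neg_smul, Sum.swap, Finset.sum_add_distrib,
    Finset.sum_neg_distrib, Finset.sum_sub_distrib]
  rw [sub_eq_add_neg]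
  congr 1
  exact Finset.sum_comm

variable (τ : V → ℂ[X])

/-- The values of the arrows of the double with loops, given values `ε` of the trivial paths,
`U` of the sum of the loops and `t` of the arrows of the double. -/
def hatVal (ε : V → S) (U : S) (t : ∀ {i j : V}, Dbl i j → S) {i j : V} :
    HatQuiver.Arrow i j → S
  | .arr a => t (.inl a)
  | .rev a => t (.inr a)
  | .loop i => U * ε i

/-- The homomorphism from the `N = 1` quiver algebra given by complete orthogonal idempotents,
a central element `U` and elements for the arrows that satisfy the relation. -/
theorem exists_lift (ε : V → S) (U : S) (t : ∀ {i j : V}, Dbl i j → S)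
    (hε : ∀ i, ε i * ε i = ε i) (hne : ∀ i j, i ≠ j → ε i * ε j = 0) (h1 : ∑ i, ε i = 1)
    (hl : ∀ {i j : V} (a : Dbl i j), ε j * t a = t a)
    (hr : ∀ {i j : V} (a : Dbl i j), t a * ε i = t a) (hU : ∀ s, U * s = s * U)
    (hrel : ∑ i, ∑ j, ∑ a : Dbl j i, a.sign • (t a * t a.swap) = ∑ i, aeval U (τ i) * ε i) :
    ∃ φ : NOneQuiverAlgebra V τ →ₐ[ℂ] S,
      (∀ i, φ (RingQuot.mkAlgHom ℂ (Rel V τ) (e i)) = ε i) ∧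
      (∀ (i j : V) (a : Dbl i j), φ (RingQuot.mkAlgHom ℂ (Rel V τ) (dbl a)) = t a) ∧
      φ (RingQuot.mkAlgHom ℂ (Rel V τ) (uElt V)) = U := by
  have hl' : ∀ {i j : V} (a : HatQuiver.Arrow i j), ε j * hatVal ε U t a = hatVal ε U t a := by
    intro i j a
    cases a with
    | arr a => exact hl _
    | rev a => exact hl _
    | loop => rw [hatVal, ← mul_assoc, ← hU, mul_assoc, hε]
  have hr' : ∀ {i j : V} (a : HatQuiver.Arrow i j), hatVal ε U t a * ε i = hatVal ε U t a := by
    intro i j a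
    cases a with
    | arr a => exact hr _
    | rev a => exact hr _
    | loop => rw [hatVal, mul_assoc, hε]
  let φ₀ : PathAlgebra ℂ (HatQuiver V) →ₐ[ℂ] S :=
    PathAlgebra.lift (V := HatQuiver V) ε (hatVal ε U t) hε hne hl' h1
  have hφe : ∀ i, φ₀ (e i) = ε i := fun i => PathAlgebra.lift_vertex (V := HatQuiver V) hε hne hl' h1 _
  have hφa : ∀ {i j : V} (a : Dbl i j), φ₀ (dbl a) = t a := by
    intro i j a
    cases a <;> exact PathAlgebra.lift_arrow (V := HatQuiver V) hε hne hl' hr' h1 _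
  have hφl : ∀ i, φ₀ (loop i) = U * ε i := fun i => PathAlgebra.lift_arrow (V := HatQuiver V) hε hne hl' hr' h1 _
  have hφu : φ₀ (uElt V) = U := by
    rw [uElt, map_sum, Finset.sum_congr rfl fun i _ => hφl i, ← Finset.mul_sum, h1, mul_one]
  have hφr : ∀ ⦃x y⦄, Rel V τ x y → φ₀ x = φ₀ y := by
    intro x y h
    cases h with
    | moment =>
      have h2 := sum_sign_dbl t
      have h3 : ∀ {i j : V} (a : i ⟶ j), φ₀ (arr a) = t (.inl a) := fun a => hφa (.inl a)
      have h4 : ∀ {i j : V} (a : i ⟶ j), φ₀ (rev a) = t (.inr a) := fun a => hφa (.inr a)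
      rw [hrel] at h2
      simp only [map_sum, map_sub, map_mul, hφe, h3, h4, ← h2, ← aeval_algHom_apply, hφu]
    | central x => rw [map_mul, map_mul, hφu, hU]
  refine ⟨RingQuot.liftAlgHom ℂ ⟨φ₀, hφr⟩, fun i => ?_, fun i j a => ?_, ?_⟩ <;>
    rw [RingQuot.liftAlgHom_mkAlgHom_apply]
  exacts [hφe i, hφa a, hφu]

end NOneQuiverAlgebra

end

noncomputable section

/-! ## Maps out of the deformed skew group algebra -/

/-- The value of an element of the group algebra over `ℂ[u]` in an algebra in which the group is
represented by `σ`, when `u` is replaced by `U`. -/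
def evalGroupAlgebra {H S : Type*} [Group H] [Ring S] [Algebra ℂ S] (σ : H →* S) (U : S) :
    MonoidAlgebra ℂ[X] H →+ S where
  toFun z := z.coeff.sum fun g r => aeval U r * σ g
  map_zero' := Finsupp.sum_zero_index
  map_add' z w := Finsupp.sum_add_index' (by simp) (by simp [add_mul])

section EvalGroupAlgebra

variable {H S : Type*} [Group H] [Ring S] [Algebra ℂ S] (σ : H →* S) (U : S)

theorem evalGroupAlgebra_single (g : H) (r : ℂ[X]) :
    evalGroupAlgebra σ U (MonoidAlgebra.single g r) = aeval U r * σ g := by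
  change (Finsupp.single g r).sum (fun g r => aeval U r * σ g) = _
  exact Finsupp.sum_single_index (by simp)

theorem evalGroupAlgebra_centralElement [Fintype H] {I : Type*} [Fintype I] {δ : I → ℕ}
    (ρ : ∀ i, Representation ℂ H (Fin (δ i) → ℂ)) (τ : I → ℂ[X]) :
    evalGroupAlgebra σ U (centralElement ρ τ) =
      ∑ i, ∑ p, (δ i : ℂ)⁻¹ • (aeval U (τ i) * matUnit σ (ρ i) p p) := by
  simp only [centralElement, centralIdempotent, Finset.smul_sum, map_sum,
    MonoidAlgebra.smul_single, evalGroupAlgebra_single, smul_eq_mul]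
  refine Finset.sum_congr rfl fun i _ => ?_
  rw [← Finset.smul_sum, ← Finset.mul_sum, sum_matUnit_self, Finset.mul_sum, Finset.smul_sum]
  refine Finset.sum_congr rfl fun g _ => ?_
  simp only [map_mul, aeval_C, Algebra.algebraMap_eq_smul_one, smul_mul_assoc, one_mul,
    mul_smul_comm, mul_one, smul_smul]
  congr 1
  ring

end EvalGroupAlgebra

namespace DeformedSkewAlgebra

variable (G : Subgroup (Matrix.SpecialLinearGroup (Fin 2) ℂ)) (z : MonoidAlgebra ℂ[X] G)

/-- The image of `x` or `y`. -/
def var (k : Fin 2) : DeformedSkewAlgebra G z :=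
  RingQuot.mkAlgHom ℂ (DeformedSkewRel G z) (SkewMonoidAlgebra.single 1 (FreeAlgebra.ι ℂ[X] k))

/-- The image of `u`. -/
def param : DeformedSkewAlgebra G z :=
  RingQuot.mkAlgHom ℂ (DeformedSkewRel G z) (SkewMonoidAlgebra.single 1 (algebraMap ℂ[X] _ X))

theorem single_one_mul_single (a b : FreeAlgebra ℂ[X] (Fin 2)) (g : G) :
    (SkewMonoidAlgebra.single 1 a * SkewMonoidAlgebra.single g b : SkewGroupAlgebra G) =
      SkewMonoidAlgebra.single g (a * b) := by
  rw [SkewMonoidAlgebra.single_mul_single, one_smul, one_mul]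

/-- The noncommutative polynomials in the skew group algebra. -/
def ofFree : FreeAlgebra ℂ[X] (Fin 2) →ₐ[ℂ] SkewGroupAlgebra G :=
  AlgHom.ofLinearMap
    { toFun := SkewMonoidAlgebra.single 1
      map_add' := SkewMonoidAlgebra.single_add 1
      map_smul' := fun c a => (SkewMonoidAlgebra.smul_single c 1 a).symm }
    rfl (fun a b => (single_one_mul_single G a b 1).symm)

theorem smul_algebraMap_free (g : G) (r : ℂ[X]) :
    g • (algebraMap ℂ[X] (FreeAlgebra ℂ[X] (Fin 2)) r) = algebraMap ℂ[X] _ r :=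
  (slSubst (g : Matrix.SpecialLinearGroup (Fin 2) ℂ)).commutes r

theorem aeval_param (r : ℂ[X]) : aeval (param G z) r =
    RingQuot.mkAlgHom ℂ (DeformedSkewRel G z) (ofFree G (algebraMap ℂ[X] _ r)) := by
  change aeval (((RingQuot.mkAlgHom ℂ (DeformedSkewRel G z)).comp
    ((ofFree G).comp (IsScalarTower.toAlgHom ℂ ℂ[X] _))) X) r = _
  rw [aeval_algHom_apply, aeval_X_left_apply]
  rfl

theorem mk_single (g : G) (a : FreeAlgebra ℂ[X] (Fin 2)) :
    RingQuot.mkAlgHom ℂ (DeformedSkewRel G z) (SkewMonoidAlgebra.single g a) =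
      RingQuot.mkAlgHom ℂ (DeformedSkewRel G z) (ofFree G a) * groupElt G z g := by
  change _ = RingQuot.mkAlgHom ℂ (DeformedSkewRel G z) (SkewMonoidAlgebra.single 1 a) *
    RingQuot.mkAlgHom ℂ (DeformedSkewRel G z) (SkewMonoidAlgebra.single g 1)
  rw [← map_mul, single_one_mul_single, mul_one]

theorem groupElt_mul_mk (g : G) (a : FreeAlgebra ℂ[X] (Fin 2)) :
    groupElt G z g * RingQuot.mkAlgHom ℂ (DeformedSkewRel G z) (ofFree G a) =
      RingQuot.mkAlgHom ℂ (DeformedSkewRel G z) (ofFree G (g • a)) * groupElt G z g := by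
  rw [← mk_single]
  change RingQuot.mkAlgHom ℂ (DeformedSkewRel G z) (SkewMonoidAlgebra.single g 1) *
    RingQuot.mkAlgHom ℂ (DeformedSkewRel G z) (SkewMonoidAlgebra.single 1 a) = _
  rw [← map_mul, SkewMonoidAlgebra.single_mul_single, one_mul, mul_one]

theorem groupElt_mul_var (g : G) (k : Fin 2) : groupElt G z g * var G z k =
    ∑ l, (g : Matrix.SpecialLinearGroup (Fin 2) ℂ).1 l k • (var G z l * groupElt G z g) := by
  have h : g • FreeAlgebra.ι ℂ[X] k = ∑ l, (g : Matrix.SpecialLinearGroup (Fin 2) ℂ).1 l k •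
      (FreeAlgebra.ι ℂ[X] l : FreeAlgebra ℂ[X] (Fin 2)) := by
    change slSubst (g : Matrix.SpecialLinearGroup (Fin 2) ℂ) _ = _
    rw [slSubst, FreeAlgebra.lift_ι_apply]
    refine Finset.sum_congr rfl fun l _ => ?_
    rw [← Polynomial.algebraMap_eq, algebraMap_smul]
  refine (groupElt_mul_mk G z g (FreeAlgebra.ι ℂ[X] k)).trans ?_
  simp only [h, map_sum, map_smul, Finset.sum_mul, smul_mul_assoc]
  rfl

theorem param_comm_mk (a : FreeAlgebra ℂ[X] (Fin 2)) :
    param G z * RingQuot.mkAlgHom ℂ (DeformedSkewRel G z) (ofFree G a) =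
      RingQuot.mkAlgHom ℂ (DeformedSkewRel G z) (ofFree G a) * param G z := by
  change RingQuot.mkAlgHom ℂ (DeformedSkewRel G z) (ofFree G (algebraMap ℂ[X] _ X)) * _ =
    _ * RingQuot.mkAlgHom ℂ (DeformedSkewRel G z) (ofFree G (algebraMap ℂ[X] _ X))
  simp only [← map_mul, Algebra.commutes]

@[elab_as_elim]
theorem induction {P : DeformedSkewAlgebra G z → Prop} (a : DeformedSkewAlgebra G z)
    (hadd : ∀ x y, P x → P y → P (x + y)) (hmul : ∀ x y, P x → P y → P (x * y))
    (halg : ∀ c, P (algebraMap ℂ _ c)) (hg : ∀ g, P (groupElt G z g))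
    (hvar : ∀ k, P (var G z k)) (hparam : P (param G z)) : P a := by
  obtain ⟨y, rfl⟩ := RingQuot.mkAlgHom_surjective ℂ (DeformedSkewRel G z) a
  have hfree : ∀ b, P (RingQuot.mkAlgHom ℂ (DeformedSkewRel G z) (ofFree G b)) := by
    intro b
    induction b using FreeAlgebra.induction with
    | grade0 r =>
      rw [← aeval_param]
      induction r using Polynomial.induction_on with
      | C c => rw [aeval_C]; exact halg c
      | add p q hp hq => rw [map_add]; exact hadd _ _ hp hq
      | monomial n c h =>
        rw [pow_succ, ← mul_assoc, map_mul, aeval_X]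
        exact hmul _ _ h hparam
    | grade1 k => exact hvar k
    | mul a b ha hb => rw [map_mul, map_mul]; exact hmul _ _ ha hb
    | add a b ha hb => rw [map_add, map_add]; exact hadd _ _ ha hb
  induction y using SkewMonoidAlgebra.induction_on with
  | zero => rw [map_zero, ← map_zero (algebraMap ℂ _)]; exact halg 0
  | single g b => rw [mk_single]; exact hmul _ _ (hfree b) (hg g)
  | add x y hx hy => rw [map_add]; exact hadd _ _ hx hy

theorem param_comm (a : DeformedSkewAlgebra G z) : param G z * a = a * param G z := by
  induction a using DeformedSkewAlgebra.induction with
  | hadd x y hx hy => rw [mul_add, add_mul, hx, hy]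
  | hmul x y hx hy => rw [← mul_assoc, hx, mul_assoc, hy, mul_assoc]
  | halg c => exact (Algebra.commutes c _).symm
  | hg g =>
    refine Eq.symm ((groupElt_mul_mk G z g (algebraMap ℂ[X] _ X)).trans ?_)
    rw [smul_algebraMap_free]
    rfl
  | hvar k => exact param_comm_mk G z _
  | hparam => rfl

theorem var_mul_var_sub : var G z 0 * var G z 1 - var G z 1 * var G z 0 =
    evalGroupAlgebra (groupElt G z) (param G z) z := by
  have h := RingQuot.mkAlgHom_rel ℂ (DeformedSkewRel.comm (G := G) (z := z))
  have h1 : SkewMonoidAlgebra.single (1 : G) (FreeAlgebra.ι ℂ[X] 0 * FreeAlgebra.ι ℂ[X] 1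
        - FreeAlgebra.ι ℂ[X] 1 * FreeAlgebra.ι ℂ[X] 0) = ofFree G (FreeAlgebra.ι ℂ[X] 0 *
        FreeAlgebra.ι ℂ[X] 1 - FreeAlgebra.ι ℂ[X] 1 * FreeAlgebra.ι ℂ[X] 0) := rfl
  rw [h1] at h
  simp only [map_sub, map_mul] at h
  refine h.trans ?_
  rw [ofGroupAlgebra, Finsupp.sum, map_sum]
  exact Finset.sum_congr rfl fun g _ => by
    rw [mk_single, ← aeval_param]

theorem exists_lift {S : Type*} [Ring S] [Algebra ℂ S] (σ : G →* S) (x : Fin 2 → S) (U : S)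
    (hU : ∀ s, U * s = s * U)
    (hx : ∀ g k, σ g * x k =
      ∑ l, (g : Matrix.SpecialLinearGroup (Fin 2) ℂ).1 l k • (x l * σ g))
    (hrel : x 0 * x 1 - x 1 * x 0 = evalGroupAlgebra σ U z) :
    ∃ φ : DeformedSkewAlgebra G z →ₐ[ℂ] S, (∀ g, φ (groupElt G z g) = σ g) ∧
      (∀ k, φ (var G z k) = x k) ∧ φ (param G z) = U := by
  have hc : ∀ (r : ℂ[X]) s, aeval U r * s = s * aeval U r := by
    intro r s
    induction r using Polynomial.induction_on with
    | C c => rw [aeval_C, Algebra.commutes]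
    | add p q hp hq => rw [map_add, add_mul, mul_add, hp, hq]
    | monomial n c h => rw [pow_succ, ← mul_assoc, map_mul, aeval_X, mul_assoc, hU, ← mul_assoc, h,
        mul_assoc]
  -- The polynomial ring acts on `S` with the variable acting as `U`. Since `U` is central this is
  -- an algebra structure, and the free algebra over `ℂ[X]` maps to `S`.
  let _ : Algebra ℂ[X] S := (aeval U).toRingHom.toAlgebra' hc
  have _ : IsScalarTower ℂ ℂ[X] S := IsScalarTower.of_algebraMap_eq fun c =>
    (aeval_C U c).symm
  let f₀ : FreeAlgebra ℂ[X] (Fin 2) →ₐ[ℂ[X]] S := FreeAlgebra.lift ℂ[X] x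
  have hf₀ : ∀ k, f₀ (FreeAlgebra.ι ℂ[X] k) = x k := fun k => FreeAlgebra.lift_ι_apply x k
  have hf₁ : ∀ r, f₀ (algebraMap ℂ[X] _ r) = aeval U r := fun r => f₀.commutes r
  let f : FreeAlgebra ℂ[X] (Fin 2) →ₐ[ℂ] S := f₀.restrictScalars ℂ
  have hf₂ : ∀ (c : ℂ) a, f₀ (c • a) = c • f₀ a := fun c a => map_smul f c a
  have hcomm : ∀ {a : FreeAlgebra ℂ[X] (Fin 2)} {g : G}, f (g • a) * σ g = σ g * f a := by
    intro a g
    induction a using FreeAlgebra.induction with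
    | grade0 r =>
      rw [smul_algebraMap_free]
      change f₀ _ * _ = _ * f₀ _
      rw [hf₁, hc]
    | grade1 k =>
      change f₀ (slSubst (g : Matrix.SpecialLinearGroup (Fin 2) ℂ) _) * _ = _ * f₀ _
      rw [hf₀, hx, slSubst, FreeAlgebra.lift_ι_apply, map_sum, Finset.sum_mul]
      refine Finset.sum_congr rfl fun l _ => ?_
      rw [← Polynomial.algebraMap_eq, algebraMap_smul, hf₂, hf₀, smul_mul_assoc]
    | mul a b ha hb => rw [smul_mul', map_mul, map_mul, mul_assoc, hb, ← mul_assoc, ha, mul_assoc]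
    | add a b ha hb => rw [smul_add, map_add, map_add, add_mul, mul_add, ha, hb]
  let F := SkewMonoidAlgebra.liftNCAlgHom f σ hcomm
  have hF : ∀ g a, F (SkewMonoidAlgebra.single g a) = f a * σ g := fun g a =>
    SkewMonoidAlgebra.liftNC_single _ _ _ _
  have hFr : ∀ ⦃a b⦄, DeformedSkewRel G z a b → F a = F b := by
    rintro _ _ ⟨⟩
    rw [hF, map_one, mul_one, ofGroupAlgebra, Finsupp.sum, map_sum]
    simp only [hF]
    change f₀ _ = ∑ g ∈ _, f₀ _ * _
    simp only [map_sub, map_mul, hf₀, hf₁, hrel]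
    rfl
  refine ⟨RingQuot.liftAlgHom ℂ ⟨F, hFr⟩, fun g => ?_, fun k => ?_, ?_⟩
  · refine (RingQuot.liftAlgHom_mkAlgHom_apply ℂ F hFr _).trans ?_
    rw [SkewMonoidAlgebra.of_apply, hF, map_one, one_mul]
  · refine (RingQuot.liftAlgHom_mkAlgHom_apply ℂ F hFr _).trans ?_
    rw [hF, map_one, mul_one]
    exact hf₀ k
  · refine (RingQuot.liftAlgHom_mkAlgHom_apply ℂ F hFr _).trans ?_
    rw [hF, map_one, mul_one]
    exact (hf₁ X).trans (aeval_X U)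

end DeformedSkewAlgebra

end

noncomputable section

/-! ## Dual systems and symplectic bases -/

section DualSystem

variable {k : Type*} [Field k] {W W' : Type*} [AddCommGroup W] [Module k W] [FiniteDimensional k W]
  [AddCommGroup W'] [Module k W'] [FiniteDimensional k W']

/-- For a perfect pairing there are dual systems with prescribed values. -/
theorem exists_dual_system (B : W →ₗ[k] W' →ₗ[k] k) (hB : ∀ d, (∀ c, B c d = 0) → d = 0)
    {ι : Type*} [Fintype ι] [DecidableEq ι] (hW : Module.finrank k W = Fintype.card ι)
    (hW' : Module.finrank k W' = Fintype.card ι) (s : ι → k) :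
    ∃ (c : ι → W) (c' : ι → W'), ∀ a b, B (c a) (c' b) = if a = b then s b else 0 := by
  let e := (Module.finBasisOfFinrankEq k W hW).reindex (Fintype.equivFin ι).symm
  -- `F` takes the pairings with a basis of `W`. It is injective by nondegeneracy, hence bijective
  -- by dimension, and `c'` consists of preimages of multiples of the standard basis.
  let F : W' →ₗ[k] (ι → k) := LinearMap.pi fun a => B (e a)
  have hF : Function.Injective F := by
    rw [injective_iff_map_eq_zero]
    refine fun d hd => hB d fun c => ?_
    have : B.flip d = 0 := e.ext fun a => congrFun hd a
    exact LinearMap.congr_fun this c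
  have hF' : Function.Surjective F :=
    (LinearMap.injective_iff_surjective_of_finrank_eq_finrank (by simp [hW'])).mp hF
  choose c' hc' using fun b => hF' (Pi.single b (s b))
  refine ⟨e, c', fun a b => ?_⟩
  have := congrFun (hc' b) a
  rw [Pi.single_apply] at this
  exact this

/-- Darboux's construction, adding one hyperbolic pair for each element of the index set; the
statement for an arbitrary finite subset `s` is what the induction needs. -/
theorem exists_symplectic_system (B : W →ₗ[k] W →ₗ[k] k) (hB : ∀ d, (∀ c, B c d = 0) → d = 0)
    (halt : ∀ c, B c c = 0) {ι : Type*} [Fintype ι] [DecidableEq ι]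
    (hW : Module.finrank k W = Fintype.card ι + Fintype.card ι) (s : Finset ι) :
    ∃ p q : ι → W, ∀ a ∈ s, ∀ b ∈ s, B (p a) (q b) = (if a = b then 1 else 0) ∧
      B (p a) (p b) = 0 ∧ B (q a) (q b) = 0 := by
  have hneg : ∀ c d, B c d = - B d c := fun c d => by
    have := halt (c + d)
    simp only [map_add, LinearMap.add_apply, halt, zero_add, add_zero] at this
    exact eq_neg_of_add_eq_zero_right this
  induction s using Finset.induction_on with
  | empty => exact ⟨0, 0, by simp⟩
  | insert a₀ s ha ih =>
    obtain ⟨p, q, h⟩ := ih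
    let F : W →ₗ[k] (s ⊕ s → k) :=
      LinearMap.pi (Sum.elim (fun a => B (p a)) (fun a => B (q a)))
    have hcard : s.card < Fintype.card ι := Finset.card_lt_univ_of_notMem ha
    -- The `2 |s|` vectors found so far are fewer than the dimension `2 |ι|`, so some nonzero `x` is
    -- orthogonal to all of them.
    have hker : LinearMap.ker F ≠ ⊥ := by
      refine LinearMap.ker_ne_bot_of_finrank_lt ?_
      simp only [Module.finrank_fintype_fun_eq_card, Fintype.card_sum, Fintype.card_coe, hW]
      omega
    obtain ⟨x, hx, hx0⟩ := Submodule.exists_mem_ne_zero_of_ne_bot hker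
    have hpx : ∀ a ∈ s, B (p a) x = 0 := fun a ha => congrFun hx (Sum.inl ⟨a, ha⟩)
    have hqx : ∀ a ∈ s, B (q a) x = 0 := fun a ha => congrFun hx (Sum.inr ⟨a, ha⟩)
    obtain ⟨y, hy⟩ : ∃ y, B y x ≠ 0 := by
      by_contra hcon
      push Not at hcon
      exact hx0 (hB x hcon)
    set y' := (- (B y x)⁻¹) • y with hy'
    have hxy' : B x y' = 1 := by
      rw [hneg, hy', map_smul, LinearMap.smul_apply, smul_eq_mul]
      field_simp
    -- The partner `y'` of `x`, corrected to be orthogonal to the earlier pairs. Pairing with `x` is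
    -- unaffected, as `x` is already orthogonal to them.
    let w := y' - ∑ b ∈ s, B (p b) y' • q b + ∑ b ∈ s, B (q b) y' • p b
    have hw : ∀ c, B c w = B c y' - ∑ b ∈ s, B (p b) y' * B c (q b)
        + ∑ b ∈ s, B (q b) y' * B c (p b) := fun c => by simp [w]
    have hpw : ∀ a ∈ s, B (p a) w = 0 := fun a ha => by
      rw [hw, Finset.sum_eq_single_of_mem a ha fun b hb hba => by
          rw [(h a ha b hb).1, if_neg hba.symm, mul_zero],
        Finset.sum_eq_zero fun b hb => by rw [(h a ha b hb).2.1, mul_zero], (h a ha a ha).1,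
        if_pos rfl]
      ring
    have hqw : ∀ a ∈ s, B (q a) w = 0 := fun a ha => by
      rw [hw, Finset.sum_eq_zero fun b hb => by rw [(h a ha b hb).2.2, mul_zero],
        Finset.sum_eq_single_of_mem a ha fun b hb hba => by
          rw [hneg (q a) (p b), (h b hb a ha).1, if_neg hba, neg_zero, mul_zero], hneg (q a) (p a),
          (h a ha a ha).1, if_pos rfl]
      ring
    have hxw : B x w = 1 := by
      rw [hw, hxy', Finset.sum_eq_zero fun b hb => by rw [hneg x (q b), hqx b hb, neg_zero, mul_zero],
        Finset.sum_eq_zero fun b hb => by rw [hneg x (p b), hpx b hb, neg_zero, mul_zero]]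
      ring
    refine ⟨fun a => if a = a₀ then x else p a, fun a => if a = a₀ then w else q a,
      fun a hamem b hbmem => ?_⟩
    have hs : ∀ {c}, c ∈ insert a₀ s → c ≠ a₀ → c ∈ s := fun hc hne =>
      (Finset.mem_insert.mp hc).resolve_left hne
    by_cases h1 : a = a₀ <;> by_cases h2 : b = a₀
    · subst h1; subst h2
      simp [hxw, halt]
    · subst h1
      have hb := hs hbmem h2
      simp only [if_true, if_neg h2, if_neg (Ne.symm h2)]
      exact ⟨by rw [hneg, hqx b hb, neg_zero], by rw [hneg, hpx b hb, neg_zero],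
        by rw [hneg, hqw b hb, neg_zero]⟩
    · subst h2
      have ha := hs hamem h1
      simp only [if_true, if_neg h1]
      exact ⟨hpw a ha, hpx a ha, hqw a ha⟩
    · simp only [if_neg h1, if_neg h2]
      exact h a (hs hamem h1) b (hs hbmem h2)

end DualSystem

open NOneQuiverAlgebra

theorem NOneQuiverAlgebra.Dbl.sign_swap {V : Type u} [Quiver.{v} V] {i j : V} (a : Dbl i j) :
    Dbl.sign (i := j) (j := i) a.swap = - a.sign := by
  cases a <;> simp [Dbl.sign]

/-- Spaces attached to pairs of vertices, which are dual to each other in an antisymmetric way, have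
dual systems indexed by the arrows of the double, if they have the right dimensions. -/
theorem exists_dbl_dual_system {I : Type u} [Fintype I] [Quiver.{v} I]
    [∀ i j : I, Fintype (i ⟶ j)] {W : I → I → Type*} [∀ i j, AddCommGroup (W i j)]
    [∀ i j, Module ℂ (W i j)] [∀ i j, FiniteDimensional ℂ (W i j)]
    (B : ∀ i j, W i j →ₗ[ℂ] W j i →ₗ[ℂ] ℂ) (hanti : ∀ i j c d, B i j c d = - B j i d c)
    (hB : ∀ i j d, (∀ c, B i j c d = 0) → d = 0)
    (hW : ∀ i j : I, Module.finrank ℂ (W i j) = Fintype.card (i ⟶ j) + Fintype.card (j ⟶ i)) :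
    ∃ c : ∀ {i j : I}, Dbl i j → W i j, ∀ (i j : I) (a : Dbl i j) (b : Dbl j i),
      (b = a.swap → B i j (c a) (c b) = a.sign) ∧ (b ≠ a.swap → B i j (c a) (c b) = 0) := by
  classical
  have h1 : ∀ i j : I, ∃ (c : Dbl i j → W i j) (c' : Dbl j i → W j i), ∀ a b,
      B i j (c a) (c' b) = if b = a.swap then a.sign else 0 := by
    intro i j
    obtain ⟨c, c', h⟩ := exists_dual_system (B i j) (hB i j) (ι := Dbl i j)
      (by rw [hW, Fintype.card_sum]) (by rw [hW, Fintype.card_sum, add_comm]) Dbl.sign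
    refine ⟨c, fun b => c' b.swap, fun a b => ?_⟩
    rw [h]
    by_cases hab : b = a.swap
    · subst hab; simp
    · rw [if_neg hab, if_neg]
      rintro rfl
      exact hab (Sum.swap_swap b).symm
  -- At a single vertex both systems lie in the same space, so they cannot be chosen independently.
  -- The form there is alternating, and a symplectic basis does it, `p` for the loops and `q` for
  -- their reverses.
  have h2 : ∀ i : I, ∃ c : Dbl i i → W i i, ∀ a b,
      B i i (c a) (c b) = if b = a.swap then a.sign else 0 := by
    intro i
    have halt : ∀ c, B i i c c = 0 := fun c => by
      have := hanti i i c c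
      exact self_eq_neg.mp this
    obtain ⟨p, q, h⟩ := exists_symplectic_system (B i i) (hB i i) halt (hW i i) Finset.univ
    have h := fun a b => h a (Finset.mem_univ a) b (Finset.mem_univ b)
    refine ⟨Sum.elim p q, ?_⟩
    rintro (a | a) (b | b)
    · simp [(h a b).2.1]
    · simp [(h a b).1, Dbl.sign, eq_comm]
    · rw [hanti]
      simp [(h b a).1, Dbl.sign]
      split_ifs <;> simp
    · simp [(h a b).2.2]
  choose c c' hc using h1
  choose s hs using h2
  -- An arbitrary ordering of the vertices decides which of the two spaces of a pair receives the
  -- free choice `c` and which the dual system `c'`.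
  let f := Fintype.equivFin I
  let D : ∀ {i j : I}, Dbl i j → W i j := fun {i j} a =>
    if h : i = j then h ▸ s i (h ▸ a) else if f i < f j then c i j a else c' j i a
  have hD0 : ∀ (i : I) (a : Dbl i i), D a = s i a := fun i a => dif_pos rfl
  have hD1 : ∀ (i j : I) (a : Dbl i j), f i < f j → D a = c i j a := fun i j a h => by
    have hne : i ≠ j := by rintro rfl; exact lt_irrefl _ h
    simp only [D, dif_neg hne, if_pos h]
  have hD2 : ∀ (i j : I) (a : Dbl i j), f j < f i → D a = c' j i a := fun i j a h => by
    have hne : i ≠ j := by rintro rfl; exact lt_irrefl _ h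
    simp only [D, dif_neg hne, if_neg (not_lt.mpr h.le)]
  have key : ∀ (i j : I) (a : Dbl i j) (b : Dbl j i),
      B i j (D a) (D b) = if b = a.swap then a.sign else 0 := by
    intro i j a b
    rcases lt_trichotomy (f i) (f j) with h | h | h
    · rw [hD1 i j a h, hD2 j i b h, hc]
    · obtain rfl := f.injective h
      rw [hD0, hD0, hs]
    · rw [hD2 i j a h, hD1 j i b h, hanti, hc]
      by_cases hab : b = a.swap
      · subst hab
        rw [if_pos (Sum.swap_swap a).symm, if_pos rfl, Dbl.sign_swap, neg_neg]
      · rw [if_neg hab, if_neg, neg_zero]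
        rintro rfl
        exact hab (Sum.swap_swap b).symm
  exact ⟨D, fun i j a b => ⟨fun h => by rw [key, if_pos h], fun h => by rw [key, if_neg h]⟩⟩

end

noncomputable section

open Representation

/-! ## Homomorphisms into the tensor product with the natural representation -/

section NatHom

variable {G : Subgroup (Matrix.SpecialLinearGroup (Fin 2) ℂ)} {m n : ℕ}

/-- The coordinates of the intertwining maps from `σ` to the tensor product of the natural
representation and `τ`. -/
def natHom (σ : Representation ℂ G (Fin m → ℂ)) (τ : Representation ℂ G (Fin n → ℂ)) :
    Submodule ℂ (Fin 2 → Matrix (Fin n) (Fin m) ℂ) where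
  carrier := {c | ∀ (g : G) l, c l * σ.mat g =
    ∑ k, (g : Matrix.SpecialLinearGroup (Fin 2) ℂ).1 l k • (τ.mat g * c k)}
  add_mem' {c d} hc hd g l := by
    simp only [Pi.add_apply, Matrix.add_mul, hc g l, hd g l, Matrix.mul_add, smul_add,
      Finset.sum_add_distrib]
  zero_mem' g l := by simp
  smul_mem' r c hc g l := by
    simp only [Pi.smul_apply, Matrix.smul_mul, hc g l, Matrix.mul_smul, Finset.smul_sum,
      smul_comm r]

variable {σ : Representation ℂ G (Fin m → ℂ)} {τ : Representation ℂ G (Fin n → ℂ)}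

/-- The coordinates of an element of the tensor product with the natural representation. -/
def natCoord (n : ℕ) : TensorProduct ℂ (Fin 2 → ℂ) (Fin n → ℂ) ≃ₗ[ℂ] (Fin 2 → Fin n → ℂ) :=
  (TensorProduct.comm ℂ _ _).trans (TensorProduct.piScalarRight ℂ ℂ (Fin n → ℂ) (Fin 2))

theorem natCoord_tmul (v : Fin 2 → ℂ) (w : Fin n → ℂ) (l : Fin 2) :
    natCoord n (v ⊗ₜ w) l = v l • w := by
  simp [natCoord]

theorem natCoord_tprod (g : G) (t : TensorProduct ℂ (Fin 2 → ℂ) (Fin n → ℂ)) (l : Fin 2) :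
    natCoord n ((naturalRep G).tprod τ g t) l =
      ∑ k, (g : Matrix.SpecialLinearGroup (Fin 2) ℂ).1 l k • τ g (natCoord n t k) := by
  induction t using TensorProduct.induction_on with
  | zero => simp
  | add x y hx hy => simp only [map_add, Pi.add_apply, hx, hy, smul_add, Finset.sum_add_distrib]
  | tmul v w =>
    rw [Representation.tprod_apply, TensorProduct.map_tmul, natCoord_tmul]
    simp only [natCoord_tmul, map_smul, smul_smul, ← Finset.sum_smul]
    rfl

/-- Coordinates in the plane turn an intertwiner into a pair of matrices. Through this the McKay
multiplicities become dimensions of `natHom`. -/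
theorem finrank_natHom (σ : Representation ℂ G (Fin m → ℂ)) (τ : Representation ℂ G (Fin n → ℂ)) :
    Module.finrank ℂ (natHom σ τ) =
      Module.finrank ℂ (IntertwiningMap σ ((naturalRep G).tprod τ)) := by
  let c : IntertwiningMap σ ((naturalRep G).tprod τ) →ₗ[ℂ] (Fin 2 → Matrix (Fin n) (Fin m) ℂ) :=
    LinearMap.pi fun l =>
      { toFun := fun f => LinearMap.toMatrix'
          (LinearMap.proj l ∘ₗ (natCoord n).toLinearMap ∘ₗ f.toLinearMap)
        map_add' := fun f g => by
          rw [← map_add]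
          congr 1
          ext
          simp
        map_smul' := fun r f => by
          rw [← map_smul]
          congr 1
          ext
          simp }
  have hc : ∀ f l, Matrix.toLin' (c f l) =
      LinearMap.proj l ∘ₗ (natCoord n).toLinearMap ∘ₗ f.toLinearMap := fun f l =>
    Matrix.toLin'_toMatrix' _
  have hmem : ∀ f, c f ∈ natHom σ τ := by
    intro f g l
    apply Matrix.toLin'.injective
    simp only [Matrix.toLin'_mul, map_sum, map_smul, hc, toLin'_mat]
    refine LinearMap.ext fun v => ?_
    have h := congrArg (fun t => natCoord n t l) (IntertwiningMap.isIntertwining _ _ f g v)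
    simp only [natCoord_tprod] at h
    refine h.trans ?_
    rw [LinearMap.sum_apply]
    rfl
  refine (LinearEquiv.finrank_eq (LinearEquiv.ofBijective (c.codRestrict _ hmem)
    ⟨?_, ?_⟩)).symm
  · intro f f' h
    have h1 : ∀ l, c f l = c f' l := fun l => congrFun (congrArg Subtype.val h) l
    refine IntertwiningMap.ext (LinearMap.ext fun v => (natCoord n).injective (funext fun l => ?_))
    have h2 := hc f l
    rw [h1, hc] at h2
    exact (LinearMap.congr_fun h2 v).symm
  · intro d
    let f : (Fin m → ℂ) →ₗ[ℂ] TensorProduct ℂ (Fin 2 → ℂ) (Fin n → ℂ) :=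
      (natCoord n).symm.toLinearMap ∘ₗ LinearMap.pi fun l => Matrix.toLin' (d.1 l)
    have hf : ∀ v l, natCoord n (f v) l = Matrix.toLin' (d.1 l) v := fun v l =>
      congrFun ((natCoord n).apply_symm_apply _) l
    refine ⟨⟨f, fun g => LinearMap.ext fun v => (natCoord n).injective (funext fun l => ?_)⟩,
      Subtype.ext (funext fun l => Matrix.toLin'.injective ?_)⟩
    · change natCoord n (f (σ g v)) l = natCoord n ((naturalRep G).tprod τ g (f v)) l
      rw [natCoord_tprod, hf, ← toLin'_mat,
        ← Matrix.toLin'_mul_apply, d.2 g l, map_sum, LinearMap.sum_apply]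
      refine Finset.sum_congr rfl fun k _ => ?_
      rw [hf, map_smul, Matrix.toLin'_mul, toLin'_mat]
      rfl
    · refine (hc _ l).trans (LinearMap.ext fun v => hf v l)

/-- The pairing of two-component matrices induced by the symplectic form of the plane. -/
def natPairing (m n : ℕ) : (Fin 2 → Matrix (Fin n) (Fin m) ℂ) →ₗ[ℂ]
    (Fin 2 → Matrix (Fin m) (Fin n) ℂ) →ₗ[ℂ] ℂ :=
  LinearMap.mk₂ ℂ (fun c d => (c 0 * d 1 - c 1 * d 0).trace)
    (fun c c' d => by
      simp only [Pi.add_apply, Matrix.add_mul, Matrix.trace_sub, Matrix.trace_add]; ring)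
    (fun r c d => by
      simp only [Pi.smul_apply, Matrix.smul_mul, Matrix.trace_sub, Matrix.trace_smul, smul_eq_mul]
      ring)
    (fun c d d' => by
      simp only [Pi.add_apply, Matrix.mul_add, Matrix.trace_sub, Matrix.trace_add]; ring)
    (fun r c d => by
      simp only [Pi.smul_apply, Matrix.mul_smul, Matrix.trace_sub, Matrix.trace_smul, smul_eq_mul]
      ring)

theorem natPairing_apply (c : Fin 2 → Matrix (Fin n) (Fin m) ℂ)
    (d : Fin 2 → Matrix (Fin m) (Fin n) ℂ) :
    natPairing m n c d = (c 0 * d 1 - c 1 * d 0).trace := rfl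

theorem natPairing_anti (c : Fin 2 → Matrix (Fin n) (Fin m) ℂ)
    (d : Fin 2 → Matrix (Fin m) (Fin n) ℂ) : natPairing m n c d = - natPairing n m d c := by
  rw [natPairing_apply, natPairing_apply, Matrix.trace_sub, Matrix.trace_sub,
    Matrix.trace_mul_comm (c 0), Matrix.trace_mul_comm (c 1)]
  ring

/-- The action of the group on two-component matrices. -/
def natAct (σ : Representation ℂ G (Fin m → ℂ)) (τ : Representation ℂ G (Fin n → ℂ)) (g : G)
    (c : Fin 2 → Matrix (Fin n) (Fin m) ℂ) : Fin 2 → Matrix (Fin n) (Fin m) ℂ := fun l =>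
  ∑ k, (g : Matrix.SpecialLinearGroup (Fin 2) ℂ).1 l k • (τ.mat g * c k * σ.mat g⁻¹)

/-- The form of the plane is invariant because `det g = 1`, and `d` is fixed by the group, so the
action on `c` can be moved away. -/
theorem natPairing_natAct (g : G) (c : Fin 2 → Matrix (Fin n) (Fin m) ℂ)
    {d : Fin 2 → Matrix (Fin m) (Fin n) ℂ} (hd : d ∈ natHom τ σ) :
    natPairing m n (natAct σ τ g c) d = natPairing m n c d := by
  have h1 : ∀ l, σ.mat g⁻¹ * d l * τ.mat g =
      ∑ k, (g : Matrix.SpecialLinearGroup (Fin 2) ℂ).1 l k • d k := by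
    intro l
    rw [Matrix.mul_assoc, hd g l, Matrix.mul_sum]
    refine Finset.sum_congr rfl fun k _ => ?_
    rw [Matrix.mul_smul, ← Matrix.mul_assoc, mat_inv_mul_mat, Matrix.one_mul]
  have h2 : ∀ k l, (τ.mat g * c k * σ.mat g⁻¹ * d l).trace =
      (c k * ∑ k', (g : Matrix.SpecialLinearGroup (Fin 2) ℂ).1 l k' • d k').trace := by
    intro k l
    rw [← h1, Matrix.mul_assoc, Matrix.mul_assoc, Matrix.trace_mul_comm, Matrix.mul_assoc]
  have hdet := (g : Matrix.SpecialLinearGroup (Fin 2) ℂ).2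
  rw [Matrix.det_fin_two] at hdet
  simp only [natPairing_apply, natAct, Matrix.trace_sub, Fin.sum_univ_two, Matrix.add_mul,
    Matrix.smul_mul, Matrix.trace_add, Matrix.trace_smul, h2, Matrix.mul_add, Matrix.mul_smul,
    smul_eq_mul]
  linear_combination ((c 0 * d 1).trace - (c 1 * d 0).trace) * hdet

theorem natAct_mul (g h : G) (c : Fin 2 → Matrix (Fin n) (Fin m) ℂ) :
    natAct σ τ (g * h) c = natAct σ τ g (natAct σ τ h c) := by
  funext l
  simp only [natAct, Matrix.mul_sum, Matrix.sum_mul, Finset.smul_sum, Matrix.mul_smul,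
    Matrix.smul_mul, smul_smul]
  rw [Finset.sum_comm]
  refine Finset.sum_congr rfl fun k _ => ?_
  have h1 : τ.mat (g * h) * c k * σ.mat (g * h)⁻¹ =
      τ.mat g * (τ.mat h * c k * σ.mat h⁻¹) * σ.mat g⁻¹ := by
    simp only [mul_inv_rev, mat_mul, Matrix.mul_assoc]
  rw [← Finset.sum_smul, h1]
  congr 1

theorem natAct_mul_mat (g : G) (c : Fin 2 → Matrix (Fin n) (Fin m) ℂ) (l : Fin 2) :
    natAct σ τ g c l * σ.mat g =
      ∑ k, (g : Matrix.SpecialLinearGroup (Fin 2) ℂ).1 l k • (τ.mat g * c k) := by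
  rw [natAct, Matrix.sum_mul]
  refine Finset.sum_congr rfl fun k _ => ?_
  rw [Matrix.smul_mul, Matrix.mul_assoc _ (σ.mat g⁻¹), mat_inv_mul_mat, Matrix.mul_one]

/-- By `natAct_mul_mat`, the elements of `natHom` are the fixed points of `natAct`, and a sum over
an orbit is fixed. -/
theorem sum_natAct_mem [Fintype G] (c : Fin 2 → Matrix (Fin n) (Fin m) ℂ) :
    ∑ g : G, natAct σ τ g c ∈ natHom σ τ := by
  intro g l
  rw [← natAct_mul_mat]
  congr 1
  have h : natAct σ τ g (∑ h : G, natAct σ τ h c) = ∑ h : G, natAct σ τ g (natAct σ τ h c) := by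
    funext l
    simp only [natAct, Finset.sum_apply, Matrix.mul_sum, Matrix.sum_mul, Finset.smul_sum]
    exact Finset.sum_comm
  rw [h]
  simp only [← natAct_mul]
  exact congrFun (Fintype.sum_equiv (Equiv.mulLeft g⁻¹) _ _ fun h => by simp) l

/-- The pairing of homomorphisms into tensor products with the natural representation. -/
def natHomPairing (σ : Representation ℂ G (Fin m → ℂ)) (τ : Representation ℂ G (Fin n → ℂ)) :
    natHom σ τ →ₗ[ℂ] natHom τ σ →ₗ[ℂ] ℂ :=
  (natPairing m n).domRestrict₁₂ (natHom σ τ) (natHom τ σ)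

theorem natHomPairing_apply (c : natHom σ τ) (d : natHom τ σ) :
    natHomPairing σ τ c d = natPairing m n c.1 d.1 := rfl

theorem natPairing_nondegenerate (d : Fin 2 → Matrix (Fin m) (Fin n) ℂ)
    (h : ∀ c, natPairing m n c d = 0) : d = 0 := by
  have h0 : d 0 = 0 := by
    ext b a
    simpa [natPairing_apply, Matrix.trace_single_mul] using h ![0, Matrix.single a b 1]
  have h1 : d 1 = 0 := by
    ext b a
    simpa [natPairing_apply, Matrix.trace_single_mul] using h ![Matrix.single a b 1, 0]
  funext k
  fin_cases k
  exacts [h0, h1]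

/-- Pairing with an invariant `d` only sees the average: `⟨∑ g c, d⟩ = |G| ⟨c, d⟩`. So nondegeneracy
descends from all pairs of matrices to the invariant ones. -/
theorem natHomPairing_nondegenerate [Fintype G] (d : natHom τ σ)
    (h : ∀ c, natHomPairing σ τ c d = 0) : d = 0 := by
  refine Subtype.ext (natPairing_nondegenerate d.1 fun c => ?_)
  have h1 := h ⟨_, sum_natAct_mem c⟩
  rw [natHomPairing_apply, map_sum, LinearMap.sum_apply,
    Finset.sum_congr rfl fun g _ => natPairing_natAct g c d.2, Finset.sum_const, Finset.card_univ,
    nsmul_eq_mul] at h1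
  exact (mul_eq_zero.mp h1).resolve_left (Nat.cast_ne_zero.mpr Fintype.card_ne_zero)

/-- The two-component matrix of the action of `x` and `y` that corresponds, under the symplectic
form, to a homomorphism into a tensor product with the natural representation. -/
def natRot (c : Fin 2 → Matrix (Fin n) (Fin m) ℂ) : Fin 2 → Matrix (Fin n) (Fin m) ℂ :=
  ![- c 1, c 0]

/-- The components of `c` transform by the rows of `g`, the variables by its columns. For
determinant one the symplectic form identifies the plane with its dual, and `natRot` is this
identification. -/
theorem mat_mul_natRot {c : Fin 2 → Matrix (Fin n) (Fin m) ℂ} (hc : c ∈ natHom σ τ) (g : G)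
    (k : Fin 2) : τ.mat g * natRot c k =
      ∑ l, (g : Matrix.SpecialLinearGroup (Fin 2) ℂ).1 l k • (natRot c l * σ.mat g) := by
  have hdet := (g : Matrix.SpecialLinearGroup (Fin 2) ℂ).2
  rw [Matrix.det_fin_two] at hdet
  have h0 := hc g 0
  have h1 := hc g 1
  rw [Fin.sum_univ_two] at h0 h1 ⊢
  simp only [natRot, Matrix.cons_val_zero, Matrix.cons_val_one, Matrix.neg_mul, h0, h1]
  revert k
  rw [Fin.forall_fin_two]
  refine ⟨?_, ?_⟩
  · simp only [Matrix.cons_val_zero, Matrix.mul_neg]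
    -- The two sides differ by a multiple of `det g - 1`.
    refine sub_eq_zero.mp (Eq.trans (b := ((g : Matrix.SpecialLinearGroup (Fin 2) ℂ).1 0 0 * (g : Matrix.SpecialLinearGroup (Fin 2) ℂ).1 1 1 -
      (g : Matrix.SpecialLinearGroup (Fin 2) ℂ).1 0 1 * (g : Matrix.SpecialLinearGroup (Fin 2) ℂ).1 1 0 - 1) • (τ.mat g * c 1)) ?_ ?_)
    · module
    · rw [hdet, sub_self, zero_smul]
  · simp only [Matrix.cons_val_one, Matrix.cons_val_zero]
    refine sub_eq_zero.mp (Eq.trans (b := (1 - ((g : Matrix.SpecialLinearGroup (Fin 2) ℂ).1 0 0 * (g : Matrix.SpecialLinearGroup (Fin 2) ℂ).1 1 1 -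
      (g : Matrix.SpecialLinearGroup (Fin 2) ℂ).1 0 1 * (g : Matrix.SpecialLinearGroup (Fin 2) ℂ).1 1 0)) • (τ.mat g * c 0)) ?_ ?_)
    · module
    · rw [hdet, sub_self, zero_smul]

theorem natRot_mul_natRot {l : ℕ} (a : Fin 2 → Matrix (Fin n) (Fin m) ℂ)
    (b : Fin 2 → Matrix (Fin m) (Fin l) ℂ) :
    natRot a 0 * natRot b 1 - natRot a 1 * natRot b 0 = a 0 * b 1 - a 1 * b 0 := by
  simp [natRot]
  abel

/-- Compose the two homomorphisms into one from `υ` to `V ⊗ V ⊗ τ` and contract `V ⊗ V` by the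
invariant form: the result is an intertwiner from `υ` to `τ`. -/
theorem natHom_comp_comm {l : ℕ} {υ : Representation ℂ G (Fin l → ℂ)}
    {a : Fin 2 → Matrix (Fin n) (Fin m) ℂ} (ha : a ∈ natHom σ τ)
    {b : Fin 2 → Matrix (Fin m) (Fin l) ℂ} (hb : b ∈ natHom υ σ) (g : G) :
    (a 0 * b 1 - a 1 * b 0) * υ.mat g = τ.mat g * (a 0 * b 1 - a 1 * b 0) := by
  have hdet := (g : Matrix.SpecialLinearGroup (Fin 2) ℂ).2
  rw [Matrix.det_fin_two] at hdet
  have h : ∀ k k', a k * b k' * υ.mat g = ∑ p, ∑ q,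
      ((g : Matrix.SpecialLinearGroup (Fin 2) ℂ).1 k p *
        (g : Matrix.SpecialLinearGroup (Fin 2) ℂ).1 k' q) • (τ.mat g * (a p * b q)) := by
    intro k k'
    rw [Matrix.mul_assoc, hb g k', Matrix.mul_sum, Finset.sum_comm]
    refine Finset.sum_congr rfl fun q _ => ?_
    rw [Matrix.mul_smul, ← Matrix.mul_assoc, ha g k, Matrix.sum_mul, Finset.smul_sum]
    refine Finset.sum_congr rfl fun p _ => ?_
    rw [Matrix.smul_mul, smul_smul, mul_comm, Matrix.mul_assoc]
  simp only [Matrix.sub_mul, h, Matrix.mul_sub, Fin.sum_univ_two]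
  refine sub_eq_zero.mp (Eq.trans (b := ((g : Matrix.SpecialLinearGroup (Fin 2) ℂ).1 0 0 * (g : Matrix.SpecialLinearGroup (Fin 2) ℂ).1 1 1 -
      (g : Matrix.SpecialLinearGroup (Fin 2) ℂ).1 0 1 * (g : Matrix.SpecialLinearGroup (Fin 2) ℂ).1 1 0 - 1) • (τ.mat g * (a 0 * b 1) - τ.mat g * (a 1 * b 0))) ?_ ?_)
  · module
  · rw [hdet, sub_self, zero_smul]

theorem sum_natRot_mul (a : Fin 2 → Matrix (Fin n) (Fin m) ℂ)
    (d : Fin 2 → Matrix (Fin m) (Fin n) ℂ) :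
    ∑ k, ∑ p, ∑ q, d k q p * natRot a k p q = natPairing m n a d := by
  rw [natPairing_apply, Matrix.trace_sub, Fin.sum_univ_two]
  simp only [natRot, Matrix.trace, Matrix.diag_apply, Matrix.mul_apply, Matrix.cons_val_zero,
    Matrix.cons_val_one, Matrix.neg_apply, mul_comm (d _ _ _), neg_mul,
    Finset.sum_neg_distrib]
  ring

end NatHom

end

noncomputable section

/-! ## Maps into corners -/

section CornerLift

variable {T : Type*} [Ring T] [Algebra ℂ T] {f : T} (hf : IsIdempotentElem f)

/-- The inclusion of a corner. -/
def cornerVal : hf.Corner →ₙₐ[ℂ] T where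
  toFun := Subtype.val
  map_smul' _ _ := rfl
  map_zero' := rfl
  map_add' _ _ := rfl
  map_mul' _ _ := rfl

/-- An element of a corner. -/
def cornerMk (s : T) (h1 : f * s = s) (h2 : s * f = s) : hf.Corner :=
  ⟨s, (Subsemigroup.mem_corner_iff hf).mpr ⟨h1, h2⟩⟩

theorem cornerVal_mk (s : T) (h1 : f * s = s) (h2 : s * f = s) :
    cornerVal hf (cornerMk hf s h1 h2) = s := rfl

theorem mul_cornerVal (s : hf.Corner) : f * cornerVal hf s = cornerVal hf s :=
  ((Subsemigroup.mem_corner_iff hf).mp s.2).1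

theorem cornerVal_injective : Function.Injective (cornerVal hf) := Subtype.val_injective

variable {U : T}

/-- The component in a corner of a central element. -/
def cornerCentral (hU : ∀ s, U * s = s * U) : hf.Corner :=
  cornerMk hf (U * f) (by rw [hU, ← mul_assoc, hf.eq]) (by rw [mul_assoc, hf.eq])

theorem cornerCentral_comm (hU : ∀ s, U * s = s * U) (s : hf.Corner) :
    cornerCentral hf hU * s = s * cornerCentral hf hU := by
  apply cornerVal_injective hf
  rw [map_mul, map_mul, cornerCentral, cornerVal_mk, mul_assoc, mul_cornerVal, hU, hU,
    ← mul_assoc]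
  congr 1
  exact ((Subsemigroup.mem_corner_iff hf).mp s.2).2.symm

/-- The factor `s` is essential: a constant polynomial evaluates to a multiple of `f` in the corner
but to a multiple of `1` in `T`, and only on elements of the corner do these agree. -/
theorem cornerVal_aeval_mul (hU : ∀ s, U * s = s * U) (r : ℂ[X]) (s : hf.Corner) :
    cornerVal hf (aeval (cornerCentral hf hU) r * s) = aeval U r * cornerVal hf s := by
  induction r using Polynomial.induction_on generalizing s with
  | C c =>
    rw [aeval_C, aeval_C, Algebra.algebraMap_eq_smul_one, Algebra.algebraMap_eq_smul_one,
      smul_mul_assoc, one_mul, smul_mul_assoc, one_mul, map_smul]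
  | add p q hp hq => rw [map_add, map_add, add_mul, add_mul, map_add, hp, hq]
  | monomial n c h =>
    rw [pow_succ, ← mul_assoc, map_mul (aeval _), map_mul (aeval U), aeval_X, aeval_X, mul_assoc, h, mul_assoc,
      map_mul (cornerVal hf), cornerCentral, cornerVal_mk, mul_assoc, mul_cornerVal]

/-- The homomorphism from the `N = 1` quiver algebra to a corner given by orthogonal idempotents,
a central element `U` and elements for the arrows that satisfy the relation. -/
theorem NOneQuiverAlgebra.exists_corner_lift {V : Type u} [Quiver.{v} V] [Fintype V]
    [∀ i j : V, Fintype (i ⟶ j)] (τ : V → ℂ[X]) (ε : V → T) (t : ∀ {i j : V}, Dbl i j → T)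
    (hε : ∀ i, ε i * ε i = ε i) (hne : ∀ i j, i ≠ j → ε i * ε j = 0)
    (hl : ∀ {i j : V} (a : Dbl i j), ε j * t a = t a)
    (hr : ∀ {i j : V} (a : Dbl i j), t a * ε i = t a) (hU : ∀ s, U * s = s * U)
    (hrel : ∑ i, ∑ j, ∑ a : Dbl j i, a.sign • (t a * t a.swap) = ∑ i, aeval U (τ i) * ε i) :
    ∃ φ : NOneQuiverAlgebra V τ →ₙₐ[ℂ] T, φ 1 = ∑ i, ε i ∧
      (∀ i, φ (RingQuot.mkAlgHom ℂ (Rel V τ) (e i)) = ε i) ∧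
      (∀ (i j : V) (a : Dbl i j), φ (RingQuot.mkAlgHom ℂ (Rel V τ) (dbl a)) = t a) ∧
      φ (RingQuot.mkAlgHom ℂ (Rel V τ) (uElt V)) = U * ∑ i, ε i := by
  classical
  have hl1 : ∀ i, (∑ j, ε j) * ε i = ε i := fun i => by
    rw [Finset.sum_mul, Finset.sum_eq_single i (fun j _ h => hne j i h) (by simp), hε]
  have hr1 : ∀ i, ε i * (∑ j, ε j) = ε i := fun i => by
    rw [Finset.mul_sum, Finset.sum_eq_single i (fun j _ h => hne i j h.symm) (by simp), hε]
  have hf : IsIdempotentElem (∑ i, ε i) := by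
    unfold IsIdempotentElem
    rw [Finset.sum_mul]
    exact Finset.sum_congr rfl fun i _ => hr1 i
  let E : V → hf.Corner := fun i => cornerMk hf (ε i) (hl1 i) (hr1 i)
  let t' : ∀ {i j : V}, Dbl i j → hf.Corner := fun {i j} a => cornerMk hf (t a)
    (by rw [← hl a, ← mul_assoc, hl1]) (by rw [← hr a, mul_assoc, hr1])
  have hinj := cornerVal_injective hf
  obtain ⟨φ, h1, h2, h3⟩ := exists_lift (S := hf.Corner) τ E (cornerCentral hf hU) t'
    (fun i => hinj (hε i)) (fun i j h => hinj (hne i j h))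
    (hinj (map_sum (cornerVal hf) E Finset.univ)) (fun a => hinj (hl a)) (fun a => hinj (hr a))
    (cornerCentral_comm hf hU) (hinj (by
      simp only [map_sum, map_smul, map_mul (cornerVal hf) (t' _), cornerVal_aeval_mul]
      exact hrel))
  refine ⟨(cornerVal hf).comp (φ : NOneQuiverAlgebra V τ →ₙₐ[ℂ] hf.Corner),
    congrArg (cornerVal hf) (map_one φ),
    fun i => congrArg (cornerVal hf) (h1 i), fun i j a => congrArg (cornerVal hf) (h2 i j a),
    congrArg (cornerVal hf) h3⟩

/-- The homomorphism from the deformed skew group algebra to a corner given by a multiplicative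
map on the group, elements for `x` and `y`, and a central element `U`. -/
theorem DeformedSkewAlgebra.exists_corner_lift {G : Subgroup (Matrix.SpecialLinearGroup (Fin 2) ℂ)}
    [Fintype G] {I : Type*} [Fintype I] {δ : I → ℕ} (ρ : ∀ i, Representation ℂ G (Fin (δ i) → ℂ))
    (τ : I → ℂ[X]) (σ : G →ₙ* T) (x : Fin 2 → T) (hU : ∀ s, U * s = s * U)
    (hx1 : ∀ k, x k * σ 1 = x k)
    (hx : ∀ g k, σ g * x k =
      ∑ l, (g : Matrix.SpecialLinearGroup (Fin 2) ℂ).1 l k • (x l * σ g))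
    (hrel : x 0 * x 1 - x 1 * x 0 = ∑ i, ∑ p, (δ i : ℂ)⁻¹ • (aeval U (τ i) *
      ∑ g : G, ((δ i : ℂ) / Fintype.card G * (ρ i).mat g⁻¹ p p) • σ g)) :
    ∃ φ : DeformedSkewAlgebra G (centralElement ρ τ) →ₙₐ[ℂ] T,
      (∀ g, φ (groupElt G _ g) = σ g) ∧ (∀ k, φ (var G _ k) = x k) ∧
      φ (param G _) = U * σ 1 := by
  have hf : IsIdempotentElem (σ 1) := by
    unfold IsIdempotentElem
    rw [← map_mul, mul_one]
  have hinj := cornerVal_injective hf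
  let σ' : G →* hf.Corner :=
    { toFun := fun g => cornerMk hf (σ g) (by rw [← map_mul, one_mul]) (by rw [← map_mul, mul_one])
      map_one' := rfl
      map_mul' := fun g h => hinj (map_mul σ g h) }
  have hx1' : ∀ k, σ 1 * x k = x k := fun k => by
    rw [hx]
    simp [hx1, Matrix.one_apply, ite_smul]
  let x' : Fin 2 → hf.Corner := fun k => cornerMk hf (x k) (hx1' k) (hx1 k)
  obtain ⟨φ, h1, h2, h3⟩ := exists_lift G (centralElement ρ τ) (S := hf.Corner) σ' x'
    (cornerCentral hf hU) (cornerCentral_comm hf hU) (fun g k => hinj (by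
      simp only [map_mul, map_sum, map_smul]
      exact hx g k)) (hinj (by
      rw [evalGroupAlgebra_centralElement]
      simp only [map_sum, map_smul, cornerVal_aeval_mul, matUnit]
      exact hrel))
  exact ⟨(cornerVal hf).comp (φ : DeformedSkewAlgebra G (centralElement ρ τ) →ₙₐ[ℂ] hf.Corner),
    fun g => congrArg (cornerVal hf) (h1 g), fun k => congrArg (cornerVal hf) (h2 k),
    congrArg (cornerVal hf) h3⟩

end CornerLift

/-! ## Systems of homomorphisms indexed by the arrows of the double -/

open Representation NOneQuiverAlgebra

/-- Expansion in one of two dual systems. -/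
theorem eq_sum_of_dual_system {k : Type*} [Field k] {W W' : Type*} [AddCommGroup W] [Module k W]
    [AddCommGroup W'] [Module k W'] [FiniteDimensional k W'] (B : W →ₗ[k] W' →ₗ[k] k)
    {ι : Type*} [Fintype ι] [DecidableEq ι] (hW' : Module.finrank k W' = Fintype.card ι)
    {c : ι → W} {c' : ι → W'} {s : ι → k} (hs : ∀ a, s a ≠ 0)
    (h : ∀ a b, B (c a) (c' b) = if a = b then s a else 0) (d : W') :
    d = ∑ a, ((s a)⁻¹ * B (c a) d) • c' a := by
  have hB : ∀ (r : ι → k) a, B (c a) (∑ b, r b • c' b) = s a * r a := fun r a => by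
    simp [h, mul_comm]
  have hli : LinearIndependent k c' := by
    rw [Fintype.linearIndependent_iff]
    intro r hr a
    have := hB r a
    rw [hr, map_zero] at this
    exact (mul_eq_zero.mp this.symm).resolve_left (hs a)
  have hd : d ∈ Submodule.span k (Set.range c') := by
    rw [hli.span_eq_top_of_card_eq_finrank' hW'.symm]
    trivial
  obtain ⟨r, rfl⟩ := (Submodule.mem_span_range_iff_exists_fun k).mp hd
  refine Finset.sum_congr rfl fun a _ => ?_
  rw [hB, inv_mul_cancel_left₀ (hs a)]

/-- Homomorphisms of representations into tensor products with the natural representation, one for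
each arrow of the double of a quiver, which form systems dual to each other. -/
structure IsDualSystem {G : Subgroup (Matrix.SpecialLinearGroup (Fin 2) ℂ)} [Fintype G]
    {I : Type u} [Quiver.{v} I] [∀ i j : I, Fintype (i ⟶ j)] {δ : I → ℕ}
    (ρ : ∀ i, Representation ℂ G (Fin (δ i) → ℂ))
    (c : ∀ {i j : I}, Dbl i j → Fin 2 → Matrix (Fin (δ j)) (Fin (δ i)) ℂ) : Prop where
  mem : ∀ {i j : I} (a : Dbl i j), c a ∈ natHom (ρ i) (ρ j)
  pairing_swap : ∀ {i j : I} (a : Dbl i j), natPairing (δ i) (δ j) (c a) (c a.swap) = a.sign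
  pairing_of_ne : ∀ {i j : I} (a : Dbl i j) (b : Dbl j i), b ≠ a.swap →
    natPairing (δ i) (δ j) (c a) (c b) = 0
  sum_natAct : ∀ {i j : I} (d : Fin 2 → Matrix (Fin (δ i)) (Fin (δ j)) ℂ),
    ∑ g : G, natAct (ρ j) (ρ i) g d = ∑ a : Dbl i j,
      ((Fintype.card G : ℂ) * (natPairing (δ i) (δ j) (c a) d * a.sign)) • c a.swap

theorem IsMcKayQuiver.exists_isDualSystem {G : Subgroup (Matrix.SpecialLinearGroup (Fin 2) ℂ)}
    [Fintype G] {I : Type u} [Fintype I] [Quiver.{v} I] [∀ i j : I, Fintype (i ⟶ j)] {δ : I → ℕ}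
    {ρ : ∀ i, Representation ℂ G (Fin (δ i) → ℂ)} (hQ : IsMcKayQuiver G ρ) :
    ∃ c : ∀ {i j : I}, Dbl i j → Fin 2 → Matrix (Fin (δ j)) (Fin (δ i)) ℂ,
      IsDualSystem ρ c := by
  classical
  have hfin : ∀ i j, Module.finrank ℂ (natHom (ρ i) (ρ j)) =
      Fintype.card (i ⟶ j) + Fintype.card (j ⟶ i) := fun i j => by
    rw [finrank_natHom, hQ i j]
  obtain ⟨c, hc⟩ := exists_dbl_dual_system (W := fun i j => natHom (ρ i) (ρ j))
    (fun i j => natHomPairing (ρ i) (ρ j)) (fun i j c d => natPairing_anti c.1 d.1)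
    (fun i j d h => natHomPairing_nondegenerate d h) hfin
  have hsign : ∀ {i j : I} (a : Dbl i j), a.sign * a.sign = 1 := fun a => by
    cases a <;> simp [Dbl.sign]
  refine ⟨fun a => (c a).1, fun a => (c a).2, fun a => (hc _ _ a _).1 rfl,
    fun a b h => (hc _ _ a b).2 h, fun {i j} d => ?_⟩
  have h := eq_sum_of_dual_system (natHomPairing (ρ i) (ρ j)) (ι := Dbl i j)
    (by rw [hfin, Fintype.card_sum, add_comm]) (c := fun a => c a) (c' := fun a => c a.swap)
    (s := Dbl.sign) (fun a h0 => by simpa [h0] using hsign a) (fun a b => by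
      split_ifs with hab
      · exact hab ▸ (hc _ _ a _).1 rfl
      · exact (hc _ _ a _).2 fun h0 => hab (by simpa using congrArg Sum.swap h0.symm))
    ⟨_, sum_natAct_mem d⟩
  have h2 := congrArg Subtype.val h
  rw [AddSubmonoidClass.coe_finsetSum] at h2
  refine h2.trans (Finset.sum_congr rfl fun a _ => ?_)
  -- The coefficients of the averaged element are `|G|` times the pairings with `d` itself, as `c a`
  -- is invariant.
  have h3 : natPairing (δ i) (δ j) (c a).1 (∑ g : G, natAct (ρ j) (ρ i) g d) =
      Fintype.card G * natPairing (δ i) (δ j) (c a).1 d := by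
    rw [natPairing_anti, map_sum, LinearMap.sum_apply,
      Finset.sum_congr rfl fun g _ => natPairing_natAct g d (c a).2, Finset.sum_const,
      Finset.card_univ, nsmul_eq_mul, natPairing_anti d]
    ring
  rw [natHomPairing_apply, h3, inv_eq_of_mul_eq_one_right (hsign a)]
  change (_ : ℂ) • (c a.swap).1 = _
  congr 1
  ring

namespace IsDualSystem

variable {G : Subgroup (Matrix.SpecialLinearGroup (Fin 2) ℂ)} [Fintype G] {I : Type u}
  [Quiver.{v} I] [∀ i j : I, Fintype (i ⟶ j)] {δ : I → ℕ}
  {ρ : ∀ i, Representation ℂ G (Fin (δ i) → ℂ)}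
  {c : ∀ {i j : I}, Dbl i j → Fin 2 → Matrix (Fin (δ j)) (Fin (δ i)) ℂ} (hc : IsDualSystem ρ c)
  (hρ : IsCompleteIrreps ρ)

include hc hρ

/-- The contraction intertwines inequivalent irreducible representations. -/
theorem comp_of_ne {i j m : I} (h : i ≠ j) (a : Dbl m j) (b : Dbl i m) :
    natRot (c a) 0 * natRot (c b) 1 - natRot (c a) 1 * natRot (c b) 0 = 0 := by
  rw [natRot_mul_natRot]
  exact eq_zero_of_comm (hρ.irreducible i) (hρ.irreducible j) (hρ.isEmpty_equiv h) _
    fun g => natHom_comp_comm (hc.mem a) (hc.mem b) g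

/-- The contraction is a scalar by Schur's lemma, and its trace is the pairing by definition. -/
theorem comp_self {i m : I} (a : Dbl m i) (b : Dbl i m) :
    natRot (c a) 0 * natRot (c b) 1 - natRot (c a) 1 * natRot (c b) 0 =
      (natPairing (δ m) (δ i) (c a) (c b) / δ i) • (1 : Matrix (Fin (δ i)) (Fin (δ i)) ℂ) := by
  rw [natRot_mul_natRot]
  exact eq_trace_smul_one_of_comm (hρ.irreducible i) _ fun g =>
    natHom_comp_comm (hc.mem a) (hc.mem b) g

end IsDualSystem

end

noncomputable section

open Representation NOneQuiverAlgebra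

/-! ## Arrows of the quiver algebra in the deformed skew group algebra -/

section ArrowElt

variable {G : Subgroup (Matrix.SpecialLinearGroup (Fin 2) ℂ)} [Fintype G] {S : Type*} [Ring S]
  [Algebra ℂ S] (f : G →* S) (x : Fin 2 → S) {m n : ℕ}
  (σ : Representation ℂ G (Fin m → ℂ)) (τ : Representation ℂ G (Fin n → ℂ))
  (o : Fin m) (o' : Fin n)

/-- The combination of the elements `E_{o' p} y E_{q o}` with the entries of a matrix as
coefficients, where `E` denotes the matrix units of `τ` and `σ`. -/
def sandwich : S →ₗ[ℂ] Matrix (Fin m) (Fin n) ℂ →ₗ[ℂ] S :=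
  LinearMap.mk₂ ℂ (fun y M => ∑ p, ∑ q, M q p • (matUnit f τ o' p * y * matUnit f σ q o))
    (fun y y' M => by simp only [mul_add, add_mul, smul_add, Finset.sum_add_distrib])
    (fun r y M => by
      simp only [mul_smul_comm, smul_mul_assoc, Finset.smul_sum, smul_comm r])
    (fun y M M' => by simp only [Matrix.add_apply, add_smul, Finset.sum_add_distrib])
    (fun r y M => by simp only [Matrix.smul_apply, smul_assoc, Finset.smul_sum])

theorem sandwich_apply (y : S) (M : Matrix (Fin m) (Fin n) ℂ) : sandwich f σ τ o o' y M =
    ∑ p, ∑ q, M q p • (matUnit f τ o' p * y * matUnit f σ q o) := rfl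

theorem sandwich_single (y : S) (p : Fin n) (q : Fin m) :
    sandwich f σ τ o o' y (Matrix.single q p 1) = matUnit f τ o' p * y * matUnit f σ q o := by
  rw [sandwich_apply, Finset.sum_eq_single p, Finset.sum_eq_single q]
  · simp
  · intro q' _ h
    simp [h.symm]
  · simp
  · intro p' _ h
    simp [h.symm]
  · simp

theorem sandwich_mul_left (g : G) (y : S) (M : Matrix (Fin m) (Fin n) ℂ) :
    sandwich f σ τ o o' (f g * y) M = sandwich f σ τ o o' y (M * τ.mat g) := by
  simp only [sandwich_apply, Matrix.mul_apply, Finset.sum_smul, ← mul_assoc, matUnit_mul,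
    Finset.sum_mul, smul_mul_assoc, Finset.smul_sum, smul_smul]
  rw [Finset.sum_comm]
  conv_rhs => rw [Finset.sum_comm]
  exact Finset.sum_congr rfl fun q _ => Finset.sum_comm

theorem sandwich_mul_right (g : G) (y : S) (M : Matrix (Fin m) (Fin n) ℂ) :
    sandwich f σ τ o o' (y * f g) M = sandwich f σ τ o o' y (σ.mat g * M) := by
  simp only [sandwich_apply, Matrix.mul_apply, Finset.sum_smul, mul_assoc, mul_matUnit,
    Finset.mul_sum, mul_smul_comm, Finset.smul_sum, smul_smul]
  refine Finset.sum_congr rfl fun p _ => ?_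
  rw [Finset.sum_comm]
  simp only [mul_comm (M _ _)]

/-- The combination of the elements `E_{o' p} x_k E_{q o}` with the entries of a two-component
matrix as coefficients, where `E` denotes the matrix units of `τ` and `σ`. -/
def arrowElt : (Fin 2 → Matrix (Fin m) (Fin n) ℂ) →ₗ[ℂ] S :=
  ∑ k, sandwich f σ τ o o' (x k) ∘ₗ LinearMap.proj k

theorem arrowElt_apply (d : Fin 2 → Matrix (Fin m) (Fin n) ℂ) : arrowElt f x σ τ o o' d =
    ∑ k, sandwich f σ τ o o' (x k) (d k) := by
  simp [arrowElt]

theorem arrowElt_single (k : Fin 2) (p : Fin n) (q : Fin m) :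
    arrowElt f x σ τ o o' (Pi.single k (Matrix.single q p 1)) =
      matUnit f τ o' p * x k * matUnit f σ q o := by
  rw [arrowElt_apply, Finset.sum_eq_single k, Pi.single_eq_same, sandwich_single]
  · intro k' _ h
    rw [Pi.single_eq_of_ne h, map_zero]
  · simp

variable {f x}

/-- Conjugating `x_k` by `g` can be absorbed either by the variables or by the matrix units next to
them. Hence `arrowElt` depends only on the average of `d` over the group. -/
theorem arrowElt_natAct (hx : ∀ g k, f g * x k =
      ∑ l, (g : Matrix.SpecialLinearGroup (Fin 2) ℂ).1 l k • (x l * f g))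
    (g : G) (d : Fin 2 → Matrix (Fin m) (Fin n) ℂ) :
    arrowElt f x σ τ o o' (natAct τ σ g d) = arrowElt f x σ τ o o' d := by
  have h2 : ∀ k, x k =
      f g⁻¹ * (∑ l, (g : Matrix.SpecialLinearGroup (Fin 2) ℂ).1 l k • x l) * f g := by
    intro k
    rw [mul_assoc, Finset.sum_mul]
    simp only [smul_mul_assoc]
    rw [← hx, ← mul_assoc, ← map_mul, inv_mul_cancel, map_one, one_mul]
  have h3 : ∀ k, sandwich f σ τ o o' (x k) (d k) =
      ∑ l, (g : Matrix.SpecialLinearGroup (Fin 2) ℂ).1 l k •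
        sandwich f σ τ o o' (x l) (σ.mat g * d k * τ.mat g⁻¹) := by
    intro k
    conv_lhs => rw [h2 k]
    rw [sandwich_mul_right, sandwich_mul_left]
    simp only [map_sum, map_smul, LinearMap.sum_apply, LinearMap.smul_apply]
  simp only [arrowElt_apply, h3, natAct, map_sum, map_smul]
  exact Finset.sum_comm

theorem natPairing_single (a : Fin 2 → Matrix (Fin n) (Fin m) ℂ) (k : Fin 2) (p : Fin n)
    (q : Fin m) : natPairing m n a (Pi.single k (Matrix.single q p 1)) = natRot a k p q := by
  rw [← sum_natRot_mul, Finset.sum_eq_single k, Finset.sum_eq_single p, Finset.sum_eq_single q]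
  · simp
  · intro q' _ h
    simp [h.symm]
  · simp
  · intro p' _ h
    simp [h.symm]
  · simp
  · intro k' _ h
    simp [h]
  · simp

end ArrowElt

namespace IsDualSystem

variable {G : Subgroup (Matrix.SpecialLinearGroup (Fin 2) ℂ)} [Fintype G] {I : Type u}
  [Quiver.{v} I] [∀ i j : I, Fintype (i ⟶ j)] {δ : I → ℕ}
  {ρ : ∀ i, Representation ℂ G (Fin (δ i) → ℂ)}
  {c : ∀ {i j : I}, Dbl i j → Fin 2 → Matrix (Fin (δ j)) (Fin (δ i)) ℂ} (hc : IsDualSystem ρ c)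
  {S : Type*} [Ring S] [Algebra ℂ S] {f : G →* S} {x : Fin 2 → S} (o : ∀ i, Fin (δ i))

-- The left side is `arrowElt` of an elementary pair of matrices. Replace that pair by its average,
-- expand it in the `c_{a*}` by `sum_natAct`, and read the coefficients off `natPairing_single`.
include hc in
theorem matUnit_mul_mul_matUnit (hx : ∀ g k, f g * x k =
      ∑ l, (g : Matrix.SpecialLinearGroup (Fin 2) ℂ).1 l k • (x l * f g)) {i j : I} (k : Fin 2)
    (p : Fin (δ j)) (q : Fin (δ i)) :
    matUnit f (ρ j) (o j) p * x k * matUnit f (ρ i) q (o i) = ∑ a : Dbl i j, natRot (c a) k p q •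
      a.sign • arrowElt f x (ρ i) (ρ j) (o i) (o j) (c a.swap) := by
  have hG : (Fintype.card G : ℂ) ≠ 0 := Nat.cast_ne_zero.mpr Fintype.card_ne_zero
  have h := congrArg (arrowElt f x (ρ i) (ρ j) (o i) (o j))
    (hc.sum_natAct (i := i) (j := j) (Pi.single k (Matrix.single q p 1)))
  rw [map_sum, Finset.sum_congr rfl fun g _ => arrowElt_natAct _ _ _ _ hx g _, Finset.sum_const,
    Finset.card_univ, ← Nat.cast_smul_eq_nsmul ℂ, map_sum, arrowElt_single] at h
  rw [← smul_right_injective _ hG |>.eq_iff, h, Finset.smul_sum]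
  refine Finset.sum_congr rfl fun a _ => ?_
  rw [map_smul, natPairing_single, smul_smul, smul_smul, mul_assoc]

end IsDualSystem

end

/-! ### The quiver relation in the compressed skew group algebra -/

noncomputable section

open Representation NOneQuiverAlgebra

namespace IsDualSystem

variable {G : Subgroup (Matrix.SpecialLinearGroup (Fin 2) ℂ)} [Fintype G] {I : Type u} [Fintype I]
  [Quiver.{v} I] [∀ i j : I, Fintype (i ⟶ j)] {δ : I → ℕ}
  {ρ : ∀ i, Representation ℂ G (Fin (δ i) → ℂ)}
  {c : ∀ {i j : I}, Dbl i j → Fin 2 → Matrix (Fin (δ j)) (Fin (δ i)) ℂ} (hc : IsDualSystem ρ c)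
  (hρ : IsCompleteIrreps ρ)
  {S : Type*} [Ring S] [Algebra ℂ S] {f : G →* S} {x : Fin 2 → S} {o : ∀ i, Fin (δ i)}
  (hx : ∀ g k, f g * x k =
    ∑ l, (g : Matrix.SpecialLinearGroup (Fin 2) ℂ).1 l k • (x l * f g))
  {t : ∀ {i j : I}, Dbl i j → S}
  (ht : ∀ {i j : I} (a : Dbl i j),
    t a = a.sign • arrowElt f x (ρ i) (ρ j) (o i) (o j) (c a.swap))

include hρ

theorem matUnit_mul_arrowElt {i j : I} (d : Fin 2 → Matrix (Fin (δ i)) (Fin (δ j)) ℂ) :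
    matUnit f (ρ j) (o j) (o j) * arrowElt f x (ρ i) (ρ j) (o i) (o j) d =
      arrowElt f x (ρ i) (ρ j) (o i) (o j) d := by
  simp only [arrowElt_apply, sandwich_apply, Finset.mul_sum, mul_smul_comm, ← mul_assoc,
    hρ.matUnit_mul_self, if_true]

theorem arrowElt_mul_matUnit {i j : I} (d : Fin 2 → Matrix (Fin (δ i)) (Fin (δ j)) ℂ) :
    arrowElt f x (ρ i) (ρ j) (o i) (o j) d * matUnit f (ρ i) (o i) (o i) =
      arrowElt f x (ρ i) (ρ j) (o i) (o j) d := by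
  simp only [arrowElt_apply, sandwich_apply, Finset.sum_mul, smul_mul_assoc, mul_assoc,
    hρ.matUnit_mul_self, if_true]

include hc hx ht

/-- Insert `1 = ∑ E^j_{p o_j} E^j_{o_j p}` between the variables and expand both factors in arrows;
the sum over `p` is a matrix product. -/
theorem corner_mul_mul (i : I) (k l : Fin 2) :
    matUnit f (ρ i) (o i) (o i) * (x k * x l) * matUnit f (ρ i) (o i) (o i) =
      ∑ j, ∑ a : Dbl j i, ∑ b : Dbl i j,
        (natRot (c a) k * natRot (c b) l) (o i) (o i) • (t a * t b) := by
  have h1 : matUnit f (ρ i) (o i) (o i) * (x k * x l) * matUnit f (ρ i) (o i) (o i) =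
      ∑ j, ∑ p, (matUnit f (ρ i) (o i) (o i) * x k * matUnit f (ρ j) p (o j)) *
        (matUnit f (ρ j) (o j) p * x l * matUnit f (ρ i) (o i) (o i)) := by
    have h2 : x k * x l = x k * (∑ j, ∑ p, matUnit f (ρ j) p p) * x l := by
      rw [hρ.sum_matUnit, mul_one]
    rw [h2]
    simp only [Finset.mul_sum, Finset.sum_mul]
    refine Finset.sum_congr rfl fun j _ => Finset.sum_congr rfl fun p _ => ?_
    have h3 : matUnit f (ρ j) p p = matUnit f (ρ j) p (o j) * matUnit f (ρ j) (o j) p := by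
      rw [hρ.matUnit_mul_self, if_pos rfl]
    rw [h3]
    simp only [mul_assoc]
  rw [h1]
  refine Finset.sum_congr rfl fun j _ => ?_
  simp only [hc.matUnit_mul_mul_matUnit o hx, ← ht, Finset.sum_mul_sum, smul_mul_smul_comm,
    Matrix.mul_apply, Finset.sum_smul]
  rw [Finset.sum_comm]
  exact Finset.sum_congr rfl fun a _ => Finset.sum_comm

/-- The coefficient of `t a * t b` is a diagonal entry of the contraction of `c a` and `c b`, which
is `⟨c a, c b⟩ / δ i`. Duality leaves only `b = a*`. -/
theorem corner_commutator (i : I) :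
    matUnit f (ρ i) (o i) (o i) * (x 0 * x 1 - x 1 * x 0) * matUnit f (ρ i) (o i) (o i) =
      (δ i : ℂ)⁻¹ • ∑ j, ∑ a : Dbl j i, a.sign • (t a * t a.swap) := by
  rw [mul_sub, sub_mul, hc.corner_mul_mul hρ hx ht, hc.corner_mul_mul hρ hx ht]
  simp only [← Finset.sum_sub_distrib, ← sub_smul, ← Matrix.sub_apply, hc.comp_self hρ,
    Finset.smul_sum]
  refine Finset.sum_congr rfl fun j _ => Finset.sum_congr rfl fun a _ => ?_
  rw [Finset.sum_eq_single a.swap]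
  · rw [hc.pairing_swap, Matrix.smul_apply, Matrix.one_apply_eq, smul_smul, smul_eq_mul, mul_one,
      div_eq_inv_mul]
  · intro b _ hb
    rw [hc.pairing_of_ne a b hb, zero_div, zero_smul, Matrix.zero_apply, zero_smul]
  · simp

theorem sum_sign_smul_mul {U : S} (hU : ∀ s, U * s = s * U) {τ : I → ℂ[X]}
    (hrel : x 0 * x 1 - x 1 * x 0 =
      ∑ i, ∑ p, (δ i : ℂ)⁻¹ • (aeval U (τ i) * matUnit f (ρ i) p p)) :
    ∑ i, ∑ j, ∑ a : Dbl j i, a.sign • (t a * t a.swap) =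
      ∑ i, aeval U (τ i) * matUnit f (ρ i) (o i) (o i) := by
  refine Finset.sum_congr rfl fun i _ => ?_
  have hc' : ∀ (r : ℂ[X]) s, aeval U r * s = s * aeval U r := fun r s => by
    have h := Algebra.commute_of_mem_adjoin_singleton_of_commute
      (aeval_mem_adjoin_singleton ℂ U (p := r)) (hU s : Commute U s).symm
    exact h.symm
  have h := hc.corner_commutator hρ hx ht i
  have h0 := hρ.dim_ne_zero i
  rw [hrel, eq_inv_smul_iff₀ h0] at h
  rw [← h]
  simp only [Finset.mul_sum, Finset.sum_mul, mul_smul_comm, smul_mul_assoc]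
  rw [Finset.sum_eq_single i, Finset.sum_eq_single (o i)]
  · rw [smul_smul, mul_inv_cancel₀ h0, one_smul, ← mul_assoc, ← hc', mul_assoc, mul_assoc,
      hρ.matUnit_mul_self, if_pos rfl, hρ.matUnit_mul_self, if_pos rfl]
  · intro p _ hp
    rw [← mul_assoc, ← hc', mul_assoc, mul_assoc, hρ.matUnit_mul_self f i p p, if_neg hp,
      mul_zero, mul_zero, smul_zero]
  · simp
  · intro j _ hj
    refine Finset.sum_eq_zero fun p _ => ?_
    rw [← mul_assoc, ← hc', mul_assoc, mul_assoc, hρ.matUnit_mul_of_ne f hj, mul_zero, mul_zero,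
      smul_zero]
  · simp

end IsDualSystem

end

noncomputable section

open Representation NOneQuiverAlgebra

/-! ## Block matrices -/

section Blocks

variable {I : Type*} [Fintype I] [DecidableEq I] (δ : I → ℕ) (R : Type*) [Ring R]

/-- The inclusion of a block of coordinates. -/
def blockIncl (j : I) : Matrix (Σ i, Fin (δ i)) (Fin (δ j)) R :=
  Matrix.of fun n p => if n = ⟨j, p⟩ then 1 else 0

theorem blockIncl_transpose_mul_self (j : I) :
    (blockIncl δ R j).transpose * blockIncl δ R j = 1 := by
  ext p q
  simp [Matrix.mul_apply, blockIncl, Matrix.one_apply, eq_comm]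

theorem blockIncl_transpose_mul_of_ne {i j : I} (h : i ≠ j) :
    (blockIncl δ R i).transpose * blockIncl δ R j = 0 := by
  ext p q
  simp [Matrix.mul_apply, blockIncl, h.symm]

theorem scalar_mul_blockIncl (j : I) (r : R) :
    Matrix.scalar (Σ i, Fin (δ i)) r * blockIncl δ R j = blockIncl δ R j * Matrix.scalar (Fin (δ j)) r := by
  ext n p
  simp [blockIncl]

variable {δ R} [Algebra ℂ R]

/-- The matrix whose block in place `j i` is the product of a complex matrix and an element. -/
def blk (j i : I) : Matrix (Fin (δ j)) (Fin (δ i)) ℂ →ₗ[ℂ] R →ₗ[ℂ]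
    Matrix (Σ i, Fin (δ i)) (Σ i, Fin (δ i)) R :=
  LinearMap.mk₂ ℂ
    (fun M r => blockIncl δ R j * M.map (fun z => z • r) * (blockIncl δ R i).transpose)
    (fun M M' r => by
      rw [← Matrix.add_mul, ← Matrix.mul_add]
      congr 2
      ext p q
      simp [add_smul])
    (fun z M r => by
      rw [← Matrix.smul_mul, ← Matrix.mul_smul]
      congr 2
      ext p q
      simp [mul_smul])
    (fun M r r' => by
      rw [← Matrix.add_mul, ← Matrix.mul_add]
      congr 2
      ext p q
      simp)
    (fun z M r => by
      rw [← Matrix.smul_mul, ← Matrix.mul_smul]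
      congr 2
      ext p q
      simp [smul_comm z])

theorem blk_apply (j i : I) (M : Matrix (Fin (δ j)) (Fin (δ i)) ℂ) (r : R) : blk j i M r =
    blockIncl δ R j * M.map (fun z => z • r) * (blockIncl δ R i).transpose := rfl

theorem blk_mul_blk (j i l : I) (M : Matrix (Fin (δ j)) (Fin (δ i)) ℂ) (r : R)
    (N : Matrix (Fin (δ i)) (Fin (δ l)) ℂ) (s : R) :
    blk j i M r * blk i l N s = blk j l (M * N) (r * s) := by
  have h : M.map (fun z => z • r) * N.map (fun z => z • s) =
      (M * N).map (fun z => z • (r * s)) := by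
    ext p q
    simp only [Matrix.mul_apply, Matrix.map_apply, Finset.sum_smul, smul_mul_smul_comm]
  rw [blk_apply, blk_apply, blk_apply, ← h]
  calc _ = blockIncl δ R j * M.map (fun z => z • r) *
        ((blockIncl δ R i).transpose * blockIncl δ R i) * N.map (fun z => z • s) *
          (blockIncl δ R l).transpose := by simp only [Matrix.mul_assoc]
    _ = _ := by
      rw [blockIncl_transpose_mul_self, Matrix.mul_one]
      simp only [Matrix.mul_assoc]

theorem blk_mul_blk_of_ne (j : I) {i i' : I} (h : i ≠ i') (l : I)
    (M : Matrix (Fin (δ j)) (Fin (δ i)) ℂ) (r : R)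
    (N : Matrix (Fin (δ i')) (Fin (δ l)) ℂ) (s : R) :
    blk j i M r * blk i' l N s = 0 := by
  rw [blk_apply, blk_apply]
  calc _ = blockIncl δ R j * M.map (fun z => z • r) *
        ((blockIncl δ R i).transpose * blockIncl δ R i') * N.map (fun z => z • s) *
          (blockIncl δ R l).transpose := by simp only [Matrix.mul_assoc]
    _ = _ := by
      rw [blockIncl_transpose_mul_of_ne δ R h]
      simp only [Matrix.mul_zero, Matrix.zero_mul]

theorem scalar_mul_blk (j i : I) (M : Matrix (Fin (δ j)) (Fin (δ i)) ℂ) (r s : R) :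
    Matrix.scalar (Σ i, Fin (δ i)) s * blk j i M r = blk j i M (s * r) := by
  have h : Matrix.scalar (Fin (δ j)) s * M.map (fun z => z • r) = M.map (fun z => z • (s * r)) := by
    ext p q
    simp
  rw [blk_apply, blk_apply, ← Matrix.mul_assoc, ← Matrix.mul_assoc, scalar_mul_blockIncl,
    Matrix.mul_assoc (blockIncl δ R j), h]

theorem sum_blk_mul_blk (M : ∀ i, Matrix (Fin (δ i)) (Fin (δ i)) ℂ) (r : I → R) (j i : I)
    (N : Matrix (Fin (δ j)) (Fin (δ i)) ℂ) (s : R) :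
    (∑ l, blk l l (M l) (r l)) * blk j i N s = blk j i (M j * N) (r j * s) := by
  rw [Finset.sum_mul, Finset.sum_eq_single j, blk_mul_blk]
  · exact fun l _ h => blk_mul_blk_of_ne _ h _ _ _ _ _
  · simp

theorem blk_mul_sum_blk (M : ∀ i, Matrix (Fin (δ i)) (Fin (δ i)) ℂ) (r : I → R) (j i : I)
    (N : Matrix (Fin (δ j)) (Fin (δ i)) ℂ) (s : R) :
    blk j i N s * (∑ l, blk l l (M l) (r l)) = blk j i (N * M i) (s * r i) := by
  rw [Finset.mul_sum, Finset.sum_eq_single i, blk_mul_blk]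
  · exact fun l _ h => blk_mul_blk_of_ne _ h.symm _ _ _ _ _
  · simp

/-- Cutting out the block in place `j i` by the inclusions `blockIncl` isolates one summand, and `r
j i` is its entry at `o j`, `o i`. -/
theorem eq_zero_of_sum_blk_eq_zero {o : ∀ i, Fin (δ i)} {r : I → I → R}
    (h : ∑ j, ∑ i, blk j i (Matrix.single (o j) (o i) 1) (r j i) = 0) (j i : I) : r j i = 0 := by
  have h1 : ∀ j' i', (blockIncl δ R j).transpose *
      blk j' i' (Matrix.single (o j') (o i') 1) (r j' i') * blockIncl δ R i =
      ((blockIncl δ R j).transpose * blockIncl δ R j') *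
        (Matrix.single (o j') (o i') (1 : ℂ)).map (fun z => z • (r j' i')) *
        ((blockIncl δ R i').transpose * blockIncl δ R i) := fun j' i' => by
    rw [blk_apply]
    simp only [Matrix.mul_assoc]
  have h2 := congrArg (fun X => ((blockIncl δ R j).transpose * X * blockIncl δ R i) (o j) (o i)) h
  simp only [Matrix.mul_sum, Matrix.sum_mul, h1] at h2
  rw [Finset.sum_eq_single j, Finset.sum_eq_single i] at h2
  · simpa [blockIncl_transpose_mul_self] using h2
  · intro i' _ hi
    rw [blockIncl_transpose_mul_of_ne δ R hi, Matrix.mul_zero]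
  · simp
  · intro j' _ hj
    refine Finset.sum_eq_zero fun i' _ => ?_
    rw [blockIncl_transpose_mul_of_ne δ R hj.symm, Matrix.zero_mul, Matrix.zero_mul]
  · simp

end Blocks

/-! ## Relations and generators of the `N = 1` quiver algebra -/

namespace NOneQuiverAlgebra

variable {V : Type u} [Quiver.{v} V] [Fintype V] [∀ i j : V, Fintype (i ⟶ j)] (τ : V → ℂ[X])

/-- An arrow of the double of `Q`, in the `N = 1` quiver algebra. -/
def arrowOf {i j : V} (a : Dbl i j) : NOneQuiverAlgebra V τ :=
  RingQuot.mkAlgHom ℂ (Rel V τ) (dbl a)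

/-- The central element `u` of the `N = 1` quiver algebra. -/
def loopSum : NOneQuiverAlgebra V τ := RingQuot.mkAlgHom ℂ (Rel V τ) (uElt V)

theorem idem_mul_self (i : V) : idem τ i * idem τ i = idem τ i := isIdempotentElem_idem τ i

theorem idem_mul_of_ne {i j : V} (h : i ≠ j) : idem τ i * idem τ j = 0 := by
  rw [idem, idem, ← map_mul, e_mul_of_ne h, map_zero]

theorem sum_idem : ∑ i, idem τ i = 1 := by
  simp only [idem]
  rw [← map_sum, sum_e, map_one]

theorem idem_mul_arrowOf {i j : V} (a : Dbl i j) : idem τ j * arrowOf τ a = arrowOf τ a := by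
  rw [idem, arrowOf, ← map_mul]
  cases a with
  | inl a => rw [dbl, e_mul_arr]
  | inr a => rw [dbl, e_mul_rev]

theorem arrowOf_mul_idem {i j : V} (a : Dbl i j) : arrowOf τ a * idem τ i = arrowOf τ a := by
  rw [idem, arrowOf, ← map_mul]
  cases a with
  | inl a => rw [dbl, arr_mul_e]
  | inr a => rw [dbl, rev_mul_e]

theorem loopSum_comm (b : NOneQuiverAlgebra V τ) : loopSum τ * b = b * loopSum τ := by
  obtain ⟨x, rfl⟩ := RingQuot.mkAlgHom_surjective ℂ (Rel V τ) b
  rw [loopSum, ← map_mul, ← map_mul]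
  exact RingQuot.mkAlgHom_rel ℂ (Rel.central x)

theorem sum_sign_smul_arrowOf_mul (i : V) :
    ∑ j, ∑ a : Dbl j i, a.sign • (arrowOf τ a * arrowOf τ a.swap) =
      aeval (loopSum τ) (τ i) * idem τ i := by
  have h : ∑ i, ∑ j, ∑ a : Dbl j i, a.sign • (arrowOf τ a * arrowOf τ a.swap) =
      ∑ i, aeval (loopSum τ) (τ i) * idem τ i := by
    rw [sum_sign_dbl (fun a => arrowOf τ a)]
    have h := RingQuot.mkAlgHom_rel ℂ (Rel.moment (V := V) (τ := τ))
    simp only [map_sum, map_sub, map_mul, ← aeval_algHom_apply] at h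
    exact h
  -- The defining relation is a sum over all vertices; multiplication by `e_i` extracts the part at
  -- `i`.
  have h2 := congrArg (· * idem τ i) h
  simp only [Finset.sum_mul, smul_mul_assoc] at h2
  rw [Finset.sum_eq_single i] at h2
  · rw [Finset.sum_eq_single i (f := fun l => aeval (loopSum τ) (τ l) * idem τ l * idem τ i)] at h2
    · simpa only [mul_assoc, idem_mul_self, arrowOf_mul_idem] using h2
    · intro l _ hl
      rw [mul_assoc, idem_mul_of_ne τ hl, mul_zero]
    · simp
  · intro l _ hl
    refine Finset.sum_eq_zero fun j _ => Finset.sum_eq_zero fun a _ => ?_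
    rw [← arrowOf_mul_idem τ a.swap, mul_assoc, mul_assoc, idem_mul_of_ne τ hl, mul_zero,
      mul_zero, smul_zero]
  · simp

theorem mk_loop (i : V) : RingQuot.mkAlgHom ℂ (Rel V τ) (loop i) = loopSum τ * idem τ i := by
  rw [← uElt_mul_e, map_mul]
  rfl

@[elab_as_elim]
theorem induction {P : NOneQuiverAlgebra V τ → Prop} (b : NOneQuiverAlgebra V τ)
    (hadd : ∀ x y, P x → P y → P (x + y)) (hsmul : ∀ (c : ℂ) x, P x → P (c • x))
    (hmul : ∀ x y, P x → P y → P (x * y)) (hidem : ∀ i, P (idem τ i))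
    (harrow : ∀ {i j : V} (a : Dbl i j), P (arrowOf τ a)) (hloop : P (loopSum τ)) : P b := by
  obtain ⟨x, rfl⟩ := RingQuot.mkAlgHom_surjective ℂ (Rel V τ) b
  induction x using PathAlgebra.induction_arrow with
  | hadd x y hx hy => rw [map_add]; exact hadd _ _ hx hy
  | hsmul c x hx => rw [map_smul]; exact hsmul c _ hx
  | hmul x y hx hy => rw [map_mul]; exact hmul _ _ hx hy
  | h0 => simpa using hsmul 0 _ hloop
  | hvertex i => exact hidem i
  | harrow a =>
    rename_i i j
    change HatQuiver.Arrow (V := V) i j at a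
    cases a with
    | arr a => exact harrow (.inl a)
    | rev a => exact harrow (.inr a)
    | loop => exact Eq.mpr (congrArg P (mk_loop τ i)) (hmul _ _ hloop (hidem _))

end NOneQuiverAlgebra

end

/-! ### The deformed skew group algebra acting by block matrices over the quiver algebra -/

noncomputable section

open Representation NOneQuiverAlgebra

namespace IsDualSystem

variable {G : Subgroup (Matrix.SpecialLinearGroup (Fin 2) ℂ)} [Fintype G] {I : Type u} [Fintype I]
  [DecidableEq I]
  [Quiver.{v} I] [∀ i j : I, Fintype (i ⟶ j)] {δ : I → ℕ}
  (ρ : ∀ i, Representation ℂ G (Fin (δ i) → ℂ))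
  (c : ∀ {i j : I}, Dbl i j → Fin 2 → Matrix (Fin (δ j)) (Fin (δ i)) ℂ) (τ : I → ℂ[X])

/-- The action of the group by block diagonal matrices over the `N = 1` quiver algebra. -/
def blockRep : G →ₙ* Matrix (Σ i, Fin (δ i)) (Σ i, Fin (δ i)) (NOneQuiverAlgebra I τ) where
  -- Since `e_i` is placed in the block of `ρ_i`, the identity of the group acts as a proper
  -- idempotent in general, and the map is only multiplicative; its natural target is the corner at
  -- that idempotent.
  toFun g := ∑ i, blk i i ((ρ i).mat g) (idem τ i)
  map_mul' g h := by
    rw [Finset.mul_sum]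
    refine Finset.sum_congr rfl fun i _ => ?_
    rw [sum_blk_mul_blk, mat_mul, idem_mul_self]

theorem blockRep_apply (g : G) : blockRep ρ τ g = ∑ i, blk i i ((ρ i).mat g) (idem τ i) := rfl

/-- The action of `x` and `y` by block matrices over the `N = 1` quiver algebra. -/
def blockVar (k : Fin 2) : Matrix (Σ i, Fin (δ i)) (Σ i, Fin (δ i)) (NOneQuiverAlgebra I τ) :=
  ∑ i, ∑ j, ∑ a : Dbl i j, blk j i (natRot (c a) k) (arrowOf τ a)

theorem blockRep_mul_blk {i j : I} (g : G) (M : Matrix (Fin (δ j)) (Fin (δ i)) ℂ)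
    {b : NOneQuiverAlgebra I τ} (hb : idem τ j * b = b) :
    blockRep ρ τ g * blk j i M b = blk j i ((ρ j).mat g * M) b := by
  rw [blockRep_apply, sum_blk_mul_blk, hb]

theorem blk_mul_blockRep {i j : I} (g : G) (M : Matrix (Fin (δ j)) (Fin (δ i)) ℂ)
    {b : NOneQuiverAlgebra I τ} (hb : b * idem τ i = b) :
    blk j i M b * blockRep ρ τ g = blk j i (M * (ρ i).mat g) b := by
  rw [blockRep_apply, blk_mul_sum_blk, hb]

theorem blockVar_mul_one (k : Fin 2) : blockVar c τ k * blockRep ρ τ 1 = blockVar c τ k := by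
  simp only [blockVar, Finset.sum_mul]
  refine Finset.sum_congr rfl fun i _ => Finset.sum_congr rfl fun j _ =>
    Finset.sum_congr rfl fun a _ => ?_
  rw [blk_mul_blockRep ρ τ 1 _ (arrowOf_mul_idem τ a), mat_one, Matrix.mul_one]

variable {ρ c} (hc : IsDualSystem ρ c)

include hc in
theorem blockRep_mul_blockVar (g : G) (k : Fin 2) : blockRep ρ τ g * blockVar c τ k =
    ∑ l, (g : Matrix.SpecialLinearGroup (Fin 2) ℂ).1 l k • (blockVar c τ l * blockRep ρ τ g) := by
  simp only [blockVar, Finset.sum_mul, Finset.mul_sum, Finset.smul_sum]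
  refine Eq.trans (Finset.sum_congr rfl fun i _ => ?_) Finset.sum_comm
  refine Eq.trans (Finset.sum_congr rfl fun j _ => ?_) Finset.sum_comm
  refine Eq.trans (Finset.sum_congr rfl fun a _ => ?_) Finset.sum_comm
  rw [blockRep_mul_blk ρ τ g _ (idem_mul_arrowOf τ a), mat_mul_natRot (hc.mem a) g k, map_sum,
    LinearMap.sum_apply]
  refine Finset.sum_congr rfl fun l _ => ?_
  rw [map_smul, LinearMap.smul_apply, blk_mul_blockRep ρ τ g _ (arrowOf_mul_idem τ a)]

variable (c) in
theorem blockVar_mul_blockVar (k l : Fin 2) : blockVar c τ k * blockVar c τ l =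
    ∑ i, ∑ j, ∑ m, ∑ a : Dbl m j, ∑ b : Dbl i m,
      blk j i (natRot (c a) k * natRot (c b) l) (arrowOf τ a * arrowOf τ b) := by
  have h : ∀ {i j m : I} (b : Dbl i m), (∑ m', ∑ a : Dbl m' j, blk j m' (natRot (c a) k) (arrowOf τ a)) *
      blk m i (natRot (c b) l) (arrowOf τ b) =
      ∑ a : Dbl m j, blk j i (natRot (c a) k * natRot (c b) l) (arrowOf τ a * arrowOf τ b) := by
    intro i j m b
    rw [Finset.sum_mul, Finset.sum_eq_single m, Finset.sum_mul]
    · exact Finset.sum_congr rfl fun a _ => blk_mul_blk _ _ _ _ _ _ _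
    · intro m' _ hm
      rw [Finset.sum_mul]
      exact Finset.sum_eq_zero fun a _ => blk_mul_blk_of_ne _ hm _ _ _ _ _
    · simp
  have h2 : blockVar c τ k = ∑ j, ∑ m', ∑ a : Dbl m' j, blk j m' (natRot (c a) k) (arrowOf τ a) :=
    Finset.sum_comm
  rw [h2, blockVar, Finset.mul_sum]
  refine Finset.sum_congr rfl fun i _ => ?_
  rw [Finset.sum_mul]
  refine Finset.sum_congr rfl fun j _ => ?_
  rw [Finset.mul_sum]
  refine Finset.sum_congr rfl fun m _ => ?_
  rw [Finset.mul_sum, Finset.sum_comm]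
  exact Finset.sum_congr rfl fun b _ => h b

variable (hρ : IsCompleteIrreps ρ)

-- Schur orthogonality between the blocks: the unit of `ρ i` vanishes in every other `ρ j`.
include hρ in
theorem sum_smul_blockRep (i : I) (p q : Fin (δ i)) :
    ∑ g : G, ((δ i : ℂ) / Fintype.card G * (ρ i).mat g⁻¹ q p) • blockRep ρ τ g =
      blk i i (Matrix.single p q 1) (idem τ i) := by
  have h : ∀ j, ∑ g : G, ((δ i : ℂ) / Fintype.card G * (ρ i).mat g⁻¹ q p) •
      blk j j ((ρ j).mat g) (idem τ j) =
      blk j j (matUnit (ρ j).matHom (ρ i) p q) (idem τ j) := fun j => by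
    rw [matUnit, map_sum, LinearMap.sum_apply]
    exact Finset.sum_congr rfl fun g _ => by rw [map_smul, LinearMap.smul_apply]; rfl
  simp only [blockRep_apply, Finset.smul_sum]
  rw [Finset.sum_comm, Finset.sum_congr rfl fun j _ => h j, Finset.sum_eq_single i,
    hρ.matUnit_matHom_self]
  · intro j _ hj
    rw [hρ.matUnit_matHom_of_ne hj.symm, map_zero, LinearMap.zero_apply]
  · simp

-- Blocks with different ends vanish by `comp_of_ne`. On the diagonal `comp_self` and duality leave
-- `1/δ_i` times the signed sum of the `a a*`, to which the relation at `i` applies.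
include hc hρ in
theorem blockVar_commutator :
    blockVar c τ 0 * blockVar c τ 1 - blockVar c τ 1 * blockVar c τ 0 =
      ∑ i, blk i i ((δ i : ℂ)⁻¹ • 1) (aeval (loopSum τ) (τ i) * idem τ i) := by
  simp only [blockVar_mul_blockVar, ← Finset.sum_sub_distrib, ← LinearMap.sub_apply, ← map_sub]
  refine Finset.sum_congr rfl fun i _ => ?_
  rw [Finset.sum_eq_single i]
  · rw [← sum_sign_smul_arrowOf_mul]
    simp only [map_sum, map_smul]
    refine Finset.sum_congr rfl fun m _ => Finset.sum_congr rfl fun a _ => ?_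
    simp only [hc.comp_self hρ]
    rw [Finset.sum_eq_single a.swap]
    · rw [hc.pairing_swap, div_eq_mul_inv, mul_smul, map_smul, LinearMap.smul_apply, map_smul]
    · intro b _ hb
      rw [hc.pairing_of_ne a b hb, zero_div, zero_smul, map_zero, LinearMap.zero_apply]
    · simp
  · intro j _ hj
    refine Finset.sum_eq_zero fun m _ => Finset.sum_eq_zero fun a _ =>
      Finset.sum_eq_zero fun b _ => ?_
    rw [hc.comp_of_ne hρ hj.symm, map_zero, LinearMap.zero_apply]
  · simp

theorem scalar_loopSum_comm
    (s : Matrix (Σ i, Fin (δ i)) (Σ i, Fin (δ i)) (NOneQuiverAlgebra I τ)) :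
    Matrix.scalar (Σ i, Fin (δ i)) (loopSum τ) * s = s * Matrix.scalar _ (loopSum τ) := by
  ext p q
  simp [loopSum_comm]

variable (c) in
theorem blk_mul_blockVar_mul_blk (k : Fin 2) {i j : I} (M : Matrix (Fin (δ j)) (Fin (δ j)) ℂ)
    (N : Matrix (Fin (δ i)) (Fin (δ i)) ℂ) :
    blk j j M (idem τ j) * blockVar c τ k * blk i i N (idem τ i) =
      ∑ a : Dbl i j, blk j i (M * natRot (c a) k * N) (arrowOf τ a) := by
  simp only [blockVar, Finset.mul_sum, Finset.sum_mul]
  rw [Finset.sum_eq_single i, Finset.sum_eq_single j]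
  · refine Finset.sum_congr rfl fun a _ => ?_
    rw [blk_mul_blk, blk_mul_blk, idem_mul_arrowOf, arrowOf_mul_idem]
  · intro j' _ hj
    exact Finset.sum_eq_zero fun a _ => by rw [blk_mul_blk_of_ne _ hj.symm, zero_mul]
  · simp
  · intro i' _ hi
    exact Finset.sum_eq_zero fun j' _ => Finset.sum_eq_zero fun a _ => by
      rw [mul_assoc, blk_mul_blk_of_ne _ hi, mul_zero]
  · simp

/-- The action of the deformed skew group algebra on the columns of block matrices. -/
theorem exists_block_hom (hc : IsDualSystem ρ c) (hρ : IsCompleteIrreps ρ) :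
    ∃ φ : DeformedSkewAlgebra G (centralElement ρ τ) →ₙₐ[ℂ]
      Matrix (Σ i, Fin (δ i)) (Σ i, Fin (δ i)) (NOneQuiverAlgebra I τ),
      (∀ i p q, φ (matUnit (groupElt G _) (ρ i) p q) =
        blk i i (Matrix.single p q 1) (idem τ i)) ∧
      (∀ k, φ (DeformedSkewAlgebra.var G _ k) = blockVar c τ k) ∧
      ∀ i j M b, idem τ j * b = b →
        φ (DeformedSkewAlgebra.param G _) * blk j i M b = blk j i M (loopSum τ * b) := by
  have haeval : ∀ r : ℂ[X], aeval (Matrix.scalar (Σ i, Fin (δ i)) (loopSum τ)) r =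
      Matrix.scalar (Σ i, Fin (δ i)) (aeval (loopSum τ) r) := fun r =>
    aeval_algHom_apply (Matrix.scalarAlgHom (Σ i, Fin (δ i)) ℂ) (loopSum τ) r
  obtain ⟨φ, h1, h2, h3⟩ := DeformedSkewAlgebra.exists_corner_lift ρ τ (blockRep ρ τ)
    (blockVar c τ) (scalar_loopSum_comm τ) (blockVar_mul_one ρ c τ)
    (hc.blockRep_mul_blockVar τ) (by
      rw [hc.blockVar_commutator τ hρ]
      refine Finset.sum_congr rfl fun i _ => ?_
      rw [← Matrix.sum_single_one, Finset.smul_sum, map_sum, LinearMap.sum_apply]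
      refine Finset.sum_congr rfl fun p _ => ?_
      rw [sum_smul_blockRep τ hρ, haeval, scalar_mul_blk, map_smul, LinearMap.smul_apply])
  refine ⟨φ, fun i p q => ?_, h2, fun i j M b hb => ?_⟩
  · simp only [matUnit, map_sum, map_smul, h1]
    exact sum_smul_blockRep τ hρ i p q
  · rw [h3, mul_assoc, blockRep_mul_blk ρ τ 1 M hb, scalar_mul_blk, mat_one, Matrix.one_mul]

end IsDualSystem

end

noncomputable section

open Representation NOneQuiverAlgebra

theorem NOneQuiverAlgebra.Dbl.sign_mul_sign {V : Type u} [Quiver.{v} V] {i j : V} (a : Dbl i j) :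
    a.sign * a.sign = 1 := by
  cases a <;> simp [Dbl.sign]

namespace IsDualSystem

/-! ## The quiver algebra as a corner of the deformed skew group algebra -/

section Corner

variable {G : Subgroup (Matrix.SpecialLinearGroup (Fin 2) ℂ)} [Fintype G] {I : Type u} [Fintype I]
  [Quiver.{v} I] [∀ i j : I, Fintype (i ⟶ j)] {δ : I → ℕ}
  {ρ : ∀ i, Representation ℂ G (Fin (δ i) → ℂ)}
  {c : ∀ {i j : I}, Dbl i j → Fin 2 → Matrix (Fin (δ j)) (Fin (δ i)) ℂ} (hc : IsDualSystem ρ c)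
  (hρ : IsCompleteIrreps ρ) (τ : I → ℂ[X]) (o : ∀ i, Fin (δ i))

include hc hρ

/-- An arrow `a` goes to the element built from the dual vector `c_{a*}`. The sign is the inverse of
`⟨c_a, c_{a*}⟩`, so that the expansion of `E x_k E` in these images has the entries of `natRot (c
a)` as coefficients. -/
theorem exists_hom_deformedSkewAlgebra :
    ∃ ψ : NOneQuiverAlgebra I τ →ₙₐ[ℂ] DeformedSkewAlgebra G (centralElement ρ τ),
      (∀ i, ψ (idem τ i) = matUnit (groupElt G _) (ρ i) (o i) (o i)) ∧
      (∀ (i j : I) (a : Dbl i j), ψ (arrowOf τ a) = a.sign •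
        arrowElt (groupElt G _) (DeformedSkewAlgebra.var G _) (ρ i) (ρ j) (o i) (o j) (c a.swap)) ∧
      ψ (loopSum τ) = DeformedSkewAlgebra.param G _ *
        ∑ i, matUnit (groupElt G _) (ρ i) (o i) (o i) := by
  obtain ⟨ψ, -, h1, h2, h3⟩ := exists_corner_lift (U := DeformedSkewAlgebra.param G _) τ
    (fun i => matUnit (groupElt G (centralElement ρ τ)) (ρ i) (o i) (o i))
    (fun {i j} a => a.sign • arrowElt (groupElt G (centralElement ρ τ))
      (DeformedSkewAlgebra.var G _) (ρ i) (ρ j) (o i) (o j) (c a.swap))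
    (fun i => by rw [hρ.matUnit_mul_self, if_pos rfl])
    (fun i j h => hρ.matUnit_mul_of_ne _ h _ _ _ _)
    (fun a => by rw [mul_smul_comm, matUnit_mul_arrowElt hρ])
    (fun a => by rw [smul_mul_assoc, arrowElt_mul_matUnit hρ])
    (DeformedSkewAlgebra.param_comm G _)
    (hc.sum_sign_smul_mul hρ (DeformedSkewAlgebra.groupElt_mul_var G _) (fun _ => rfl)
      (DeformedSkewAlgebra.param_comm G _)
      ((DeformedSkewAlgebra.var_mul_var_sub G _).trans
        (evalGroupAlgebra_centralElement _ _ ρ τ)))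
  exact ⟨ψ, h1, h2, h3⟩

variable {ψ : NOneQuiverAlgebra I τ →ₙₐ[ℂ] DeformedSkewAlgebra G (centralElement ρ τ)}
  (hψe : ∀ i, ψ (idem τ i) = matUnit (groupElt G _) (ρ i) (o i) (o i))
  (hψa : ∀ (i j : I) (a : Dbl i j), ψ (arrowOf τ a) = a.sign •
    arrowElt (groupElt G _) (DeformedSkewAlgebra.var G _) (ρ i) (ρ j) (o i) (o j) (c a.swap))
  (hψu : ψ (loopSum τ) = DeformedSkewAlgebra.param G _ *
    ∑ i, matUnit (groupElt G _) (ρ i) (o i) (o i))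

include hψe hψa hψu

/-- The claim is made for all `p` and `q`, not only for the chosen indices, so that it passes to
products in the induction on `a`. -/
theorem matUnit_mul_mul_matUnit_mem_range (a : DeformedSkewAlgebra G (centralElement ρ τ)) :
    ∀ i j (p : Fin (δ i)) (q : Fin (δ j)),
    matUnit (groupElt G _) (ρ i) (o i) p * a * matUnit (groupElt G _) (ρ j) q (o j) ∈
      NonUnitalAlgHom.range ψ := by
  have h0 : ∀ i j (p : Fin (δ i)) (q : Fin (δ j)), matUnit (groupElt G (centralElement ρ τ)) (ρ i) (o i) p *
      matUnit (groupElt G _) (ρ j) q (o j) ∈ NonUnitalAlgHom.range ψ := by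
    intro i j p q
    by_cases hij : i = j
    · subst hij
      rw [hρ.matUnit_mul_self]
      split_ifs
      · exact ⟨_, hψe i⟩
      · exact zero_mem _
    · rw [hρ.matUnit_mul_of_ne _ hij]
      exact zero_mem _
  have hu : ∀ j, DeformedSkewAlgebra.param G (centralElement ρ τ) * matUnit (groupElt G _) (ρ j) (o j) (o j) =
      ψ (loopSum τ * idem τ j) := by
    classical
    intro j
    rw [map_mul, hψu, hψe, mul_assoc, Finset.sum_mul, Finset.sum_eq_single j,
      hρ.matUnit_mul_self, if_pos rfl]
    · exact fun i _ h => hρ.matUnit_mul_of_ne _ h _ _ _ _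
    · simp
  induction a using DeformedSkewAlgebra.induction with
  | hadd x y hx hy =>
    intro i j p q
    rw [mul_add, add_mul]
    exact add_mem (hx i j p q) (hy i j p q)
  | hmul x y hx hy =>
    intro i j p q
    -- Splitting `1` between `x` and `y` turns a compressed product into a sum of products of
    -- compressed factors.
    have h : x * y = ∑ l, ∑ r, (x * matUnit (groupElt G _) (ρ l) r (o l)) *
        (matUnit (groupElt G _) (ρ l) (o l) r * y) := by
      conv_lhs => rw [← mul_one x, ← hρ.sum_matUnit (groupElt G _)]
      simp only [Finset.mul_sum, Finset.sum_mul]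
      refine Finset.sum_congr rfl fun l _ => Finset.sum_congr rfl fun r _ => ?_
      have h : matUnit (groupElt G (centralElement ρ τ)) (ρ l) r r =
          matUnit (groupElt G _) (ρ l) r (o l) * matUnit (groupElt G _) (ρ l) (o l) r := by
        rw [hρ.matUnit_mul_self, if_pos rfl]
      rw [h]
      simp only [mul_assoc]
    rw [h]
    simp only [Finset.mul_sum, Finset.sum_mul]
    refine sum_mem fun l _ => sum_mem fun r _ => ?_
    have := mul_mem (hx i l p r) (hy l j r q)
    simpa only [mul_assoc] using this
  | halg r =>
    intro i j p q
    rw [Algebra.algebraMap_eq_smul_one, mul_smul_comm, mul_one, smul_mul_assoc]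
    exact SMulMemClass.smul_mem r (h0 i j p q)
  | hg g =>
    intro i j p q
    rw [matUnit_mul, Finset.sum_mul]
    refine sum_mem fun r _ => ?_
    rw [smul_mul_assoc]
    exact SMulMemClass.smul_mem _ (h0 i j r q)
  | hvar k =>
    intro i j p q
    rw [hc.matUnit_mul_mul_matUnit o (DeformedSkewAlgebra.groupElt_mul_var G _)]
    refine sum_mem fun a _ => SMulMemClass.smul_mem _ ?_
    exact ⟨_, hψa j i a⟩
  | hparam =>
    intro i j p q
    rw [← DeformedSkewAlgebra.param_comm, mul_assoc]
    have h : matUnit (groupElt G (centralElement ρ τ)) (ρ i) (o i) p =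
        matUnit (groupElt G _) (ρ i) (o i) (o i) * matUnit (groupElt G _) (ρ i) (o i) p := by
      rw [hρ.matUnit_mul_self, if_pos rfl]
    rw [h, mul_assoc, ← mul_assoc, hu i]
    exact mul_mem ⟨_, rfl⟩ (h0 i j p q)

/-- The block action `φ` is a left inverse of `ψ` up to the map `θ`, which records each `e_j b e_i`
in its own block and therefore loses nothing. -/
theorem injective_hom : Function.Injective ψ := by
  classical
  obtain ⟨φ, hφe, hφx, hφu⟩ := exists_block_hom τ hc hρ
  let θ : NOneQuiverAlgebra I τ → Matrix (Σ i, Fin (δ i)) (Σ i, Fin (δ i)) (NOneQuiverAlgebra I τ) :=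
    fun b => ∑ j, ∑ i, blk j i (Matrix.single (o j) (o i) 1) (idem τ j * b * idem τ i)
  have hsingle : ∀ i j l : I, Matrix.single (o j) (o i) (1 : ℂ) *
      Matrix.single (o i) (o l) (1 : ℂ) = Matrix.single (o j) (o l) 1 := fun i j l => by
    rw [Matrix.single_mul_single_same, mul_one]
  have key : ∀ b, φ (ψ b) = θ b := by
    intro b
    induction b using NOneQuiverAlgebra.induction with
    | hadd x y hx hy =>
      simp only [θ, map_add, hx, hy, mul_add, add_mul, Finset.sum_add_distrib]
    | hsmul r x hx =>
      simp only [θ, map_smul, hx, mul_smul_comm, smul_mul_assoc, Finset.smul_sum]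
    | hmul x y hx hy =>
      rw [map_mul ψ, map_mul φ, hx, hy]
      have h1 : ∀ j m i, (∑ l, blk j l (Matrix.single (o j) (o l) 1) (idem τ j * x * idem τ l)) *
          blk m i (Matrix.single (o m) (o i) 1) (idem τ m * y * idem τ i) =
          blk j i (Matrix.single (o j) (o i) 1) (idem τ j * x * idem τ m * y * idem τ i) := by
        intro j m i
        rw [Finset.sum_mul, Finset.sum_eq_single m, blk_mul_blk, hsingle, mul_assoc (idem τ m),
          ← mul_assoc, mul_assoc (_ * x), idem_mul_self, ← mul_assoc]
        · exact fun l _ hl => blk_mul_blk_of_ne _ hl _ _ _ _ _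
        · simp
      simp only [θ]
      rw [Finset.sum_mul]
      refine Finset.sum_congr rfl fun j _ => ?_
      simp only [Finset.mul_sum]
      rw [Finset.sum_comm]
      refine Finset.sum_congr rfl fun i _ => ?_
      simp only [h1]
      simp only [← map_sum, ← Finset.sum_mul, ← Finset.mul_sum, sum_idem, one_mul, mul_assoc]
    | hidem i =>
      rw [hψe, hφe]
      simp only [θ]
      rw [Finset.sum_eq_single i, Finset.sum_eq_single i, idem_mul_self, idem_mul_self]
      · intro j _ hj
        rw [idem_mul_self, idem_mul_of_ne τ hj.symm, map_zero]
      · simp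
      · intro j _ hj
        exact Finset.sum_eq_zero fun l _ => by
          rw [idem_mul_of_ne τ hj, zero_mul, map_zero]
      · simp
    | harrow a =>
      rename_i i j
      have h1 : ∀ k p q, φ (matUnit (groupElt G _) (ρ j) (o j) p * DeformedSkewAlgebra.var G _ k *
          matUnit (groupElt G _) (ρ i) q (o i)) = ∑ b : Dbl i j, natRot (c b) k p q •
            blk j i (Matrix.single (o j) (o i) 1) (arrowOf τ b) := fun k p q => by
        rw [map_mul, map_mul, hφe, hφe, hφx, blk_mul_blockVar_mul_blk]
        refine Finset.sum_congr rfl fun b _ => ?_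
        rw [Matrix.single_mul_mul_single, one_mul, mul_one, ← LinearMap.smul_apply, ← map_smul,
          Matrix.smul_single, smul_eq_mul, mul_one]
      -- Each variable acts through all arrows `b` at once; pairing with `c_{a*}` selects `b = a`,
      -- and the resulting sign cancels the one in `ψ`.
      have h2 : φ (ψ (arrowOf τ a)) = a.sign • ∑ b : Dbl i j,
          natPairing (δ i) (δ j) (c b) (c a.swap) •
            blk j i (Matrix.single (o j) (o i) 1) (arrowOf τ b) := by
        rw [hψa, map_smul, arrowElt_apply]
        simp only [sandwich_apply, map_sum, map_smul, h1, ← sum_natRot_mul, Finset.sum_smul,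
          Finset.smul_sum, smul_smul]
        refine Eq.trans (Finset.sum_congr rfl fun k _ => ?_) Finset.sum_comm
        refine Eq.trans (Finset.sum_congr rfl fun p _ => ?_) Finset.sum_comm
        exact Finset.sum_comm
      rw [h2, Finset.sum_eq_single a, hc.pairing_swap, smul_smul, Dbl.sign_mul_sign, one_smul]
      · simp only [θ]
        rw [Finset.sum_eq_single j, Finset.sum_eq_single i, idem_mul_arrowOf, arrowOf_mul_idem]
        · intro l _ hl
          rw [← arrowOf_mul_idem, mul_assoc, mul_assoc, idem_mul_of_ne τ hl.symm, mul_zero,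
            mul_zero, map_zero]
        · simp
        · intro l _ hl
          refine Finset.sum_eq_zero fun m _ => ?_
          rw [← idem_mul_arrowOf, ← mul_assoc, idem_mul_of_ne τ hl, zero_mul, zero_mul, map_zero]
        · simp
      · intro b _ hb
        rw [hc.pairing_of_ne b a.swap fun h => hb (by simpa using (congrArg Sum.swap h).symm),
          zero_smul]
      · simp
    | hloop =>
      simp only [θ]
      rw [hψu, map_mul, map_sum]
      simp only [hφe]
      rw [Finset.mul_sum]
      refine Finset.sum_congr rfl fun i _ => ?_
      rw [hφu i i _ _ (idem_mul_self τ i), Finset.sum_eq_single i, ← loopSum_comm, mul_assoc,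
        idem_mul_self]
      · intro j _ hj
        rw [← loopSum_comm, mul_assoc, idem_mul_of_ne τ hj.symm, mul_zero, map_zero]
      · simp
  rw [injective_iff_map_eq_zero]
  intro b hb
  have h := key b
  rw [hb, map_zero] at h
  have h2 := eq_zero_of_sum_blk_eq_zero h.symm
  -- `b` is the sum of its Peirce components `e_j b e_i`, all of which vanish.
  rw [← one_mul b, ← mul_one (1 * b), ← sum_idem τ, Finset.sum_mul, Finset.sum_mul]
  refine Finset.sum_eq_zero fun j _ => ?_
  rw [Finset.mul_sum]
  exact Finset.sum_eq_zero fun i _ => h2 j i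

theorem isFullCorner : IsFullCorner ψ := by
  classical
  have h1 : ψ 1 = ∑ i, matUnit (groupElt G _) (ρ i) (o i) (o i) := by
    rw [← sum_idem τ, map_sum]
    exact Finset.sum_congr rfl fun i _ => hψe i
  refine ⟨hc.injective_hom hρ τ o hψe hψa hψu, fun a => ?_, ?_⟩
  · have h : ψ 1 * a * ψ 1 ∈ NonUnitalAlgHom.range ψ := by
      rw [h1, Finset.sum_mul, Finset.sum_mul]
      refine sum_mem fun i _ => ?_
      rw [Finset.mul_sum]
      exact sum_mem fun j _ =>
        hc.matUnit_mul_mul_matUnit_mem_range hρ τ o hψe hψa hψu a i j (o i) (o j)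
    exact h
  · let e := Fintype.equivFin (Σ i, Fin (δ i))
    -- Fullness is witnessed by `E^i_{p o_i} (ψ 1) E^i_{o_i p} = E^i_{pp}`, summed over all pairs
    -- `(i, p)`.
    refine ⟨_, fun k => matUnit (groupElt G _) (ρ (e.symm k).1) (e.symm k).2 (o _),
      fun k => matUnit (groupElt G _) (ρ (e.symm k).1) (o _) (e.symm k).2, ?_⟩
    rw [e.symm.sum_comp fun n => matUnit (groupElt G (centralElement ρ τ)) (ρ n.1) n.2 (o n.1) *
      ψ 1 * matUnit (groupElt G _) (ρ n.1) (o n.1) n.2, Fintype.sum_sigma,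
      ← hρ.sum_matUnit (groupElt G _)]
    refine Finset.sum_congr rfl fun i _ => Finset.sum_congr rfl fun p _ => ?_
    rw [h1, Finset.mul_sum, Finset.sum_eq_single i, hρ.matUnit_mul_self, if_pos rfl,
      hρ.matUnit_mul_self, if_pos rfl]
    · exact fun j _ hj => hρ.matUnit_mul_of_ne _ hj.symm _ _ _ _
    · simp

end Corner

end IsDualSystem

/-! ### The trivial representation and the final assembly -/

theorem IsCompleteIrreps.matUnit_of_isTrivial {H : Type*} [Group H] [Fintype H] {I : Type*}
    {δ : I → ℕ} {ρ : ∀ i, Representation ℂ H (Fin (δ i) → ℂ)} (hρ : IsCompleteIrreps ρ) {i : I}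
    (hi : (ρ i).IsTrivial) {S : Type*} [Ring S] [Algebra ℂ S] (f : H →* S) (p : Fin (δ i)) :
    matUnit f (ρ i) p p = (Fintype.card H : ℂ)⁻¹ • ∑ g, f g := by
  have hmat : ∀ g, (ρ i).mat g = 1 := fun g => by
    apply Matrix.toLin'.injective
    rw [toLin'_mat, hi.out g, Matrix.toLin'_one]
  -- Every matrix commutes with a trivial action, so by Schur every matrix is scalar; an elementary
  -- matrix off the diagonal is not. Hence the dimension is one.
  have hsub : ∀ q, q = p := by
    intro q
    by_contra hq
    have h := eq_trace_smul_one_of_comm (hρ.irreducible i) (Matrix.single q p 1) fun g => by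
      rw [hmat, Matrix.mul_one, Matrix.one_mul]
    have h2 := congrFun (congrFun h q) p
    simp [hq] at h2
  have hd : δ i = 1 := by
    have : Subsingleton (Fin (δ i)) := ⟨fun a b => (hsub a).trans (hsub b).symm⟩
    have h1 := Fintype.card_le_one_iff_subsingleton.mpr this
    have h2 := hρ.dim_pos i
    rw [Fintype.card_fin] at h1
    omega
  rw [matUnit, Finset.smul_sum]
  refine Finset.sum_congr rfl fun g _ => ?_
  rw [hmat, Matrix.one_apply_eq, hd]
  simp

end

theorem mainTheorem6
    (G : Subgroup (Matrix.SpecialLinearGroup (Fin 2) ℂ)) [Fintype G]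
    {I : Type u} [Fintype I] [Quiver.{v} I] [∀ i j : I, Fintype (i ⟶ j)]
    {δ : I → ℕ} (ρ : ∀ i, Representation ℂ G (Fin (δ i) → ℂ))
    (hρ : IsCompleteIrreps ρ)
    (i₀ : I) (hi₀ : (ρ i₀).IsTrivial)
    (hQ : IsMcKayQuiver G ρ) :
    Set.BijOn (centralElement ρ) Set.univ (Set.center (MonoidAlgebra ℂ[X] G)) ∧
    ∀ τ : I → ℂ[X],
      IsMoritaEquivalent ℂ (DeformedSkewAlgebra G (centralElement ρ τ)) (NOneQuiverAlgebra I τ) ∧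
      Nonempty
        ((isIdempotentElem_averaging G (centralElement ρ τ)).Corner ≃ₐ[ℂ]
          (NOneQuiverAlgebra.isIdempotentElem_idem τ i₀).Corner) := by
  refine ⟨hρ.bijOn_centralElement, fun τ => ?_⟩
  obtain ⟨c, hc⟩ := hQ.exists_isDualSystem
  -- Any index in each block would do; positivity of the dimension provides one.
  let o : ∀ i, Fin (δ i) := fun i => ⟨0, hρ.dim_pos i⟩
  obtain ⟨ψ, h1, h2, h3⟩ := hc.exists_hom_deformedSkewAlgebra hρ τ o
  have h := hc.isFullCorner hρ τ o h1 h2 h3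
  exact ⟨h.isMoritaEquivalent, h.nonempty_corner_algEquiv _ _
    ((h1 i₀).trans (hρ.matUnit_of_isTrivial hi₀ _ _))⟩
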